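/- **Setting.** Let $\mathcal G$ be a first order structure in a language $L$ and $\mathcal G^*\succ\mathcal G$ a monster model: for a strong limit cardinal $\kappa>|L|+\aleph_0$, $\mathcal G^*$ is $\kappa$-saturated and strongly $\kappa$-homogeneous; "small" and "bounded" mean of cardinality $<\kappa$. Let $G$ be a group acting by automorphisms on an abelian group $A$, where $G$, $A$ and the action are $\emptyset$-definable in $\mathcal G$. Let $B\subset\mathcal G$ be finite and let $h\colon G\times G\to A$ be a $B$-definable 2-cocycle, i.e. $h(x,y)+h(xy,z)=h(x,yz)+x\cdot h(y,z)$ and $h(x,e)=h(e,x)=0$ for all $x,y,z \in G$, with finite image contained in $\mathrm{dcl}(B)$. Let $A_0\le A$ be the subgroup generated by the image of $h$. Write $G^*,A^*,h^*$ for the interpretations in $\mathcal G^*$, and let $\widetilde{G^*}=A^*\times G^*$ be the group with multiplication $(a_1,g_1)(a_2,g_2)=(a_1+g_1\cdot a_2+h^*(g_1,g_2),\,g_1g_2)$; identify $A^*$ with $A^*\times\{e\}\le\widetilde{G^*}$. Let $A_1^*\le A^*$ be a subgroup of bounded index which is type-definable over $B$ and invariant under the action of $G^*$. For $X\in\{G^*,\widetilde{G^*}\}$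 let $X^{000}_B$ be the smallest $\mathrm{Aut}(\mathcal G^*/B)$-invariant subgroup of $X$ of bounded index, and $X^{00}_B$ the smallest subgroup of $X$ of bounded index which is type-definable over $B$. A 2-cocycle $k\colon H\times H\to Q$, where the group $H$ acts on the abelian group $Q$, is *split* if there is a function $f\colon H\to Q$ with $f(e)=0$ and $k(x,y)=f(x)+x\cdot f(y)-f(xy)$ for all $x,y\in H$. For $H\le G^*$ let $\overline{h^*}_{|H\times H}\colon H\times H\to A_0/(A_1^*\cap A_0)$ be the 2-cocycle induced by $h^*$. An infinite group $G$ is *absolutely connected* if for every first order expansion $(G,\cdot,\ldots)$ of the group $G$, with $G^*$ the interpretation of $G$ in a monster model, ${G^*}^{000}$ exists (that is, ${G^*}^{000}_C$ does not depend on the small parameter set $C$) and equals $G^*$. It has *finite commutator width* if there is $k$ such that every element of $[G,G]$ is a product of at most $k$ commutators. **Proposition.** (i) Assume that $\mathrm{Hom}\left({G^*}^{000}_B,\,A_0/(A_1^*\cap A_0)\right)$ is trivial. Then the induced 2-cocycle $\overline{h^*}_{|{G^*}^{000}_B\times{G^*}^{000}_B}\colon{G^*}^{000}_B\times{G^*}^{000}_B\to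 A_0/(A_1^*\cap A_0)$ is non-split if and only if $\widetilde{G^*}^{000}_B\cap A^*\not\subseteq A_1^*$. (ii) Assume that $G$ is absolutely connected of finite commutator width. Then ${G^*}^{000}_B={G^*}^{00}_B=G^*$ is perfect, and the induced 2-cocycle $\overline{h^*}_{|{G^*}^{00}_B\times{G^*}^{00}_B}\colon{G^*}^{00}_B\times{G^*}^{00}_B\to A_0/(A_1^*\cap A_0)$ is non-split if and only if $\widetilde{G^*}^{00}_B\cap A^*\not\subseteq A_1^*$. These two equivalent conditions are also equivalent to the fact that the induced 2-cocycle $\overline{h^*}\colon G^*\times G^*\to A^*/A_1^*$ is non-split. -/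

import Mathlib

open FirstOrder

universe u

namespace ConnComp

open FirstOrder.Language

/-! ### Monster models, invariant and type-definable sets, connected components -/

section Model

variable (L : FirstOrder.Language.{u, u}) {N : Type u} [L.Structure N]

/-- `κ`-saturation: every set of formulas in one variable over fewer than `κ` parameters
which is finitely satisfiable in `N` is realized in `N`. -/
def IsSaturated (κ : Cardinal.{u}) (N : Type u) [L.Structure N] : Prop :=
  ∀ C : Set N, Cardinal.mk C < κ → ∀ p : Set (L[[C]].Formula (Fin 1)),
    (∀ q : Finset (L[[C]].Formula (Fin 1)), (q : Set (L[[C]].Formula (Fin 1))) ⊆ p →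
      ∃ v : Fin 1 → N, ∀ φ ∈ q, φ.Realize v) →
    ∃ v : Fin 1 → N, ∀ φ ∈ p, φ.Realize v

/-- Strong `κ`-homogeneity: every partial elementary map of `N` with domain of size less than
`κ` extends to an automorphism of `N`. -/
def IsStronglyHomogeneous (κ : Cardinal.{u}) (N : Type u) [L.Structure N] : Prop :=
  ∀ C : Set N, Cardinal.mk C < κ → ∀ f : C → N,
    (∀ φ : L.Formula C, φ.Realize (fun c : C => (c : N)) ↔ φ.Realize f) →
    ∃ σ : N ≃[L] N, ∀ c : C, σ c = f c

/-- `N` is a monster model with respect to the strong limit cardinal `κ > |L| + ℵ₀`.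
With respect to it, "small" and "bounded" mean: of cardinality less than `κ`. -/
structure IsMonster (κ : Cardinal.{u}) (N : Type u) [L.Structure N] : Prop where
  strongLimit : κ.IsStrongLimit
  aleph0_lt : Cardinal.aleph0 < κ
  card_lt : L.card < κ
  saturated : IsSaturated L κ N
  homogeneous : IsStronglyHomogeneous L κ N

/-- The set `X` of tuples is invariant under `Aut(N / P)`. -/
def IsInvariant (P : Set N) {ι : Type} (X : Set (ι → N)) : Prop :=
  ∀ σ : N ≃[L] N, (∀ p ∈ P, σ p = p) → (fun x : ι → N => σ ∘ x) '' X = X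

/-- The set `X` of tuples is type-definable over `P`: an intersection of `P`-definable sets. -/
def IsTypeDefinable (P : Set N) {ι : Type} (X : Set (ι → N)) : Prop :=
  ∃ S : Set (Set (ι → N)), (∀ s ∈ S, P.Definable L s) ∧ X = ⋂₀ S

/-- For a group `Γ` living in `N` (via the coordinates `c`), the smallest `P`-invariant subgroup
of bounded index, as the intersection of all such subgroups. -/
def comp000 (κ : Cardinal.{u}) (P : Set N) {ι : Type} {Γ : Type u} [Group Γ] (c : Γ → ι → N) :
    Subgroup Γ :=
  sInf {H : Subgroup Γ | IsInvariant L P (c '' (H : Set Γ)) ∧ Cardinal.mk (Γ ⧸ H) < κ}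

/-- For a group `Γ` living in `N` (via the coordinates `c`), the smallest subgroup of bounded
index which is type-definable over `P`, as the intersection of all such subgroups. -/
def comp00 (κ : Cardinal.{u}) (P : Set N) {ι : Type} {Γ : Type u} [Group Γ] (c : Γ → ι → N) :
    Subgroup Γ :=
  sInf {H : Subgroup Γ | IsTypeDefinable L P (c '' (H : Set Γ)) ∧ Cardinal.mk (Γ ⧸ H) < κ}

end Model

/-- An infinite group `G` is absolutely connected if for every first order structure on the set
`G` expanding the group `G` (`μ` is the symbol for the multiplication) and every monster model
`N` extending it elementarily, the component `N^{000}` exists (i.e. `N^{000}_C` does not depend on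
the small set `C` of parameters) and is equal to `N`. The group law of `N` is the interpretation
of `μ`. -/
def AbsolutelyConnected (G : Type u) [Group G] : Prop :=
  Infinite G ∧
  ∀ (L : FirstOrder.Language.{u, u}) [L.Structure G] (μ : L.Functions 2),
    (∀ x y : G, Structure.funMap μ ![x, y] = x * y) →
  ∀ (N : Type u) [L.Structure N] [Group N],
    (∀ x y : N, Structure.funMap μ ![x, y] = x * y) →
  ∀ κ : Cardinal.{u}, IsMonster L κ N → Nonempty (G ↪ₑ[L] N) →
  ∀ C : Set N, Cardinal.mk C < κ → comp000 L κ C (fun (x : N) (_ : Unit) => x) = ⊤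

/-- `G` has finite commutator width: for some `k`, every element of the derived subgroup is a
product of at most `k` commutators. -/
def FiniteCommutatorWidth (G : Type u) [Group G] : Prop :=
  ∃ k : ℕ, ∀ g ∈ commutator G, ∃ l : List G,
    l.length ≤ k ∧ (∀ x ∈ l, x ∈ commutatorSet G) ∧ l.prod = g

/-! ### 2-cocycles, the associated extensions, splitting -/

/-- A (normalized) 2-cocycle of `Γ` with values in the `Γ`-module `Q`. -/
structure Cocycle (Γ Q : Type u) [Group Γ] [AddCommGroup Q] [DistribMulAction Γ Q] where
  toFun : Γ → Γ → Q
  cocycle : ∀ x y z, toFun x y + toFun (x * y) z = toFun x (y * z) + x • toFun y z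
  one_right : ∀ x, toFun x 1 = 0
  one_left : ∀ x, toFun 1 x = 0

namespace Cocycle

variable {Γ Q : Type u} [Group Γ] [AddCommGroup Q] [DistribMulAction Γ Q] (h : Cocycle Γ Q)

/-- The underlying set `Q × Γ` of the extension of `Γ` by `Q` given by the 2-cocycle `h`. -/
@[ext]
structure Ext (h : Cocycle Γ Q) where
  fst : Q
  snd : Γ

instance : Mul h.Ext where
  mul p q := ⟨p.fst + p.snd • q.fst + h.toFun p.snd q.snd, p.snd * q.snd⟩

instance : One h.Ext where
  one := ⟨0, 1⟩

instance : Inv h.Ext where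
  inv p := ⟨-(p.snd⁻¹ • p.fst) - h.toFun p.snd⁻¹ p.snd, p.snd⁻¹⟩

theorem Ext.mul_def (p q : h.Ext) :
    p * q = ⟨p.fst + p.snd • q.fst + h.toFun p.snd q.snd, p.snd * q.snd⟩ := rfl

theorem Ext.one_def : (1 : h.Ext) = ⟨0, 1⟩ := rfl

theorem Ext.inv_def (p : h.Ext) :
    p⁻¹ = ⟨-(p.snd⁻¹ • p.fst) - h.toFun p.snd⁻¹ p.snd, p.snd⁻¹⟩ := rfl

/-- `(a₁, g₁) * (a₂, g₂) = (a₁ + g₁ • a₂ + h (g₁, g₂), g₁ g₂)`. -/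
instance : Group h.Ext :=
  Group.ofLeftAxioms
    (by
      intro p q r
      simp only [Ext.mul_def, smul_add, mul_smul, mul_assoc]
      congr 1
      have := h.cocycle p.snd q.snd r.snd
      calc _ = p.fst + p.snd • q.fst + p.snd • q.snd • r.fst
            + (h.toFun p.snd q.snd + h.toFun (p.snd * q.snd) r.snd) := by abel
        _ = _ := by rw [this]; abel)
    (by
      intro p
      simp [Ext.mul_def, Ext.one_def, h.one_left])
    (by
      intro p
      simp [Ext.mul_def, Ext.one_def, Ext.inv_def]
      abel)

/-- The subgroup of `Q` generated by the image of `h`. -/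
def imageSubgroup : AddSubgroup Q :=
  AddSubgroup.closure (Set.range fun p : Γ × Γ => h.toFun p.1 p.2)

theorem mem_imageSubgroup (x y : Γ) : h.toFun x y ∈ h.imageSubgroup :=
  AddSubgroup.subset_closure ⟨(x, y), rfl⟩

theorem smul_mem_imageSubgroup (g : Γ) (c : Q) (hc : c ∈ h.imageSubgroup) :
    g • c ∈ h.imageSubgroup := by
  induction hc using AddSubgroup.closure_induction with
  | mem x hx =>
    obtain ⟨⟨x, y⟩, rfl⟩ := hx
    have := h.cocycle g x y
    have e : g • h.toFun x y = h.toFun g x + h.toFun (g * x) y - h.toFun g (x * y) := by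
      rw [this]; abel
    simp only [e]
    exact sub_mem (add_mem (h.mem_imageSubgroup _ _) (h.mem_imageSubgroup _ _))
      (h.mem_imageSubgroup _ _)
  | zero => rw [smul_zero]; exact zero_mem _
  | add x y _ _ hx hy => rw [smul_add]; exact add_mem hx hy
  | neg x _ hx => rw [smul_neg]; exact neg_mem hx

end Cocycle

section Split

variable {Γ Q : Type u} [Group Γ] [AddCommGroup Q]

/-- The 2-cocycle `h`, with respect to the action `ρ` of `Γ` on `Q` by automorphisms, is split. -/
def IsSplit (ρ : Γ →* AddMonoid.End Q) (h : Γ → Γ → Q) : Prop :=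
  ∃ f : Γ → Q, (∀ x y, h x y = f x + ρ x (f y) - f (x * y)) ∧ f 1 = 0

/-- The action restricted to an invariant subgroup. -/
def subAction (ρ : Γ →* AddMonoid.End Q) (C : AddSubgroup Q) (hC : ∀ g, ∀ c ∈ C, ρ g c ∈ C) :
    Γ →* AddMonoid.End C where
  toFun g :=
    { toFun := fun c => ⟨ρ g c, hC g c c.2⟩
      map_zero' := by ext; simp
      map_add' := by intro x y; ext; simp }
  map_one' := by
    apply AddMonoidHom.ext
    intro c
    apply Subtype.ext
    change ρ 1 c = c
    rw [map_one]
    rfl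
  map_mul' x y := by
    apply AddMonoidHom.ext
    intro c
    apply Subtype.ext
    change ρ (x * y) c = ρ x (ρ y c)
    rw [map_mul]
    rfl

/-- The action induced on the quotient by an invariant subgroup. -/
def quotAction (ρ : Γ →* AddMonoid.End Q) (C : AddSubgroup Q) (hC : ∀ g, ∀ c ∈ C, ρ g c ∈ C) :
    Γ →* AddMonoid.End (Q ⧸ C) where
  toFun g := QuotientAddGroup.map C C (ρ g) (fun c hc => hC g c hc)
  map_one' := by
    apply AddMonoidHom.ext
    intro c
    induction c using QuotientAddGroup.induction_on with
    | H z =>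
      change (QuotientAddGroup.mk (ρ 1 z) : Q ⧸ C) = QuotientAddGroup.mk z
      rw [map_one]
      rfl
  map_mul' x y := by
    apply AddMonoidHom.ext
    intro c
    induction c using QuotientAddGroup.induction_on with
    | H z =>
      change (QuotientAddGroup.mk (ρ (x * y) z) : Q ⧸ C) = QuotientAddGroup.mk (ρ x (ρ y z))
      rw [map_mul]
      rfl

end Split

namespace Cocycle

variable {Γ Q : Type u} [Group Γ] [AddCommGroup Q] [DistribMulAction Γ Q] (h : Cocycle Γ Q)
  (C : AddSubgroup Q) (hC : ∀ g : Γ, ∀ c ∈ C, g • c ∈ C)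

/-- The 2-cocycle `Γ × Γ → Q / C` induced by `h` is split. -/
def IsSplitMod : Prop :=
  IsSplit (quotAction (DistribMulAction.toAddMonoidEnd Γ Q) C hC)
    (fun x y => (QuotientAddGroup.mk (h.toFun x y) : Q ⧸ C))

/-- `Q₀ / (C ∩ Q₀)`, where `Q₀` is the subgroup of `Q` generated by the image of `h`. -/
abbrev ImageQuot : Type u := h.imageSubgroup ⧸ C.addSubgroupOf h.imageSubgroup

/-- The 2-cocycle `H × H → Q₀ / (C ∩ Q₀)` induced by `h` is split, where `Q₀` is the subgroup
of `Q` generated by the image of `h`. -/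
def IsSplitOnMod (H : Subgroup Γ) : Prop :=
  IsSplit
    ((quotAction
      (subAction (DistribMulAction.toAddMonoidEnd Γ Q) h.imageSubgroup h.smul_mem_imageSubgroup)
      (C.addSubgroupOf h.imageSubgroup) (fun g c hc => hC g c hc)).comp H.subtype)
    (fun x y : H => (QuotientAddGroup.mk ⟨h.toFun x y, h.mem_imageSubgroup x y⟩ : h.ImageQuot C))

end Cocycle

/-! ### Definable groups, actions and 2-cocycles -/

/-- Formulas over the empty set meant to define a group `G` (as a set of `n`-tuples), an abelian
group `A` (as a set of `m`-tuples) and an action of `G` on `A` by automorphisms, and a formula with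
parameters named by `β` meant to define a 2-cocycle `G × G → A`. -/
structure ExtFormulas (L : FirstOrder.Language.{u, u}) (β : Type u) (n m : ℕ) where
  domG : L.Formula (Fin n)
  domA : L.Formula (Fin m)
  mul : L.Formula (Fin n ⊕ (Fin n ⊕ Fin n))
  add : L.Formula (Fin m ⊕ (Fin m ⊕ Fin m))
  act : L.Formula (Fin n ⊕ (Fin m ⊕ Fin m))
  coc : L.Formula (β ⊕ (Fin n ⊕ (Fin n ⊕ Fin m)))

/-- The set of realizations of `φ` in `M`. -/
@[ext]
structure Pts {L : FirstOrder.Language.{u, u}} {ι : Type} (φ : L.Formula ι) (M : Type u)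
    [L.Structure M] : Type u where
  val : ι → M
  property : φ.Realize val

/-- The formulas in `D` (with parameters `b`) do define in `M` a group, an abelian group, an action
by automorphisms and a 2-cocycle. All data here is determined by the formulas. -/
structure Interp {L : FirstOrder.Language.{u, u}} {β : Type u} {n m : ℕ} (D : ExtFormulas L β n m)
    (M : Type u) [L.Structure M] (b : β → M) where
  group : Group (Pts D.domG M)
  addCommGroup : AddCommGroup (Pts D.domA M)
  action : DistribMulAction (Pts D.domG M) (Pts D.domA M)
  mul_iff : ∀ x y z : Pts D.domG M,
    D.mul.Realize (Sum.elim x.1 (Sum.elim y.1 z.1)) ↔ x * y = z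
  add_iff : ∀ x y z : Pts D.domA M,
    D.add.Realize (Sum.elim x.1 (Sum.elim y.1 z.1)) ↔ x + y = z
  act_iff : ∀ (g : Pts D.domG M) (x y : Pts D.domA M),
    D.act.Realize (Sum.elim g.1 (Sum.elim x.1 y.1)) ↔ g • x = y
  coc : Cocycle (Pts D.domG M) (Pts D.domA M)
  coc_iff : ∀ (x y : Pts D.domG M) (z : Pts D.domA M),
    D.coc.Realize (Sum.elim b (Sum.elim x.1 (Sum.elim y.1 z.1))) ↔ coc.toFun x y = z

section Transfer

variable {L : FirstOrder.Language.{u, u}} {M N : Type u} [L.Structure M] [L.Structure N]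

theorem all_transfer {α : Type*} {ι : Type} [Finite ι] (j : M ↪ₑ[L] N)
    (φ : L.Formula (α ⊕ ι)) (c : α → M) (h : ∀ x : ι → M, φ.Realize (Sum.elim c x)) :
    ∀ x : ι → N, φ.Realize (Sum.elim (j ∘ c) x) := by
  have := (j.map_formula (φ.iAlls ι) c).2
    (by rw [Formula.realize_iAlls]; exact h)
  rwa [Formula.realize_iAlls] at this

/-- The image under an elementary embedding of a point of a definable set. -/
def Pts.map {ι : Type} {φ : L.Formula ι} (j : M ↪ₑ[L] N) (x : Pts φ M) : Pts φ N :=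
  ⟨j ∘ x.1, (j.map_formula φ x.1).2 x.2⟩

theorem graph_transfer {α : Type*} {p q r : ℕ} (j : M ↪ₑ[L] N) (P : L.Formula (Fin p))
    (Q : L.Formula (Fin q)) (R : L.Formula (Fin r))
    (F : L.Formula (α ⊕ (Fin p ⊕ (Fin q ⊕ Fin r)))) (c : α → M)
    (f : Pts P M → Pts Q M → Pts R M)
    (hf : ∀ x y z, F.Realize (Sum.elim c (Sum.elim x.1 (Sum.elim y.1 z.1))) ↔ f x y = z) :
    ∃ f' : Pts P N → Pts Q N → Pts R N,
      ∀ x y z, F.Realize (Sum.elim (j ∘ c) (Sum.elim x.1 (Sum.elim y.1 z.1))) ↔ f' x y = z := by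
  have h1 : ∀ (x : Pts P N) (y : Pts Q N), ∃ z : Pts R N,
      F.Realize (Sum.elim (j ∘ c) (Sum.elim x.1 (Sum.elim y.1 z.1))) := by
    intro x y
    have := all_transfer j (ι := Fin p ⊕ Fin q)
      ((P.relabel (Sum.inr ∘ Sum.inl)).imp ((Q.relabel (Sum.inr ∘ Sum.inr)).imp
        (Formula.iExs (Fin r) ((R.relabel Sum.inr) ⊓
          (F.relabel (Sum.elim (Sum.inl ∘ Sum.inl) (Sum.elim (Sum.inl ∘ Sum.inr ∘ Sum.inl)
            (Sum.elim (Sum.inl ∘ Sum.inr ∘ Sum.inr) Sum.inr)))))))) c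
      (by
        intro v
        simp only [Formula.realize_imp, Formula.realize_relabel, Formula.realize_iExs,
          Formula.realize_inf, Sum.comp_elim]
        intro hx hy
        exact ⟨(f ⟨_, hx⟩ ⟨_, hy⟩).1, (f ⟨_, hx⟩ ⟨_, hy⟩).2, (hf ⟨_, hx⟩ ⟨_, hy⟩ _).2 rfl⟩)
      (Sum.elim x.1 y.1)
    simp only [Formula.realize_imp, Formula.realize_relabel, Formula.realize_iExs,
          Formula.realize_inf, Sum.comp_elim] at this
    obtain ⟨z, hz, hF⟩ := this x.2 y.2
    exact ⟨⟨z, hz⟩, hF⟩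
  have h2 : ∀ (x : Pts P N) (y : Pts Q N) (z w : Pts R N),
      F.Realize (Sum.elim (j ∘ c) (Sum.elim x.1 (Sum.elim y.1 z.1))) →
      F.Realize (Sum.elim (j ∘ c) (Sum.elim x.1 (Sum.elim y.1 w.1))) → z = w := by
    intro x y z w hz hw
    have := all_transfer j (ι := Fin p ⊕ (Fin q ⊕ (Fin r ⊕ Fin r)))
      ((P.relabel (Sum.inr ∘ Sum.inl)).imp ((Q.relabel (Sum.inr ∘ Sum.inr ∘ Sum.inl)).imp
        ((R.relabel (Sum.inr ∘ Sum.inr ∘ Sum.inr ∘ Sum.inl)).imp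
        ((R.relabel (Sum.inr ∘ Sum.inr ∘ Sum.inr ∘ Sum.inr)).imp
        ((F.relabel (Sum.elim Sum.inl (Sum.elim (Sum.inr ∘ Sum.inl)
          (Sum.elim (Sum.inr ∘ Sum.inr ∘ Sum.inl) (Sum.inr ∘ Sum.inr ∘ Sum.inr ∘ Sum.inl))))).imp
        ((F.relabel (Sum.elim Sum.inl (Sum.elim (Sum.inr ∘ Sum.inl)
          (Sum.elim (Sum.inr ∘ Sum.inr ∘ Sum.inl) (Sum.inr ∘ Sum.inr ∘ Sum.inr ∘ Sum.inr))))).imp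
        (Formula.iInf fun i : Fin r => Term.equal
          (Term.var (Sum.inr (Sum.inr (Sum.inr (Sum.inl i)))))
          (Term.var (Sum.inr (Sum.inr (Sum.inr (Sum.inr i)))))))))))) c
      (by
        intro v
        simp only [Formula.realize_imp, Formula.realize_relabel, Formula.realize_iInf,
          Formula.realize_equal, Sum.comp_elim]
        intro hx hy hz hw hz' hw' i
        have e1 := (hf ⟨_, hx⟩ ⟨_, hy⟩ ⟨_, hz⟩).1 hz'
        have e2 := (hf ⟨_, hx⟩ ⟨_, hy⟩ ⟨_, hw⟩).1 hw'
        exact congrFun (congrArg Pts.val (e1.symm.trans e2)) i)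
      (Sum.elim x.1 (Sum.elim y.1 (Sum.elim z.1 w.1)))
    simp only [Formula.realize_imp, Formula.realize_relabel, Formula.realize_iInf,
          Formula.realize_equal, Sum.comp_elim] at this
    exact Pts.ext (funext (this x.2 y.2 z.2 w.2 hz hw))
  choose f' hf' using h1
  exact ⟨f', fun x y z => ⟨fun h => h2 x y _ _ (hf' x y) h, fun h => h ▸ hf' x y⟩⟩

/-- A group law on a definable set, given by a formula, transfers along an elementary embedding. -/
theorem law_transfer {n : ℕ} (j : M ↪ₑ[L] N) (P : L.Formula (Fin n))
    (F : L.Formula (Fin n ⊕ (Fin n ⊕ Fin n))) (f : Pts P M → Pts P M → Pts P M)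
    (hf : ∀ x y z, F.Realize (Sum.elim x.1 (Sum.elim y.1 z.1)) ↔ f x y = z)
    (assoc : ∀ x y z, f (f x y) z = f x (f y z)) (e : Pts P M) (he : ∀ x, f e x = x)
    (inv : ∀ x, ∃ y, f y x = e) :
    ∃ f' : Pts P N → Pts P N → Pts P N,
      (∀ x y z, F.Realize (Sum.elim x.1 (Sum.elim y.1 z.1)) ↔ f' x y = z) ∧
      (∀ x y z, f' (f' x y) z = f' x (f' y z)) ∧ (∀ x, f' (e.map j) x = x) ∧
      (∀ x, ∃ y, f' y x = e.map j) ∧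
      ((∀ x y, f x y = f y x) → ∀ x y, f' x y = f' y x) := by
  obtain ⟨f', hf'⟩ := graph_transfer j P P P (F.relabel (Sum.inr : _ → Empty ⊕ _))
    Empty.elim f (by
      intro x y z
      rw [Formula.realize_relabel, Sum.elim_comp_inr]
      exact hf x y z)
  have hf'' : ∀ x y z : Pts P N, F.Realize (Sum.elim x.1 (Sum.elim y.1 z.1)) ↔ f' x y = z := by
    intro x y z
    rw [← hf', Formula.realize_relabel, Sum.elim_comp_inr]
  refine ⟨f', hf'', ?_, ?_, ?_, ?_⟩
  · intro x y z
    let v (k : Fin 6) : Fin n → Empty ⊕ (Fin 6 × Fin n) := fun i => Sum.inr (k, i)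
    have := all_transfer j (ι := Fin 6 × Fin n)
      ((P.relabel (v 0)).imp <| (P.relabel (v 1)).imp <| (P.relabel (v 2)).imp <|
        (P.relabel (v 3)).imp <| (P.relabel (v 4)).imp <| (P.relabel (v 5)).imp <|
        (F.relabel (Sum.elim (v 0) (Sum.elim (v 1) (v 3)))).imp <|
        (F.relabel (Sum.elim (v 3) (Sum.elim (v 2) (v 4)))).imp <|
        (F.relabel (Sum.elim (v 1) (Sum.elim (v 2) (v 5)))).imp <|
        (F.relabel (Sum.elim (v 0) (Sum.elim (v 5) (v 4))))) Empty.elim (by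
        intro w
        simp only [Formula.realize_imp, Formula.realize_relabel, Sum.comp_elim]
        intro h0 h1 h2 h3 h4 h5 a1 a2 a3
        have b1 := (hf ⟨_, h0⟩ ⟨_, h1⟩ ⟨_, h3⟩).1 a1
        have b2 := (hf ⟨_, h3⟩ ⟨_, h2⟩ ⟨_, h4⟩).1 a2
        have b3 := (hf ⟨_, h1⟩ ⟨_, h2⟩ ⟨_, h5⟩).1 a3
        refine (hf ⟨_, h0⟩ ⟨_, h5⟩ ⟨_, h4⟩).2 ?_
        rw [← b3, ← assoc, b1, b2])
      (fun p => ![x.1, y.1, z.1, (f' x y).1, (f' (f' x y) z).1, (f' y z).1] p.1 p.2)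
    simp only [Formula.realize_imp, Formula.realize_relabel, Sum.comp_elim] at this
    exact ((hf'' x (f' y z) (f' (f' x y) z)).1 (this x.2 y.2 z.2 (f' x y).2 (f' (f' x y) z).2
      (f' y z).2 ((hf'' _ _ _).2 rfl) ((hf'' _ _ _).2 rfl) ((hf'' _ _ _).2 rfl))).symm
  · intro x
    have := all_transfer j (ι := Fin n)
      ((P.relabel Sum.inr).imp (F.relabel (Sum.elim Sum.inl (Sum.elim Sum.inr Sum.inr))))
      e.1 (by
        intro w
        simp only [Formula.realize_imp, Formula.realize_relabel, Sum.comp_elim]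
        intro h0
        exact (hf e ⟨_, h0⟩ ⟨_, h0⟩).2 (he _)) x.1
    simp only [Formula.realize_imp, Formula.realize_relabel, Sum.comp_elim] at this
    exact (hf'' (e.map j) x x).1 (this x.2)
  · intro x
    have := all_transfer j (ι := Fin n)
      ((P.relabel Sum.inr).imp (Formula.iExs (Fin n) ((P.relabel Sum.inr) ⊓
        (F.relabel (Sum.elim Sum.inr (Sum.elim (Sum.inl ∘ Sum.inr) (Sum.inl ∘ Sum.inl)))))))
      e.1 (by
        intro w
        simp only [Formula.realize_imp, Formula.realize_relabel, Formula.realize_iExs,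
          Formula.realize_inf, Sum.comp_elim]
        intro h0
        obtain ⟨y, hy⟩ := inv ⟨_, h0⟩
        exact ⟨y.1, y.2, (hf y ⟨_, h0⟩ e).2 hy⟩) x.1
    simp only [Formula.realize_imp, Formula.realize_relabel, Formula.realize_iExs,
          Formula.realize_inf, Sum.comp_elim] at this
    obtain ⟨y, hy, hF⟩ := this x.2
    exact ⟨⟨y, hy⟩, (hf'' ⟨y, hy⟩ x (e.map j)).1 hF⟩
  · intro comm x y
    let v (k : Fin 3) : Fin n → Empty ⊕ (Fin 3 × Fin n) := fun i => Sum.inr (k, i)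
    have := all_transfer j (ι := Fin 3 × Fin n)
      ((P.relabel (v 0)).imp <| (P.relabel (v 1)).imp <| (P.relabel (v 2)).imp <|
        (F.relabel (Sum.elim (v 0) (Sum.elim (v 1) (v 2)))).imp <|
        (F.relabel (Sum.elim (v 1) (Sum.elim (v 0) (v 2))))) Empty.elim (by
        intro w
        simp only [Formula.realize_imp, Formula.realize_relabel, Sum.comp_elim]
        intro h0 h1 h2 a1
        have b1 := (hf ⟨_, h0⟩ ⟨_, h1⟩ ⟨_, h2⟩).1 a1
        exact (hf ⟨_, h1⟩ ⟨_, h0⟩ ⟨_, h2⟩).2 ((comm _ _).trans b1))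
      (fun p => ![x.1, y.1, (f' x y).1] p.1 p.2)
    simp only [Formula.realize_imp, Formula.realize_relabel, Sum.comp_elim] at this
    exact ((hf'' y x (f' x y)).1 (this x.2 y.2 (f' x y).2 ((hf'' _ _ _).2 rfl))).symm

/-- Variables for elements of the first definable set. -/
def varG {α : Type*} {n m r s : ℕ} (k : Fin r) : Fin n → α ⊕ (Fin r × Fin n ⊕ Fin s × Fin m) :=
  fun i => Sum.inr (Sum.inl (k, i))

/-- Variables for elements of the second definable set. -/
def varA {α : Type*} {n m r s : ℕ} (k : Fin s) : Fin m → α ⊕ (Fin r × Fin n ⊕ Fin s × Fin m) :=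
  fun i => Sum.inr (Sum.inr (k, i))

/-- If the formulas in `D` define a group, an abelian group, an action and a 2-cocycle in `M`, then
they do so in every elementary extension. -/
theorem Interp.exists_star {β : Type u} {n m : ℕ} {D : ExtFormulas L β n m} {b : β → M}
    (I : Interp D M b) (j : M ↪ₑ[L] N) : Nonempty (Interp D N (j ∘ b)) := by
  let := I.group
  let := I.addCommGroup
  let := I.action
  obtain ⟨mu, hmu, mu_assoc, one_mu, mu_inv, -⟩ := law_transfer j D.domG D.mul (· * ·) I.mul_iff
    mul_assoc 1 one_mul (fun x => ⟨x⁻¹, inv_mul_cancel x⟩)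
  obtain ⟨ad, had, ad_assoc, zero_ad, ad_inv, ad_comm⟩ := law_transfer j D.domA D.add (· + ·)
    I.add_iff add_assoc 0 zero_add (fun x => ⟨-x, neg_add_cancel x⟩)
  have ad_comm := ad_comm add_comm
  obtain ⟨ac, hac'⟩ := graph_transfer j D.domG D.domA D.domA
    (D.act.relabel (Sum.inr : _ → Empty ⊕ _)) Empty.elim (· • ·) (by
      intro x y z
      rw [Formula.realize_relabel, Sum.elim_comp_inr]
      exact I.act_iff x y z)
  have hac : ∀ g x y, D.act.Realize (Sum.elim g.1 (Sum.elim x.1 y.1)) ↔ ac g x = y := by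
    intro x y z
    rw [← hac', Formula.realize_relabel, Sum.elim_comp_inr]
  obtain ⟨co, hco⟩ := graph_transfer j D.domG D.domG D.domA D.coc b I.coc.toFun I.coc_iff
  choose mi hmi using mu_inv
  choose ai hai using ad_inv
  have one_ac : ∀ x, ac (Pts.map j (1 : Pts D.domG M)) x = x := by
    intro x
    have := all_transfer j (ι := Fin m)
      ((D.domA.relabel Sum.inr).imp (D.act.relabel (Sum.elim Sum.inl (Sum.elim Sum.inr Sum.inr))))
      (1 : Pts D.domG M).1 (by
        intro w
        simp only [Formula.realize_imp, Formula.realize_relabel, Sum.comp_elim]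
        intro h0
        exact (I.act_iff 1 ⟨_, h0⟩ ⟨_, h0⟩).2 (one_smul _ _)) x.1
    simp only [Formula.realize_imp, Formula.realize_relabel, Sum.comp_elim] at this
    exact (hac (Pts.map j (1 : Pts D.domG M)) x x).1 (this x.2)
  have ac_zero : ∀ x, ac x (Pts.map j (0 : Pts D.domA M)) = Pts.map j (0 : Pts D.domA M) := by
    intro x
    have := all_transfer j (ι := Fin n)
      ((D.domG.relabel Sum.inr).imp (D.act.relabel (Sum.elim Sum.inr (Sum.elim Sum.inl Sum.inl))))
      (0 : Pts D.domA M).1 (by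
        intro w
        simp only [Formula.realize_imp, Formula.realize_relabel, Sum.comp_elim]
        intro h0
        exact (I.act_iff ⟨_, h0⟩ 0 0).2 (smul_zero _)) x.1
    simp only [Formula.realize_imp, Formula.realize_relabel, Sum.comp_elim] at this
    exact (hac x (Pts.map j (0 : Pts D.domA M)) (Pts.map j (0 : Pts D.domA M))).1 (this x.2)
  have mu_ac : ∀ x y z, ac (mu x y) z = ac x (ac y z) := by
    intro x y z
    have := all_transfer j (α := Empty) (ι := Fin 3 × Fin n ⊕ Fin 3 × Fin m)
      ((D.domG.relabel (varG 0)).imp <| (D.domG.relabel (varG 1)).imp <| (D.domG.relabel (varG 2)).imp <|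
        (D.domA.relabel (varA 0)).imp <| (D.domA.relabel (varA 1)).imp <| (D.domA.relabel (varA 2)).imp <|
        (D.mul.relabel (Sum.elim (varG 0) (Sum.elim (varG 1) (varG 2)))).imp <|
        (D.act.relabel (Sum.elim (varG 1) (Sum.elim (varA 0) (varA 1)))).imp <|
        (D.act.relabel (Sum.elim (varG 0) (Sum.elim (varA 1) (varA 2)))).imp <|
        (D.act.relabel (Sum.elim (varG 2) (Sum.elim (varA 0) (varA 2))))) Empty.elim (by
        intro w
        simp only [Formula.realize_imp, Formula.realize_relabel, Sum.comp_elim]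
        intro h0 h1 h2 h3 h4 h5 a1 a2 a3
        have b1 := (I.mul_iff ⟨_, h0⟩ ⟨_, h1⟩ ⟨_, h2⟩).1 a1
        have b2 := (I.act_iff ⟨_, h1⟩ ⟨_, h3⟩ ⟨_, h4⟩).1 a2
        have b3 := (I.act_iff ⟨_, h0⟩ ⟨_, h4⟩ ⟨_, h5⟩).1 a3
        refine (I.act_iff ⟨_, h2⟩ ⟨_, h3⟩ ⟨_, h5⟩).2 ?_
        rw [← b1, mul_smul, b2, b3])
      (Sum.elim (fun p => ![x.1, y.1, (mu x y).1] p.1 p.2)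
        (fun p => ![z.1, (ac y z).1, (ac x (ac y z)).1] p.1 p.2))
    simp only [Formula.realize_imp, Formula.realize_relabel, Sum.comp_elim] at this
    exact (hac (mu x y) z (ac x (ac y z))).1 (this x.2 y.2 (mu x y).2 z.2 (ac y z).2
      (ac x (ac y z)).2 ((hmu _ _ _).2 rfl) ((hac _ _ _).2 rfl) ((hac _ _ _).2 rfl))
  have ac_ad : ∀ x y z, ac x (ad y z) = ad (ac x y) (ac x z) := by
    intro x y z
    have := all_transfer j (α := Empty) (ι := Fin 1 × Fin n ⊕ Fin 6 × Fin m)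
      ((D.domG.relabel (varG 0)).imp <| (D.domA.relabel (varA 0)).imp <| (D.domA.relabel (varA 1)).imp <|
        (D.domA.relabel (varA 2)).imp <| (D.domA.relabel (varA 3)).imp <| (D.domA.relabel (varA 4)).imp <|
        (D.domA.relabel (varA 5)).imp <|
        (D.add.relabel (Sum.elim (varA 0) (Sum.elim (varA 1) (varA 2)))).imp <|
        (D.act.relabel (Sum.elim (varG 0) (Sum.elim (varA 0) (varA 3)))).imp <|
        (D.act.relabel (Sum.elim (varG 0) (Sum.elim (varA 1) (varA 4)))).imp <|
        (D.add.relabel (Sum.elim (varA 3) (Sum.elim (varA 4) (varA 5)))).imp <|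
        (D.act.relabel (Sum.elim (varG 0) (Sum.elim (varA 2) (varA 5))))) Empty.elim (by
        intro w
        simp only [Formula.realize_imp, Formula.realize_relabel, Sum.comp_elim]
        intro h h0 h1 h2 h3 h4 h5 a1 a2 a3 a4
        have b1 := (I.add_iff ⟨_, h0⟩ ⟨_, h1⟩ ⟨_, h2⟩).1 a1
        have b2 := (I.act_iff ⟨_, h⟩ ⟨_, h0⟩ ⟨_, h3⟩).1 a2
        have b3 := (I.act_iff ⟨_, h⟩ ⟨_, h1⟩ ⟨_, h4⟩).1 a3
        have b4 := (I.add_iff ⟨_, h3⟩ ⟨_, h4⟩ ⟨_, h5⟩).1 a4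
        refine (I.act_iff ⟨_, h⟩ ⟨_, h2⟩ ⟨_, h5⟩).2 ?_
        rw [← b1, smul_add, b2, b3, b4])
      (Sum.elim (fun p => ![x.1] p.1 p.2)
        (fun p => ![y.1, z.1, (ad y z).1, (ac x y).1, (ac x z).1,
          (ad (ac x y) (ac x z)).1] p.1 p.2))
    simp only [Formula.realize_imp, Formula.realize_relabel, Sum.comp_elim] at this
    exact (hac x (ad y z) (ad (ac x y) (ac x z))).1 (this x.2 y.2 z.2 (ad y z).2 (ac x y).2
      (ac x z).2 (ad (ac x y) (ac x z)).2 ((had _ _ _).2 rfl) ((hac _ _ _).2 rfl)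
      ((hac _ _ _).2 rfl) ((had _ _ _).2 rfl))
  have co_co : ∀ x y z, ad (co x y) (co (mu x y) z) = ad (co x (mu y z)) (ac x (co y z)) := by
    intro x y z
    have := all_transfer j (ι := Fin 5 × Fin n ⊕ Fin 6 × Fin m)
      ((D.domG.relabel (varG 0)).imp <| (D.domG.relabel (varG 1)).imp <| (D.domG.relabel (varG 2)).imp <|
        (D.domG.relabel (varG 3)).imp <| (D.domG.relabel (varG 4)).imp <|
        (D.domA.relabel (varA 0)).imp <| (D.domA.relabel (varA 1)).imp <|
        (D.domA.relabel (varA 2)).imp <| (D.domA.relabel (varA 3)).imp <| (D.domA.relabel (varA 4)).imp <|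
        (D.domA.relabel (varA 5)).imp <|
        (D.mul.relabel (Sum.elim (varG 0) (Sum.elim (varG 1) (varG 3)))).imp <|
        (D.mul.relabel (Sum.elim (varG 1) (Sum.elim (varG 2) (varG 4)))).imp <|
        (D.coc.relabel (Sum.elim Sum.inl (Sum.elim (varG 0) (Sum.elim (varG 1) (varA 0))))).imp <|
        (D.coc.relabel (Sum.elim Sum.inl (Sum.elim (varG 3) (Sum.elim (varG 2) (varA 1))))).imp <|
        (D.coc.relabel (Sum.elim Sum.inl (Sum.elim (varG 0) (Sum.elim (varG 4) (varA 2))))).imp <|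
        (D.coc.relabel (Sum.elim Sum.inl (Sum.elim (varG 1) (Sum.elim (varG 2) (varA 3))))).imp <|
        (D.act.relabel (Sum.elim (varG 0) (Sum.elim (varA 3) (varA 4)))).imp <|
        (D.add.relabel (Sum.elim (varA 2) (Sum.elim (varA 4) (varA 5)))).imp <|
        (D.add.relabel (Sum.elim (varA 0) (Sum.elim (varA 1) (varA 5))))) b (by
        intro w
        simp only [Formula.realize_imp, Formula.realize_relabel, Sum.comp_elim]
        intro g0 g1 g2 g3 g4 h0 h1 h2 h3 h4 h5 a1 a2 a3 a4 a5 a6 a7 a8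
        have b1 := (I.mul_iff ⟨_, g0⟩ ⟨_, g1⟩ ⟨_, g3⟩).1 a1
        have b2 := (I.mul_iff ⟨_, g1⟩ ⟨_, g2⟩ ⟨_, g4⟩).1 a2
        have b3 := (I.coc_iff ⟨_, g0⟩ ⟨_, g1⟩ ⟨_, h0⟩).1 a3
        have b4 := (I.coc_iff ⟨_, g3⟩ ⟨_, g2⟩ ⟨_, h1⟩).1 a4
        have b5 := (I.coc_iff ⟨_, g0⟩ ⟨_, g4⟩ ⟨_, h2⟩).1 a5
        have b6 := (I.coc_iff ⟨_, g1⟩ ⟨_, g2⟩ ⟨_, h3⟩).1 a6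
        have b7 := (I.act_iff ⟨_, g0⟩ ⟨_, h3⟩ ⟨_, h4⟩).1 a7
        have b8 := (I.add_iff ⟨_, h2⟩ ⟨_, h4⟩ ⟨_, h5⟩).1 a8
        refine (I.add_iff ⟨_, h0⟩ ⟨_, h1⟩ ⟨_, h5⟩).2 ?_
        rw [← b8, ← b7, ← b6, ← b5, ← b4, ← b3, ← b2, ← b1, I.coc.cocycle])
      (Sum.elim (fun p => ![x.1, y.1, z.1, (mu x y).1, (mu y z).1] p.1 p.2)
        (fun p => ![(co x y).1, (co (mu x y) z).1, (co x (mu y z)).1, (co y z).1,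
          (ac x (co y z)).1, (ad (co x (mu y z)) (ac x (co y z))).1] p.1 p.2))
    simp only [Formula.realize_imp, Formula.realize_relabel, Sum.comp_elim] at this
    exact (had (co x y) (co (mu x y) z) (ad (co x (mu y z)) (ac x (co y z)))).1
      (this x.2 y.2 z.2 (mu x y).2 (mu y z).2 (co x y).2 (co (mu x y) z).2 (co x (mu y z)).2
        (co y z).2 (ac x (co y z)).2 (ad (co x (mu y z)) (ac x (co y z))).2
        ((hmu _ _ _).2 rfl) ((hmu _ _ _).2 rfl) ((hco _ _ _).2 rfl) ((hco _ _ _).2 rfl)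
        ((hco _ _ _).2 rfl) ((hco _ _ _).2 rfl) ((hac _ _ _).2 rfl) ((had _ _ _).2 rfl))
  have co_one : ∀ x, co x (Pts.map j (1 : Pts D.domG M)) = Pts.map j (0 : Pts D.domA M) ∧
      co (Pts.map j (1 : Pts D.domG M)) x = Pts.map j (0 : Pts D.domA M) := by
    intro x
    have := all_transfer j (ι := Fin n)
      ((D.domG.relabel Sum.inr).imp
        ((D.coc.relabel (Sum.elim (Sum.inl ∘ Sum.inl) (Sum.elim Sum.inr
          (Sum.elim (Sum.inl ∘ Sum.inr ∘ Sum.inl) (Sum.inl ∘ Sum.inr ∘ Sum.inr))))) ⊓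
        (D.coc.relabel (Sum.elim (Sum.inl ∘ Sum.inl) (Sum.elim (Sum.inl ∘ Sum.inr ∘ Sum.inl)
          (Sum.elim Sum.inr (Sum.inl ∘ Sum.inr ∘ Sum.inr)))))))
      (Sum.elim b (Sum.elim (1 : Pts D.domG M).1 (0 : Pts D.domA M).1)) (by
        intro w
        simp only [Formula.realize_imp, Formula.realize_relabel, Formula.realize_inf,
          Sum.comp_elim]
        intro h0
        exact ⟨(I.coc_iff ⟨_, h0⟩ 1 0).2 (I.coc.one_right _),
          (I.coc_iff 1 ⟨_, h0⟩ 0).2 (I.coc.one_left _)⟩) x.1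
    simp only [Formula.realize_imp, Formula.realize_relabel, Formula.realize_inf,
      Sum.comp_elim] at this
    obtain ⟨h1, h2⟩ := this x.2
    exact ⟨(hco x (Pts.map j (1 : Pts D.domG M)) (Pts.map j (0 : Pts D.domA M))).1 h1,
      (hco (Pts.map j (1 : Pts D.domG M)) x (Pts.map j (0 : Pts D.domA M))).1 h2⟩
  let : Mul (Pts D.domG N) := ⟨mu⟩
  let : One (Pts D.domG N) := ⟨Pts.map j (1 : Pts D.domG M)⟩
  let : Inv (Pts D.domG N) := ⟨mi⟩
  let : Add (Pts D.domA N) := ⟨ad⟩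
  let : Zero (Pts D.domA N) := ⟨Pts.map j (0 : Pts D.domA M)⟩
  let : Neg (Pts D.domA N) := ⟨ai⟩
  let gN : Group (Pts D.domG N) := Group.ofLeftAxioms mu_assoc one_mu hmi
  let aN : AddCommGroup (Pts D.domA N) :=
    { AddGroup.ofLeftAxioms ad_assoc zero_ad hai with add_comm := ad_comm }
  let dN : DistribMulAction (Pts D.domG N) (Pts D.domA N) :=
    { smul := ac
      one_smul := one_ac
      mul_smul := mu_ac
      smul_zero := ac_zero
      smul_add := ac_ad }
  exact ⟨{ group := gN
           addCommGroup := aN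
           action := dN
           mul_iff := hmu
           add_iff := had
           act_iff := hac
           coc := ⟨co, co_co, fun x => (co_one x).1, fun x => (co_one x).2⟩
           coc_iff := hco }⟩

end Transfer

namespace Interp

variable {L : FirstOrder.Language.{u, u}} {β : Type u} {n m : ℕ} {D : ExtFormulas L β n m}
  {M N : Type u} [L.Structure M] [L.Structure N] {b : β → M}

/-- The interpretation in an elementary extension `N` of `M` of the objects defined in `M`. -/
noncomputable def star (I : Interp D M b) (j : M ↪ₑ[L] N) : Interp D N (j ∘ b) :=
  (I.exists_star j).some

/-- The group `G`. -/
def G (_I : Interp D M b) : Type u := Pts D.domG M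

/-- The abelian group `A`. -/
def A (_I : Interp D M b) : Type u := Pts D.domA M

instance (I : Interp D M b) : Group I.G := I.group

instance (I : Interp D M b) : AddCommGroup I.A := I.addCommGroup

instance (I : Interp D M b) : DistribMulAction I.G I.A := I.action

/-- The 2-cocycle `h`. -/
def h (I : Interp D M b) : Cocycle I.G I.A := I.coc

/-- The extension of `G` by `A` given by `h`. -/
abbrev Ext (I : Interp D M b) : Type u := I.h.Ext

/-- The tuple of elements of the structure which an element of `G` is. -/
def coordG (I : Interp D M b) (x : I.G) : Fin n → M := x.1

/-- The tuple of elements of the structure which an element of `A` is. -/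
def coordA (I : Interp D M b) (x : I.A) : Fin m → M := x.1

/-- The tuple of elements of the structure which an element `(a, g)` of the extension is. -/
def coordExt (I : Interp D M b) (p : I.Ext) : Fin m ⊕ Fin n → M :=
  Sum.elim (I.coordA p.fst) (I.coordG p.snd)

/-- `H ∩ A`, for a subgroup `H` of the extension and `A` identified with `A × {e}`. -/
def interA (I : Interp D M b) (H : Subgroup I.Ext) : Set I.A :=
  {a | (⟨a, 1⟩ : I.Ext) ∈ H}

end Interp

end ConnComp

/-! Write K for the 000-component of `G*` over B and Ext for the extension of `G*` by `A*`. Two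
preliminary facts carry the argument. First, finiteness of the image of h is a first order property
with parameters, so h* takes only the values of h. These lie in dcl(B), so automorphisms over B fix
A₀ pointwise (`aut_fixes_h_star`). Second, the kernel of the action of `G*` on `A*/A₁` is invariant
of bounded index, so K acts trivially on `A*/A₁` (`smul_sub_mem_of_mem_comp000`).

Part (i). A splitting F on K with values in A₀ is encoded by the subgroup of all (a, g) with g in K
and a + F g in A₁. It has bounded index and meets `A*` in A₁. An automorphism over B replaces F by
another A₀-valued splitting, and two such splittings differ modulo A₁ by a homomorphism from K to
A₀/(A₁ ∩ A₀). If these are all trivial, the subgroup is invariant, hence contains the 000-component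
of Ext. Conversely, that component has first coordinates in A₀ + A₁ and projects onto a group
containing K. If it meets `A*` within A₁, its elements over g agree modulo A₁ and define a
splitting; this direction does not need the assumption on Hom. Bounded index of the components
themselves comes from `inv_mul_mem_of_typeOver_eq`: elements with the same type over a small model
lie in one coset of every invariant subgroup of bounded index.

Part (ii). `G*` with its structure induced over B is a monster model of an expansion of the group G
(`isMonster_ind`), and its automorphisms agree at each single point with automorphisms of the
ambient model over B. Absolute connectedness therefore gives K = `G*`. If G were not perfect, a
nontrivial character to the circle would provide a decreasing sequence of neighbourhoods of 0 whose
preimages, added as predicates, define a proper invariant subgroup of bounded index in a monster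
model. This refutes absolute connectedness, but needs the existence of monster models, which is
proved by a chain of length κ⁺ of elementary extensions. With finite commutator width, "every
element is a product of k commutators" is first order and passes to `G*`.

Given a splitting on `G*`, trivial action modulo A₁ makes (a, g) ↦ a + F g a homomorphism from Ext
to the abelian group `A*/A₁`. It kills commutators, while products of k commutators cover `G*`; its
kernel is thus the set of such products times A₁, which is type-definable although F need not be.
This gives the criterion for the 00-component. Finally, an `A*`-valued splitting modulo A₁ is a
homomorphism modulo A₀ + A₁, so perfectness pushes its values into A₀ + A₁. -/

namespace ConnComp

open FirstOrder.Language

/-! ### Saturation and homogeneity for finite tuples and indexed parameters. -/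

section Saturation

variable {L : FirstOrder.Language.{u, u}} {N : Type u} [L.Structure N] {κ : Cardinal.{u}}

/-- Every formula has an equivalent whose variables are among the finitely many free ones. -/
theorem exists_formula_finset {α : Type*} (φ : L.Formula α) :
    ∃ (s : Finset α) (ψ : L.Formula s), ∀ (K : Type u) [L.Structure K] (v : α → K),
      ψ.Realize (fun a : s => v a) ↔ φ.Realize v := by
  classical
  refine ⟨φ.freeVarFinset, φ.restrictFreeVar id, fun K _ v => ?_⟩
  exact BoundedFormula.realize_restrictFreeVar v (fun a => rfl)

/-- Existential quantification over a possibly infinite tuple of variables. -/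
theorem exists_formula_exs {α β : Type*} (φ : L.Formula (α ⊕ β)) :
    ∃ ψ : L.Formula α, ∀ (K : Type u) [L.Structure K] [Nonempty K] (v : α → K),
      ψ.Realize v ↔ ∃ w : β → K, φ.Realize (Sum.elim v w) := by
  classical
  obtain ⟨s, ψ, hψ⟩ := exists_formula_finset φ
  let f : s → α ⊕ {b // Sum.inr b ∈ s} := fun x => match x with
    | ⟨Sum.inl a, _⟩ => Sum.inl a
    | ⟨Sum.inr b, h⟩ => Sum.inr ⟨b, h⟩
  have : Finite {b // Sum.inr b ∈ s} :=
    Finite.of_injective (fun b => (⟨Sum.inr b.1, b.2⟩ : s)) (by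
      intro a b h
      simpa [Subtype.ext_iff] using h)
  refine ⟨Formula.iExs {b // Sum.inr b ∈ s} (ψ.relabel f), fun K _ _ v => ?_⟩
  simp only [Formula.realize_iExs, Formula.realize_relabel]
  constructor
  · rintro ⟨w, hw⟩
    refine ⟨fun b => if h : Sum.inr b ∈ s then w ⟨b, h⟩ else Classical.arbitrary K, ?_⟩
    rw [← hψ]
    convert hw using 1
    funext x
    obtain ⟨a | b, h⟩ := x
    · rfl
    · simp [f, h]
  · rintro ⟨w, hw⟩
    refine ⟨fun b => w b, ?_⟩
    rw [← hψ] at hw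
    convert hw using 1
    funext x
    obtain ⟨a | b, h⟩ := x <;> rfl

/-- Parameters become an indexed family, possibly with repetitions, entered as free variables
instead of constants. -/
theorem IsSaturated.realize_one (hN : IsSaturated L κ N) {γ : Type u} (hγ : Cardinal.mk γ < κ)
    (c : γ → N) (p : Set (L.Formula (γ ⊕ Fin 1)))
    (hp : ∀ q : Finset (L.Formula (γ ⊕ Fin 1)), (q : Set _) ⊆ p →
      ∃ v : Fin 1 → N, ∀ φ ∈ q, φ.Realize (Sum.elim c v)) :
    ∃ v : Fin 1 → N, ∀ φ ∈ p, φ.Realize (Sum.elim c v) := by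
  classical
  let tr : L.Formula (γ ⊕ Fin 1) → L[[Set.range c]].Formula (Fin 1) := fun φ =>
    BoundedFormula.constantsVarsEquiv.symm
      (φ.relabel (Sum.map (Set.rangeFactorization c) id) : L.Formula (Set.range c ⊕ Fin 1))
  have htr : ∀ φ (v : Fin 1 → N), (tr φ).Realize v ↔ φ.Realize (Sum.elim c v) := by
    intro φ v
    have := BoundedFormula.realize_constantsVarsEquiv (φ := tr φ) (v := v) (xs := default) (M := N)
    rw [Formula.Realize, ← this]
    simp only [tr, Equiv.apply_symm_apply]
    rw [← Formula.Realize, Formula.realize_relabel]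
    apply iff_of_eq
    congr 1
    funext x
    rcases x with x | x <;> rfl
  obtain ⟨v, hv⟩ := hN (Set.range c) (Cardinal.mk_range_le.trans_lt hγ) (tr '' p) (by
    intro q hq
    obtain ⟨r, hr, rfl⟩ := Finset.subset_set_image_iff.1 hq
    obtain ⟨v, hv⟩ := hp r hr
    refine ⟨v, fun φ hφ => ?_⟩
    obtain ⟨ψ, hψ, rfl⟩ := Finset.mem_image.1 hφ
    exact (htr _ _).2 (hv ψ hψ))
  exact ⟨v, fun φ hφ => (htr _ _).1 (hv _ ⟨φ, hφ, rfl⟩)⟩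

/-- One coordinate is added at a time: a point satisfying the existential closures of all finite
parts of `p` is realized first, and is then treated as a parameter for the remaining coordinates. -/
theorem IsSaturated.realize (hN : IsSaturated L κ N) (hκ : Cardinal.aleph0 ≤ κ) (ι : Type)
    [Finite ι] : ∀ {γ : Type u} (_ : Cardinal.mk γ < κ) (c : γ → N) (p : Set (L.Formula (γ ⊕ ι))),
      (∀ q : Finset (L.Formula (γ ⊕ ι)), (q : Set _) ⊆ p →
        ∃ v : ι → N, ∀ φ ∈ q, φ.Realize (Sum.elim c v)) →
      ∃ v : ι → N, ∀ φ ∈ p, φ.Realize (Sum.elim c v) := by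
  classical
  induction ι using Finite.induction_empty_option with
  | of_equiv e ih =>
    intro γ hγ c p hp
    have key : ∀ φ : L.Formula (γ ⊕ _), ∀ v,
        (φ.relabel (Sum.map id e.symm)).Realize (Sum.elim c v) ↔
          φ.Realize (Sum.elim c (v ∘ e.symm)) := by
      intro φ v
      rw [Formula.realize_relabel]
      apply iff_of_eq; congr 1; funext x; rcases x with x | x <;> rfl
    obtain ⟨v, hv⟩ := ih hγ c ((fun φ => φ.relabel (Sum.map id e.symm)) '' p) (by
      intro q hq
      obtain ⟨r, hr, rfl⟩ := Finset.subset_set_image_iff.1 hq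
      obtain ⟨v, hv⟩ := hp r hr
      refine ⟨v ∘ e, fun φ hφ => ?_⟩
      obtain ⟨ψ, hψ, rfl⟩ := Finset.mem_image.1 hφ
      rw [key]
      convert hv ψ hψ using 2
      funext x; simp)
    exact ⟨v ∘ e.symm, fun φ hφ => (key _ _).1 (hv _ ⟨φ, hφ, rfl⟩)⟩
  | h_empty =>
    intro γ hγ c p hp
    refine ⟨isEmptyElim, fun φ hφ => ?_⟩
    obtain ⟨v, hv⟩ := hp {φ} (by simpa using hφ)
    convert hv φ (by simp)
    exact isEmptyElim (α := PEmpty.{1}) (by assumption)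
  | @h_option ι _ ih =>
    intro γ hγ c p hp
    let g : γ ⊕ Option ι → (γ ⊕ Fin 1) ⊕ ι := Sum.elim (Sum.inl ∘ Sum.inl)
      (fun o => o.elim (Sum.inl (Sum.inr 0)) Sum.inr)
    have hg : ∀ (a : Fin 1 → N) (w : ι → N), Sum.elim (Sum.elim c a) w ∘ g =
        Sum.elim c (fun o => o.elim (a 0) w) := by
      intro a w; funext x
      rcases x with x | x | x <;> rfl
    let ψ : Finset (L.Formula (γ ⊕ Option ι)) → L.Formula (γ ⊕ Fin 1) := fun q =>
      Formula.iExs ι (Formula.iInf fun φ : q => (φ : L.Formula (γ ⊕ Option ι)).relabel g)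
    have hψ : ∀ q (a : Fin 1 → N), (ψ q).Realize (Sum.elim c a) ↔
        ∃ w : ι → N, ∀ φ ∈ q, φ.Realize (Sum.elim c (fun o => o.elim (a 0) w)) := by
      intro q a
      simp only [ψ, Formula.realize_iExs, Formula.realize_iInf, Formula.realize_relabel, hg]
      simp
    obtain ⟨a, ha⟩ := hN.realize_one hγ c (ψ '' {q | (q : Set _) ⊆ p}) (by
      intro Q hQ
      obtain ⟨R, hR, rfl⟩ := Finset.subset_set_image_iff.1 hQ
      obtain ⟨v, hv⟩ := hp (R.biUnion id) (by
        intro φ hφ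
        simp only [Finset.coe_biUnion, Set.mem_iUnion] at hφ
        obtain ⟨r, hr, hφ⟩ := hφ
        exact hR hr hφ)
      refine ⟨fun _ => v none, fun φ hφ => ?_⟩
      obtain ⟨r, hr, rfl⟩ := Finset.mem_image.1 hφ
      rw [hψ]
      refine ⟨fun i => v (some i), fun φ hφ => ?_⟩
      convert hv φ (Finset.mem_biUnion.2 ⟨r, hr, hφ⟩) using 2
      funext o; cases o <;> rfl)
    obtain ⟨w, hw⟩ := ih (γ := γ ⊕ Fin 1) (by
        rw [Cardinal.mk_sum]
        refine Cardinal.add_lt_of_lt hκ (by simpa using hγ) ?_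
        exact lt_of_lt_of_le (by simp) hκ) (Sum.elim c a)
      ((fun φ => φ.relabel g) '' p) (by
        intro q hq
        obtain ⟨r, hr, rfl⟩ := Finset.subset_set_image_iff.1 hq
        obtain ⟨w, hw⟩ := (hψ r a).1 (ha _ ⟨r, hr, rfl⟩)
        refine ⟨w, fun φ hφ => ?_⟩
        obtain ⟨χ, hχ, rfl⟩ := Finset.mem_image.1 hφ
        rw [Formula.realize_relabel, hg]
        exact hw χ hχ)
    refine ⟨fun o => o.elim (a 0) w, fun φ hφ => ?_⟩
    have := hw _ ⟨φ, hφ, rfl⟩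
    simp only [Formula.realize_relabel] at this
    rwa [hg] at this

/-- One implication suffices because formulas can be negated, and the formulas expressing equality
make `c x ↦ d x` well defined on the range of `c`. -/
theorem IsStronglyHomogeneous.exists_aut (hN : IsStronglyHomogeneous L κ N) {γ : Type u}
    (hγ : Cardinal.mk γ < κ) (c d : γ → N)
    (h : ∀ φ : L.Formula γ, φ.Realize c → φ.Realize d) : ∃ σ : N ≃[L] N, ∀ x, σ (c x) = d x := by
  have h' : ∀ φ : L.Formula γ, φ.Realize c ↔ φ.Realize d := by
    intro φ
    refine ⟨h φ, fun hd => ?_⟩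
    by_contra hc
    exact (Formula.realize_not.1 (h φ.not (Formula.realize_not.2 hc))) hd
  have hcd : ∀ x y, c x = c y → d x = d y := by
    intro x y hxy
    have := h (Term.equal (Term.var x) (Term.var y)) (by simpa using hxy)
    simpa using this
  choose s hs using fun y : Set.range c => y.2
  obtain ⟨σ, hσ⟩ := hN (Set.range c) (Cardinal.mk_range_le.trans_lt hγ) (d ∘ s) (by
    intro φ
    have := h' (φ.relabel s)
    rw [Formula.realize_relabel, Formula.realize_relabel] at this
    convert this using 2
    funext y
    exact (hs y).symm)
  refine ⟨σ, fun x => ?_⟩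
  rw [hσ ⟨c x, x, rfl⟩]
  exact hcd _ _ (hs ⟨c x, x, rfl⟩)

end Saturation

/-! ### Type-definable sets and their projections. -/

section TypeDefinable

variable {L : FirstOrder.Language.{u, u}} {N : Type u} [L.Structure N] {κ : Cardinal.{u}}
  {P : Set N} {ι ι' : Type}

theorem isTypeDefinable_iff {X : Set (ι → N)} : IsTypeDefinable L P X ↔
    ∃ p : Set (L.Formula (P ⊕ ι)), ∀ x, x ∈ X ↔ ∀ φ ∈ p, φ.Realize (Sum.elim (↑) x) := by
  constructor
  · rintro ⟨S, hS, rfl⟩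
    refine ⟨{φ | {v : ι → N | φ.Realize (Sum.elim (↑) v)} ∈ S}, fun x => ?_⟩
    constructor
    · intro hx φ hφ
      exact hx _ hφ
    · intro hx s hs
      obtain ⟨φ, rfl⟩ := Set.definable_iff_exists_formula_sum.1 (hS s hs)
      exact hx φ hs
  · rintro ⟨p, hp⟩
    refine ⟨(fun φ => {v : ι → N | φ.Realize (Sum.elim (↑) v)}) '' p, ?_, ?_⟩
    · rintro _ ⟨φ, _, rfl⟩
      exact Set.definable_iff_exists_formula_sum.2 ⟨φ, rfl⟩
    · ext x
      rw [hp]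
      simp

theorem isTypeDefinable_formula {β : Type*} (b : β → N) (hb : ∀ x, b x ∈ P)
    (φ : L.Formula (β ⊕ ι)) : IsTypeDefinable L P {x | φ.Realize (Sum.elim b x)} := by
  rw [isTypeDefinable_iff]
  refine ⟨{φ.relabel (Sum.map (fun x => ⟨b x, hb x⟩) id)}, fun x => ?_⟩
  simp only [Set.mem_singleton_iff, forall_eq, Formula.realize_relabel]
  apply iff_of_eq
  change φ.Realize _ = _
  congr 1
  funext y; rcases y with y | y <;> rfl

theorem IsTypeDefinable.inter {X Y : Set (ι → N)} (hX : IsTypeDefinable L P X)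
    (hY : IsTypeDefinable L P Y) : IsTypeDefinable L P (X ∩ Y) := by
  obtain ⟨S, hS, rfl⟩ := hX
  obtain ⟨T, hT, rfl⟩ := hY
  refine ⟨S ∪ T, ?_, Set.sInter_union S T |>.symm⟩
  rintro s (hs | hs)
  exacts [hS s hs, hT s hs]

theorem IsTypeDefinable.preimage_comp {X : Set (ι → N)} (hX : IsTypeDefinable L P X)
    (f : ι → ι') : IsTypeDefinable L P {x : ι' → N | x ∘ f ∈ X} := by
  obtain ⟨S, hS, rfl⟩ := hX
  refine ⟨(fun s => {x : ι' → N | x ∘ f ∈ s}) '' S, ?_, ?_⟩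
  · rintro _ ⟨s, hs, rfl⟩
    exact (hS s hs).preimage_comp f
  · ext x; simp

/-- Compactness: by saturation a fibre is nonempty as soon as each finite part of the type is
solvable in it, and each such solvability is one formula over `P`. Smallness of `P` is what allows
saturation to be used. -/
theorem IsTypeDefinable.exists [Finite ι'] (hN : IsMonster L κ N) (hP : Cardinal.mk P < κ)
    [Finite ι] {X : Set (ι ⊕ ι' → N)} (hX : IsTypeDefinable L P X) :
    IsTypeDefinable L P {v : ι → N | ∃ w : ι' → N, Sum.elim v w ∈ X} := by
  classical
  obtain ⟨p, hp⟩ := isTypeDefinable_iff.1 hX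
  rw [isTypeDefinable_iff]
  let g : P ⊕ (ι ⊕ ι') → (P ⊕ ι) ⊕ ι' := (Equiv.sumAssoc _ _ _).symm
  have hg : ∀ (v : ι → N) (w : ι' → N), Sum.elim (Sum.elim (fun x : P => (x : N)) v) w ∘ g =
      Sum.elim (↑) (Sum.elim v w) := by
    intro v w; funext x
    rcases x with x | x | x <;> rfl
  let ψ : Finset (L.Formula (P ⊕ (ι ⊕ ι'))) → L.Formula (P ⊕ ι) := fun q =>
    Formula.iExs ι' (Formula.iInf fun φ : q => (φ : L.Formula (P ⊕ (ι ⊕ ι'))).relabel g)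
  have hψ : ∀ q (v : ι → N), (ψ q).Realize (Sum.elim (↑) v) ↔
      ∃ w : ι' → N, ∀ φ ∈ q, φ.Realize (Sum.elim (fun x : P => (x : N)) (Sum.elim v w)) := by
    intro q a
    simp only [ψ, Formula.realize_iExs, Formula.realize_iInf, Formula.realize_relabel, hg]
    simp
  refine ⟨ψ '' {q | (q : Set _) ⊆ p}, fun v => ?_⟩
  constructor
  · rintro ⟨w, hw⟩ _ ⟨q, hq, rfl⟩
    exact (hψ _ _).2 ⟨w, fun φ hφ => (hp _).1 hw φ (hq hφ)⟩
  · intro h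
    obtain ⟨w, hw⟩ := hN.saturated.realize hN.aleph0_lt.le ι' (γ := P ⊕ ULift.{u} ι) (by
        rw [Cardinal.mk_sum]
        refine Cardinal.add_lt_of_lt hN.aleph0_lt.le (by simpa using hP) ?_
        refine lt_of_lt_of_le ?_ hN.aleph0_lt.le
        simp) (Sum.elim (↑) (fun i => v i.down))
      ((fun φ => φ.relabel (Sum.map (Sum.map id ULift.up) id ∘ g)) '' p) (by
        intro q hq
        obtain ⟨r, hr, rfl⟩ := Finset.subset_set_image_iff.1 hq
        obtain ⟨w, hw⟩ := (hψ r v).1 (h _ ⟨r, hr, rfl⟩)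
        refine ⟨w, fun φ hφ => ?_⟩
        obtain ⟨χ, hχ, rfl⟩ := Finset.mem_image.1 hφ
        rw [Formula.realize_relabel]
        convert hw χ hχ using 1
        rw [← hg, ← Function.comp_assoc]
        congr 1
        funext x; rcases x with (x | x) | x <;> rfl)
    refine ⟨w, (hp _).2 fun φ hφ => ?_⟩
    have := hw _ ⟨φ, hφ, rfl⟩
    simp only [Formula.realize_relabel] at this
    convert this using 1
    rw [← hg, ← Function.comp_assoc]
    congr 1
    funext x; rcases x with (x | x) | x <;> rfl

theorem IsTypeDefinable.isInvariant {X : Set (ι → N)} (hX : IsTypeDefinable L P X) :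
    IsInvariant L P X := by
  obtain ⟨p, hp⟩ := isTypeDefinable_iff.1 hX
  have key : ∀ σ : N ≃[L] N, (∀ x ∈ P, σ x = x) → ∀ x ∈ X, σ ∘ x ∈ X := by
    intro σ hσ x hx
    rw [hp] at hx ⊢
    intro φ hφ
    have := (StrongHomClass.realize_formula σ φ (v := Sum.elim (fun x : P => (x : N)) x)).2
      (hx φ hφ)
    convert this using 1
    funext y
    rcases y with y | y
    · exact (hσ _ y.2).symm
    · rfl
  intro σ hσ
  apply subset_antisymm
  · rintro _ ⟨x, hx, rfl⟩
    exact key σ hσ x hx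
  · intro x hx
    refine ⟨σ.symm ∘ x, key σ.symm (fun y hy => ?_) x hx, ?_⟩
    · conv_lhs => rw [← hσ y hy]
      exact σ.symm_apply_apply y
    · funext i
      exact σ.apply_symm_apply (x i)

end TypeDefinable


/-! ### Bounded index of the 000-component. -/

theorem mk_quotient_le_of_map {Γ X : Type u} [Group Γ] (H : Subgroup Γ) (f : Γ → X)
    (hf : ∀ x y, f x = f y → x⁻¹ * y ∈ H) : Cardinal.mk (Γ ⧸ H) ≤ Cardinal.mk X := by
  refine Cardinal.mk_le_of_injective (f := fun q : Γ ⧸ H => f q.out) fun p q h => ?_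
  have := QuotientGroup.eq.2 (hf _ _ h)
  rwa [QuotientGroup.out_eq', QuotientGroup.out_eq'] at this

section Component

variable (L : FirstOrder.Language.{u, u}) {N : Type u} [L.Structure N] {κ : Cardinal.{u}}
  (P : Set N) {ι : Type} {Γ : Type u} [Group Γ]

/-- `Γ` is identified by `c` with a set of tuples, on which `Aut(N / P)` acts by group
homomorphisms. -/
structure IsCoord (c : Γ → ι → N) : Prop where
  injective : Function.Injective c
  exists_hom : ∀ σ : N ≃[L] N, (∀ p ∈ P, σ p = p) → ∃ φ : Γ →* Γ, ∀ x, c (φ x) = σ ∘ c x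

variable {L P} {c : Γ → ι → N}

theorem aut_symm_fixes {σ : N ≃[L] N} (hσ : ∀ p ∈ P, σ p = p) : ∀ p ∈ P, σ.symm p = p := by
  intro p hp
  conv_lhs => rw [← hσ p hp]
  exact σ.symm_apply_apply p

theorem IsCoord.isInvariant_iff (hc : IsCoord L P c) {H : Set Γ} :
    IsInvariant L P (c '' H) ↔ ∀ σ : N ≃[L] N, (∀ p ∈ P, σ p = p) →
      ∀ x y, c y = σ ∘ c x → x ∈ H → y ∈ H := by
  constructor
  · intro h σ hσ x y hxy hx
    have : c y ∈ c '' H := by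
      rw [← h σ hσ]
      exact ⟨c x, ⟨x, hx, rfl⟩, hxy.symm⟩
    obtain ⟨z, hz, hzy⟩ := this
    rwa [← hc.injective hzy]
  · intro h σ hσ
    apply subset_antisymm
    · rintro _ ⟨_, ⟨x, hx, rfl⟩, rfl⟩
      obtain ⟨φ, hφ⟩ := hc.exists_hom σ hσ
      exact ⟨φ x, h σ hσ x _ (hφ x) hx, hφ x⟩
    · rintro _ ⟨x, hx, rfl⟩
      obtain ⟨φ, hφ⟩ := hc.exists_hom σ.symm (aut_symm_fixes hσ)
      refine ⟨c (φ x), ⟨φ x, h σ.symm (aut_symm_fixes hσ) x _ (hφ x) hx, rfl⟩, ?_⟩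
      funext i
      simp [hφ]

theorem comp000_le {H : Subgroup Γ} (h1 : IsInvariant L P (c '' (H : Set Γ)))
    (h2 : Cardinal.mk (Γ ⧸ H) < κ) : comp000 L κ P c ≤ H := sInf_le ⟨h1, h2⟩

theorem comp00_le {H : Subgroup Γ} (h1 : IsTypeDefinable L P (c '' (H : Set Γ)))
    (h2 : Cardinal.mk (Γ ⧸ H) < κ) : comp00 L κ P c ≤ H := sInf_le ⟨h1, h2⟩

theorem comp000_le_comp00 : comp000 L κ P c ≤ comp00 L κ P c :=
  sInf_le_sInf fun _ h => ⟨h.1.isInvariant, h.2⟩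

theorem IsCoord.comp000_mem (hc : IsCoord L P c) (σ : N ≃[L] N) (hσ : ∀ p ∈ P, σ p = p)
    (x y : Γ) (hxy : c y = σ ∘ c x) (hx : x ∈ comp000 L κ P c) : y ∈ comp000 L κ P c := by
  rw [comp000, Subgroup.mem_sInf] at hx ⊢
  intro H hH
  exact hc.isInvariant_iff.1 hH.1 σ hσ x y hxy (hx H hH)

theorem IsMonster.exists_small_elementarySubstructure (hN : IsMonster L κ N)
    (hP : Cardinal.mk P < κ) : ∃ S : L.ElementarySubstructure N, P ⊆ S ∧ Cardinal.mk S < κ := by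
  -- Downward Löwenheim–Skolem needs a model at least as large as the target cardinal, so a small
  -- `N` is taken whole.
  by_cases h : Cardinal.mk N < κ
  · refine ⟨⊤, by simp, ?_⟩
    exact (Cardinal.mk_set_le _).trans_lt h
  · obtain ⟨S, h1, h2⟩ := exists_elementarySubstructure_card_eq L P
      (max Cardinal.aleph0 (max (Cardinal.mk P) L.card)) (le_max_left _ _)
      (by simp) (by simp) (by
        simp only [Cardinal.lift_id]
        exact (max_le hN.aleph0_lt.le (max_le hP.le hN.card_lt.le)).trans (not_lt.1 h))
    refine ⟨S, h1, ?_⟩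
    simp only [Cardinal.lift_id] at h2
    rw [h2]
    exact max_lt hN.aleph0_lt (max_lt hP hN.card_lt)

/-- The type of the element `x` over the set `S`. -/
def typeOver (L : FirstOrder.Language.{u, u}) {N : Type u} [L.Structure N] (S : Set N)
    {ι : Type} (x : ι → N) : Set (L.Formula (S ⊕ ι)) :=
  {φ | φ.Realize (Sum.elim (↑) x)}

theorem mk_formula_lt (hκ : Cardinal.aleph0 < κ) (hL : L.card < κ) {α : Type u}
    (hα : Cardinal.mk α < κ) : Cardinal.mk (L.Formula α) < κ := by
  have h1 : Cardinal.mk (L.Formula α) ≤ Cardinal.mk (Σ n, L.BoundedFormula α n) :=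
    Cardinal.mk_le_of_injective (f := fun φ => ⟨0, φ⟩) (fun a b h => by simpa using h)
  refine (h1.trans BoundedFormula.card_le).trans_lt ?_
  simp only [Cardinal.lift_id]
  exact max_lt hκ (Cardinal.add_lt_of_lt hκ.le hα hL)

theorem mk_sum_lt (hκ : Cardinal.aleph0 ≤ κ) {α β : Type u} (hα : Cardinal.mk α < κ)
    (hβ : Cardinal.mk β < κ) : Cardinal.mk (α ⊕ β) < κ := by
  rw [Cardinal.mk_sum]
  exact Cardinal.add_lt_of_lt hκ (by simpa using hα) (by simpa using hβ)

theorem mk_prod_lt (hκ : Cardinal.aleph0 ≤ κ) {α β : Type u} (hα : Cardinal.mk α < κ)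
    (hβ : Cardinal.mk β < κ) : Cardinal.mk (α × β) < κ := by
  rw [Cardinal.mk_prod]
  exact Cardinal.mul_lt_of_lt hκ (by simpa using hα) (by simpa using hβ)

theorem mk_fun_lt (hκ : κ.IsStrongLimit) {α β : Type u} (hα : Cardinal.mk α < κ)
    (hβ : Cardinal.mk β < κ) (hκ' : Cardinal.aleph0 < κ) : Cardinal.mk (α → β) < κ := by
  have h : Cardinal.mk (α → β) ≤ Cardinal.mk (Set (α × β)) :=
    Cardinal.mk_le_of_injective (f := fun f : α → β => {p : α × β | f p.1 = p.2}) (by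
      intro f g h
      funext a
      have : (a, f a) ∈ {p : α × β | g p.1 = p.2} := by
        have h' : {p : α × β | f p.1 = p.2} = {p : α × β | g p.1 = p.2} := h
        rw [← h']
        exact (rfl : f a = f a)
      exact this.symm)
  refine h.trans_lt ?_
  rw [Cardinal.mk_set]
  exact hκ.isStrongPrelimit (mk_prod_lt hκ'.le hα hβ)

theorem mk_finite_lt (hκ : Cardinal.aleph0 ≤ κ) (ι : Type) [Finite ι] :
    Cardinal.mk (ULift.{u} ι) < κ :=
  lt_of_lt_of_le (by simp) hκ

/-- Elements of `Γ` with the same type over a small model containing `P` lie in the same coset of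
every `P`-invariant subgroup of bounded index. -/
theorem inv_mul_mem_of_typeOver_eq [Finite ι] (hN : IsMonster L κ N) (hc : IsCoord L P c)
    (S : L.ElementarySubstructure N) (hPS : P ⊆ S) (hS : Cardinal.mk S < κ) {H : Subgroup Γ}
    (h1 : IsInvariant L P (c '' (H : Set Γ))) (h2 : Cardinal.mk (Γ ⧸ H) < κ) {a b : Γ}
    (hab : typeOver L (S : Set N) (c a) = typeOver L (S : Set N) (c b)) : a⁻¹ * b ∈ H := by
  classical
  have hκ := hN.aleph0_lt.le
  -- the coheir
  let E : L.Formula ((S : Set N) ⊕ ι) → Set (ι → S) := fun φ =>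
    {m | φ.Realize (Sum.elim (↑) (fun i => (m i : N)))}
  -- The sets `E φ` form a directed family of nonempty sets: `S` is elementary, so each formula true
  -- of `c a` has a solution in `S`.
  obtain ⟨U, hU⟩ : ∃ U : Ultrafilter (ι → S), ∀ φ ∈ typeOver L (S : Set N) (c a), E φ ∈ U := by
    have : Nonempty (typeOver L (S : Set N) (c a)) :=
      ⟨⟨⊤, (Formula.realize_top : (⊤ : L.Formula _).Realize _ ↔ True).2 trivial⟩⟩
    have hne : (⨅ φ : typeOver L (S : Set N) (c a), Filter.principal (E φ.1)).NeBot := by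
      refine Filter.iInf_neBot_of_directed' (f := fun φ : typeOver L (S : Set N) (c a) =>
        Filter.principal (E φ.1)) ?_ ?_
      · intro φ ψ
        refine ⟨⟨φ.1 ⊓ ψ.1, ?_⟩, ?_, ?_⟩
        · exact Formula.realize_inf.2 ⟨φ.2, ψ.2⟩
        · simp only [ge_iff_le, Filter.le_principal_iff, Filter.mem_principal]
          intro m hm
          exact (Formula.realize_inf.1 hm).1
        · simp only [ge_iff_le, Filter.le_principal_iff, Filter.mem_principal]
          intro m hm
          exact (Formula.realize_inf.1 hm).2
      · intro φ
        rw [Filter.principal_neBot_iff]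
        have : (Formula.iExs ι φ.1).Realize (fun s : (S : Set N) => (s : N)) :=
          Formula.realize_iExs.2 ⟨c a, φ.2⟩
        have h := (S.subtype.map_formula (Formula.iExs ι φ.1) (fun s : (S : Set N) => s)).1 this
        obtain ⟨m, hm⟩ := Formula.realize_iExs.1 h
        refine ⟨m, ?_⟩
        have := (S.subtype.map_formula φ.1 _).2 hm
        change φ.1.Realize _
        convert this using 1
        funext x; rcases x with x | x <;> rfl
    refine ⟨@Ultrafilter.of _ _ hne, fun φ hφ => ?_⟩
    exact @Ultrafilter.of_le _ _ hne _ (Filter.mem_iInf_of_mem ⟨φ, hφ⟩ (Filter.mem_principal_self _))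
  -- representatives of the cosets
  let rep : Γ ⧸ H → Γ := fun q =>
    if h : ∃ y : Γ, (y : Γ ⧸ H) = q ∧ typeOver L (S : Set N) (c y) = typeOver L (S : Set N) (c a)
      then h.choose else a
  have hrep : ∀ q, typeOver L (S : Set N) (c (rep q)) = typeOver L (S : Set N) (c a) := by
    intro q
    simp only [rep]
    split_ifs with h
    · exact h.choose_spec.2
    · rfl
  have hrep' : ∀ y, typeOver L (S : Set N) (c y) = typeOver L (S : Set N) (c a) →
      (rep y)⁻¹ * y ∈ H := by
    intro y hy
    rw [← QuotientGroup.eq]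
    have h : ∃ z : Γ, (z : Γ ⧸ H) = y ∧
      typeOver L (S : Set N) (c z) = typeOver L (S : Set N) (c a) := ⟨y, rfl, hy⟩
    simp only [rep, dif_pos h]
    exact h.choose_spec.1
  -- a realization of the coheir
  let Y : Type u := Option (Option (Γ ⧸ H))
  -- Besides `a` and `b`, the parameters contain a realization of the type of `a` from every coset
  -- that has one; `rep` falls back to `a` on the other cosets.
  let e : Y → Γ := fun o => o.elim a (fun o => o.elim b rep)
  have he : ∀ y, typeOver L (S : Set N) (c (e y)) = typeOver L (S : Set N) (c a) := by
    rintro (_ | _ | q)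
    exacts [rfl, hab.symm, hrep q]
  let γ : Type u := (S : Set N) ⊕ (Y × ULift.{u} ι)
  let d : γ → N := Sum.elim (↑) (fun p => c (e p.1) p.2.down)
  have hSγ : Cardinal.mk (S : Set N) < κ := hS
  have hY : Cardinal.mk Y < κ := by
    have h1 : (1 : Cardinal) < κ := Cardinal.one_lt_aleph0.trans hN.aleph0_lt
    simp only [Y, Cardinal.mk_option]
    exact Cardinal.add_lt_of_lt hκ (Cardinal.add_lt_of_lt hκ h2 h1) h1
  have hγ : Cardinal.mk γ < κ := mk_sum_lt hκ hSγ (mk_prod_lt hκ hY (mk_finite_lt hκ ι))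
  let V : L.Formula (γ ⊕ ι) → Set (ι → S) := fun φ =>
    {m | φ.Realize (Sum.elim d (fun i => (m i : N)))}
  obtain ⟨v, hv⟩ := hN.saturated.realize hκ ι hγ d {φ | V φ ∈ U} (by
    intro q hq
    have : (⋂ φ ∈ q, V φ) ∈ U := (Filter.biInter_finset_mem q).2 fun φ hφ => hq hφ
    obtain ⟨m, hm⟩ := U.nonempty_of_mem this
    refine ⟨fun i => m i, fun φ hφ => ?_⟩
    exact Set.mem_iInter₂.1 hm φ hφ)
  have hv' : ∀ φ : L.Formula (γ ⊕ ι), φ.Realize (Sum.elim d v) ↔ V φ ∈ U := by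
    intro φ
    refine ⟨fun h => ?_, fun h => hv φ h⟩
    by_contra h'
    have : V φ.not ∈ U := by
      have := Ultrafilter.compl_mem_iff_notMem.2 h'
      convert this using 1
      ext m
      exact Formula.realize_not
    exact Formula.realize_not.1 (hv _ this) h
  have hva : ∀ φ ∈ typeOver L (S : Set N) (c a), φ.Realize (Sum.elim (↑) v) := by
    intro φ hφ
    have h := (hv' (φ.relabel (Sum.map Sum.inl id))).2 (by
      refine Filter.mem_of_superset (hU φ hφ) fun m hm => ?_
      simp only [V, Set.mem_ofPred_eq, Formula.realize_relabel]
      change φ.Realize _ at hm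
      convert hm using 1
      funext x; rcases x with x | x <;> rfl)
    rw [Formula.realize_relabel] at h
    convert h using 1
    funext x; rcases x with x | x <;> rfl
  -- it lies in `Γ`
  obtain ⟨x, hx⟩ : ∃ x : Γ, c x = v := by
    obtain ⟨σ, hσ⟩ := hN.homogeneous.exists_aut (γ := (S : Set N) ⊕ ULift.{u} ι)
      (mk_sum_lt hκ hSγ (mk_finite_lt hκ ι)) (Sum.elim (↑) (fun i => c a i.down))
      (Sum.elim (↑) (fun i => v i.down)) (by
        intro φ hφ
        have := hva (φ.relabel (Sum.map id ULift.down)) (by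
          simp only [typeOver, Set.mem_ofPred_eq, Formula.realize_relabel]
          convert hφ using 1
          funext x; rcases x with x | x <;> rfl)
        rw [Formula.realize_relabel] at this
        convert this using 1
        funext x; rcases x with x | x <;> rfl)
    obtain ⟨φ, hφ⟩ := hc.exists_hom σ fun p hp => hσ (Sum.inl ⟨p, hPS hp⟩)
    refine ⟨φ a, ?_⟩
    rw [hφ]
    funext i
    exact hσ (Sum.inr ⟨i⟩)
  subst hx
  have htx : typeOver L (S : Set N) (c x) = typeOver L (S : Set N) (c a) := by
    refine Set.Subset.antisymm (fun φ hφ => ?_) hva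
    by_contra h
    exact Formula.realize_not.1 (hva φ.not (Formula.realize_not.2 h)) hφ
  -- all the pairs `(e y, x)` are conjugate
  have hconj : ∀ y z : Y, (e y)⁻¹ * x ∈ H → (e z)⁻¹ * x ∈ H := by
    intro y z hy
    let w : Y → (S : Set N) ⊕ (ULift.{u} ι ⊕ ULift.{u} ι) → N := fun y =>
      Sum.elim (↑) (Sum.elim (fun i => c (e y) i.down) (fun i => c x i.down))
    obtain ⟨σ, hσ⟩ := hN.homogeneous.exists_aut (mk_sum_lt hκ hSγ
      (mk_sum_lt hκ (mk_finite_lt hκ ι) (mk_finite_lt hκ ι))) (w y) (w z) (by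
      -- Whether φ holds of `(e y, x)` is decided by the set of `m` from `S` with φ of `(e y, m)`.
      -- That set depends only on the type of `e y` over `S`, which is the same for all `y`.
      have key : ∀ (y : Y) (φ : L.Formula ((S : Set N) ⊕ (ULift.{u} ι ⊕ ULift.{u} ι))),
          φ.Realize (w y) ↔
          {m : ι → S | φ.Realize (Sum.elim (fun s : (S : Set N) => (s : N))
            (Sum.elim (fun i => c (e y) i.down) (fun i => (m i.down : N))))} ∈ U := by
        intro y φ
        let g : (S : Set N) ⊕ (ULift.{u} ι ⊕ ULift.{u} ι) → γ ⊕ ι := Sum.elim (Sum.inl ∘ Sum.inl)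
          (Sum.elim (fun i => Sum.inl (Sum.inr (y, i))) (fun i => Sum.inr i.down))
        have h1 : ∀ v : ι → N, Sum.elim d v ∘ g = Sum.elim (fun s : (S : Set N) => (s : N))
            (Sum.elim (fun i => c (e y) i.down) (fun i => v i.down)) := by
          intro v; funext x; rcases x with x | x | x <;> rfl
        have := hv' (φ.relabel g)
        simp only [V, Formula.realize_relabel, h1] at this
        exact this
      intro φ hφ
      rw [key] at hφ ⊢
      refine Filter.mem_of_superset hφ fun m hm => ?_
      let g : (S : Set N) ⊕ (ULift.{u} ι ⊕ ULift.{u} ι) → (S : Set N) ⊕ ι :=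
        Sum.elim Sum.inl (Sum.elim (fun i => Sum.inr i.down) (fun i => Sum.inl (m i.down)))
      have h1 : ∀ v : ι → N, Sum.elim (fun s : (S : Set N) => (s : N)) v ∘ g =
          Sum.elim (fun s : (S : Set N) => (s : N))
            (Sum.elim (fun i => v i.down) (fun i => (m i.down : N))) := by
        intro v; funext x; rcases x with x | x | x <;> rfl
      have h2 : φ.relabel g ∈ typeOver L (S : Set N) (c (e y)) := by
        simp only [typeOver, Set.mem_ofPred_eq, Formula.realize_relabel, h1]
        exact hm
      rw [he y, ← he z] at h2
      simp only [typeOver, Set.mem_ofPred_eq, Formula.realize_relabel, h1] at h2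
      exact h2)
    have hσP : ∀ p ∈ P, σ p = p := fun p hp => hσ (Sum.inl ⟨p, hPS hp⟩)
    obtain ⟨φ, hφ⟩ := hc.exists_hom σ hσP
    have e1 : φ (e y) = e z := hc.injective (by
      rw [hφ]; funext i; exact hσ (Sum.inr (Sum.inl ⟨i⟩)))
    have e2 : φ x = x := hc.injective (by
      rw [hφ]; funext i; exact hσ (Sum.inr (Sum.inr ⟨i⟩)))
    refine hc.isInvariant_iff.1 h1 σ hσP _ _ ?_ hy
    rw [← hφ, map_mul, map_inv, e1, e2]
  -- `x` has the type of `a` itself, so its own coset has a representative among the parameters; one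
  -- pair in the same coset then forces all of them to be.
  have hx : (e (some (some x)))⁻¹ * x ∈ H := hrep' x htx
  have ha : a⁻¹ * x ∈ H := hconj _ none hx
  have hb : b⁻¹ * x ∈ H := hconj _ (some none) hx
  have := H.mul_mem ha (H.inv_mem hb)
  convert this using 1
  group

/-- The type over one small model determines the coset of every invariant subgroup of bounded index
at once, hence the coset of their intersection. There are fewer than `κ` such types because `κ` is a
strong limit. -/
theorem mk_quotient_comp000_lt [Finite ι] (hN : IsMonster L κ N) (hP : Cardinal.mk P < κ)
    (hc : IsCoord L P c) : Cardinal.mk (Γ ⧸ comp000 L κ P c) < κ := by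
  obtain ⟨S, hPS, hS⟩ := hN.exists_small_elementarySubstructure hP
  have hκ := hN.aleph0_lt.le
  let T : Γ → Set (L.Formula ((S : Set N) ⊕ ULift.{u} ι)) := fun x =>
    {φ | φ.Realize (Sum.elim (↑) (fun i => c x i.down))}
  refine (mk_quotient_le_of_map _ T ?_).trans_lt ?_
  · intro a b hab
    rw [comp000, Subgroup.mem_sInf]
    rintro H ⟨h1, h2⟩
    refine inv_mul_mem_of_typeOver_eq hN hc S hPS hS h1 h2 ?_
    ext φ
    have := Set.ext_iff.1 hab (φ.relabel (Sum.map id ULift.up))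
    simp only [T, Set.mem_ofPred_eq, Formula.realize_relabel] at this
    have h3 : ∀ x : Γ, Sum.elim (fun s : (S : Set N) => (s : N)) (fun i : ULift.{u} ι => c x i.down) ∘
        Sum.map id ULift.up = Sum.elim (↑) (c x) := by
      intro x; funext y; rcases y with y | y <;> rfl
    rwa [h3, h3] at this
  · rw [Cardinal.mk_set]
    exact hN.strongLimit.isStrongPrelimit (mk_formula_lt hN.aleph0_lt hN.card_lt
      (mk_sum_lt hκ hS (mk_finite_lt hκ ι)))

end Component

end ConnComp

namespace ConnComp

/-! ### Splittings of a cocycle versus subgroups of the extension. -/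

namespace Cocycle

variable {Γ Q : Type u} [Group Γ] [AddCommGroup Q] [DistribMulAction Γ Q] {h : Cocycle Γ Q}
  {C : AddSubgroup Q} {hC : ∀ g : Γ, ∀ c ∈ C, g • c ∈ C} {K : Subgroup Γ} {F : Γ → Q}

@[simp] theorem Ext.mul_fst (p q : h.Ext) :
    (p * q).fst = p.fst + p.snd • q.fst + h.toFun p.snd q.snd := rfl

@[simp] theorem Ext.mul_snd (p q : h.Ext) : (p * q).snd = p.snd * q.snd := rfl

@[simp] theorem Ext.one_fst : (1 : h.Ext).fst = 0 := rfl

@[simp] theorem Ext.one_snd : (1 : h.Ext).snd = 1 := rfl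

@[simp] theorem Ext.inv_snd (p : h.Ext) : (p⁻¹).snd = p.snd⁻¹ := rfl

/-- The projection of the extension onto `Γ`. -/
def Ext.sndHom (h : Cocycle Γ Q) : h.Ext →* Γ where
  toFun := Ext.snd
  map_one' := rfl
  map_mul' _ _ := rfl

@[simp] theorem Ext.sndHom_apply (p : h.Ext) : Ext.sndHom h p = p.snd := rfl

/-- `F` splits `h` on `K` modulo `C`. -/
structure SplitsOn (h : Cocycle Γ Q) (C : AddSubgroup Q) (K : Subgroup Γ) (F : Γ → Q) : Prop where
  one : F 1 ∈ C
  cocycle_mem : ∀ x ∈ K, ∀ y ∈ K, h.toFun x y - (F x + x • F y - F (x * y)) ∈ C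

/-- A splitting with values in the quotient is lifted to representatives and set to 0 outside `K`.
Normalization survives only modulo `C`, which is why `SplitsOn` asks for `F 1 ∈ C`. -/
theorem isSplitOnMod_iff : h.IsSplitOnMod C hC K ↔
    ∃ F : Γ → Q, (∀ x ∈ K, F x ∈ h.imageSubgroup) ∧ h.SplitsOn C K F := by
  classical
  constructor
  · rintro ⟨f, hf, hf1⟩
    choose g hg using fun x => QuotientAddGroup.mk_surjective (f x)
    refine ⟨fun x => if hx : x ∈ K then g ⟨x, hx⟩ else 0, fun x hx => ?_, ?_, fun x hx y hy => ?_⟩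
    · simp only [dif_pos hx]
      exact (g ⟨x, hx⟩).2
    · simp only [dif_pos K.one_mem]
      have : (QuotientAddGroup.mk (g 1) : h.ImageQuot C) = 0 := by rw [hg, hf1]
      exact AddSubgroup.mem_addSubgroupOf.1 ((QuotientAddGroup.eq_zero_iff _).1 this)
    · simp only [dif_pos hx, dif_pos hy, dif_pos (K.mul_mem hx hy)]
      have := hf ⟨x, hx⟩ ⟨y, hy⟩
      simp only [← hg] at this
      exact AddSubgroup.mem_addSubgroupOf.1 (QuotientAddGroup.eq_iff_sub_mem.1 this)
  · rintro ⟨F, hF, hs⟩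
    refine ⟨fun x => QuotientAddGroup.mk ⟨F x, hF x x.2⟩, fun x y => ?_, ?_⟩
    · exact QuotientAddGroup.eq_iff_sub_mem.2 (hs.cocycle_mem x x.2 y y.2)
    · exact (QuotientAddGroup.eq_zero_iff _).2 hs.one

theorem isSplitMod_iff : h.IsSplitMod C hC ↔ ∃ F : Γ → Q, h.SplitsOn C ⊤ F := by
  constructor
  · rintro ⟨f, hf, hf1⟩
    choose g hg using fun x => QuotientAddGroup.mk_surjective (f x)
    refine ⟨g, ?_, fun x _ y _ => ?_⟩
    · have : (QuotientAddGroup.mk (g 1) : Q ⧸ C) = 0 := by rw [hg, hf1]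
      exact (QuotientAddGroup.eq_zero_iff _).1 this
    · have := hf x y
      simp only [← hg] at this
      exact QuotientAddGroup.eq_iff_sub_mem.1 this
  · rintro ⟨F, hs⟩
    refine ⟨fun x => QuotientAddGroup.mk (F x), fun x y => ?_, ?_⟩
    · exact QuotientAddGroup.eq_iff_sub_mem.2 (hs.cocycle_mem x trivial y trivial)
    · exact (QuotientAddGroup.eq_zero_iff _).2 hs.one

/-- Modulo `C`, `p ↦ p.fst + F p.snd` is a crossed homomorphism on the preimage of `K`; its defect
is exactly the splitting defect of `F`. -/
theorem SplitsOn.mul_sub_mem (hs : h.SplitsOn C K F) {p q : h.Ext} (hp : p.snd ∈ K)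
    (hq : q.snd ∈ K) : ((p * q).fst + F (p * q).snd) -
      (p.fst + F p.snd + p.snd • (q.fst + F q.snd)) ∈ C := by
  convert hs.cocycle_mem _ hp _ hq using 1
  simp only [Ext.mul_fst, Ext.mul_snd, smul_add]
  abel

/-- The subgroup of the extension given by a splitting on `K`. -/
def SplitsOn.subgroup (hs : h.SplitsOn C K F) (hC : ∀ g : Γ, ∀ c ∈ C, g • c ∈ C) :
    Subgroup h.Ext where
  carrier := {p | p.snd ∈ K ∧ p.fst + F p.snd ∈ C}
  one_mem' := ⟨K.one_mem, by simpa using hs.one⟩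
  mul_mem' := by
    rintro p q ⟨hp, hp'⟩ ⟨hq, hq'⟩
    refine ⟨K.mul_mem hp hq, ?_⟩
    have := add_mem (hs.mul_sub_mem hp hq) (add_mem hp' (hC p.snd _ hq'))
    rwa [sub_add_cancel] at this
  inv_mem' := by
    rintro p ⟨hp, hp'⟩
    refine ⟨K.inv_mem hp, ?_⟩
    have h1 := hs.mul_sub_mem (q := p) (p := p⁻¹) (K.inv_mem hp) hp
    rw [inv_mul_cancel] at h1
    have h2 := sub_mem (sub_mem hs.one h1) (hC (p⁻¹).snd _ hp')
    convert h2 using 1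
    simp only [Ext.one_fst, Ext.one_snd]
    abel

theorem SplitsOn.mem_subgroup (hs : h.SplitsOn C K F) {p : h.Ext} :
    p ∈ hs.subgroup hC ↔ p.snd ∈ K ∧ p.fst + F p.snd ∈ C := Iff.rfl

/-- When `K` acts trivially modulo `C`, the crossed homomorphism is a genuine homomorphism from the
preimage of `K` to `Q ⧸ C`, with kernel the subgroup of the splitting. -/
theorem SplitsOn.mk_quotient_le (hs : h.SplitsOn C K F)
    (hK : ∀ g ∈ K, ∀ a : Q, g • a - a ∈ C) :
    Cardinal.mk (h.Ext ⧸ hs.subgroup hC) ≤ Cardinal.mk (Γ ⧸ K) * Cardinal.mk (Q ⧸ C) := by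
  have hle : hs.subgroup hC ≤ K.comap (Ext.sndHom h) := fun p hp => hp.1
  rw [Cardinal.mk_congr (Subgroup.quotientEquivProdOfLE hle), Cardinal.mk_prod, Cardinal.lift_id,
    Cardinal.lift_id]
  refine mul_le_mul' ?_ ?_
  · refine mk_quotient_le_of_map _ (fun p => (p.snd : Γ ⧸ K)) fun p q hpq => ?_
    have := QuotientGroup.eq.1 (hpq : (p.snd : Γ ⧸ K) = q.snd)
    exact this
  · refine mk_quotient_le_of_map _
      (fun p => (QuotientAddGroup.mk (p.1.fst + F p.1.snd) : Q ⧸ C)) fun p q hpq => ?_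
    have hpq := QuotientAddGroup.eq_iff_sub_mem.1 hpq
    rw [Subgroup.mem_subgroupOf]
    refine ⟨(p⁻¹ * q).2, ?_⟩
    have h1 := hs.mul_sub_mem (p := p.1) (q := (p⁻¹ * q).1) p.2 (p⁻¹ * q).2
    have h2 := hK _ p.2 ((p⁻¹ * q).1.fst + F (p⁻¹ * q).1.snd)
    have h3 : p.1 * (p⁻¹ * q).1 = q.1 := by simp
    rw [h3] at h1
    have := neg_mem (add_mem (add_mem h1 h2) hpq)
    convert this using 1
    simp only [Ext.sndHom_apply]
    abel

theorem sup_smul_mem (hC : ∀ g : Γ, ∀ c ∈ C, g • c ∈ C) (g : Γ) {a : Q}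
    (ha : a ∈ h.imageSubgroup ⊔ C) : g • a ∈ h.imageSubgroup ⊔ C := by
  obtain ⟨x, hx, y, hy, rfl⟩ := AddSubgroup.mem_sup.1 ha
  rw [smul_add]
  exact AddSubgroup.mem_sup.2 ⟨_, h.smul_mem_imageSubgroup g x hx, _, hC g y hy, rfl⟩

/-- The elements of the extension whose first coordinate is in `Q₀ + C`, where `Q₀` is the subgroup
generated by the image of `h`. -/
def supSubgroup (h : Cocycle Γ Q) (C : AddSubgroup Q) (hC : ∀ g : Γ, ∀ c ∈ C, g • c ∈ C) :
    Subgroup h.Ext where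
  carrier := {p | p.fst ∈ h.imageSubgroup ⊔ C}
  one_mem' := (h.imageSubgroup ⊔ C).zero_mem
  mul_mem' := by
    intro p q hp hq
    exact add_mem (add_mem hp (sup_smul_mem hC _ hq))
      (AddSubgroup.mem_sup_left (h.mem_imageSubgroup _ _))
  inv_mem' := by
    intro p hp
    exact sub_mem (neg_mem (sup_smul_mem hC _ hp))
      (AddSubgroup.mem_sup_left (h.mem_imageSubgroup _ _))

theorem mem_supSubgroup {p : h.Ext} :
    p ∈ h.supSubgroup C hC ↔ p.fst ∈ h.imageSubgroup ⊔ C := Iff.rfl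

/-- All elements `(0, g)` belong to the subgroup, so a coset depends only on the first coordinate,
and on that only modulo `C`. -/
theorem mk_quotient_supSubgroup_le :
    Cardinal.mk (h.Ext ⧸ h.supSubgroup C hC) ≤ Cardinal.mk (Q ⧸ C) := by
  refine mk_quotient_le_of_map _ (fun p => (QuotientAddGroup.mk p.fst : Q ⧸ C)) fun p q hpq => ?_
  have hpq := QuotientAddGroup.eq.1 hpq
  have h1 : ∀ g : Γ, (⟨0, g⟩ : h.Ext) ∈ h.supSubgroup C hC := fun g => (h.imageSubgroup ⊔ C).zero_mem
  have h2 : (⟨-p.fst + q.fst, 1⟩ : h.Ext) ∈ h.supSubgroup C hC := AddSubgroup.mem_sup_right hpq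
  have h3 : p⁻¹ * q = (⟨0, p.snd⟩ : h.Ext)⁻¹ * ⟨-p.fst + q.fst, 1⟩ * ⟨0, q.snd⟩ := by
    have e : ∀ r : h.Ext, r = ⟨r.fst, 1⟩ * ⟨0, r.snd⟩ := by
      intro r; ext <;> simp [h.one_left]
    have e2 : (⟨-p.fst + q.fst, 1⟩ : h.Ext) = (⟨p.fst, 1⟩ : h.Ext)⁻¹ * ⟨q.fst, 1⟩ := by
      rw [eq_inv_mul_iff_mul_eq]
      ext <;> simp [h.one_left]
    conv_lhs => rw [e p, e q]
    rw [e2]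
    group
  rw [h3]
  exact mul_mem (mul_mem (inv_mem (h1 _)) h2) (h1 _)

/-- A subgroup `E` of the extension which projects onto a group containing `K` and meets `Q` within
`C` gives a splitting on `K`. -/
theorem isSplitOnMod_of_subgroup (E : Subgroup h.Ext) (hE : E ≤ h.supSubgroup C hC)
    (hK : K ≤ E.map (Ext.sndHom h)) (hEC : ∀ a : Q, (⟨a, 1⟩ : h.Ext) ∈ E → a ∈ C) :
    h.IsSplitOnMod C hC K := by
  classical
  have key : ∀ x ∈ K, ∃ a ∈ h.imageSubgroup, ∃ p ∈ E, p.snd = x ∧ p.fst + a ∈ C := by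
    intro x hx
    obtain ⟨p, hp, rfl⟩ := hK hx
    obtain ⟨y, hy, z, hz, hyz⟩ := AddSubgroup.mem_sup.1 (mem_supSubgroup.1 (hE hp))
    -- The sign: the section corresponding to a splitting `F` is `g ↦ (-F g, g)`.
    exact ⟨-y, neg_mem hy, p, hp, rfl, by rw [← hyz]; simpa using hz⟩
  choose! F hF hF' using key
  -- Two elements of `E` over the same point differ by an element of `E` inside `Q`, hence of `C`;
  -- `F` is therefore determined modulo `C`.
  have huniq : ∀ p ∈ E, ∀ q ∈ E, p.snd = q.snd → p.fst - q.fst ∈ C := by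
    intro p hp q hq hpq
    refine hEC _ ?_
    have : (⟨p.fst - q.fst, 1⟩ : h.Ext) = p * q⁻¹ := by
      rw [eq_mul_inv_iff_mul_eq]
      ext <;> simp [h.one_left, hpq]
    rw [this]
    exact mul_mem hp (inv_mem hq)
  have hF'' : ∀ p ∈ E, p.snd ∈ K → p.fst + F p.snd ∈ C := by
    intro p hp hpK
    obtain ⟨q, hq, hqp, hqC⟩ := hF' _ hpK
    have := add_mem (huniq p hp q hq hqp.symm) hqC
    convert this using 1
    abel
  refine isSplitOnMod_iff.2 ⟨F, hF, ?_, ?_⟩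
  · simpa using hF'' 1 E.one_mem K.one_mem
  · intro x hx y hy
    obtain ⟨p, hp, rfl, hpC⟩ := hF' _ hx
    obtain ⟨q, hq, rfl, hqC⟩ := hF' _ hy
    have h1 := hF'' (p * q) (mul_mem hp hq) (K.mul_mem hx hy)
    have := sub_mem (sub_mem h1 hpC) (hC p.snd _ hqC)
    convert this using 1
    simp only [Ext.mul_fst, Ext.mul_snd, smul_add]
    abel

end Cocycle

open FirstOrder.Language

/-! ### Maps between interpreted groups induced by elementary embeddings; the image of h*. -/

namespace Interp

section Maps

variable {L : FirstOrder.Language.{u, u}} {β : Type u} {n m : ℕ} {D : ExtFormulas L β n m}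
  {N₁ N₂ : Type u} [L.Structure N₁] [L.Structure N₂] {b₁ : β → N₁} {b₂ : β → N₂}
  (I₁ : Interp D N₁ b₁) (I₂ : Interp D N₂ b₂) (e : N₁ ↪ₑ[L] N₂)

theorem realize_elim₃ {α₁ α₂ α₃ : Type*} (φ : L.Formula (α₁ ⊕ (α₂ ⊕ α₃))) (x : α₁ → N₁)
    (y : α₂ → N₁) (z : α₃ → N₁) : φ.Realize (Sum.elim (e ∘ x) (Sum.elim (e ∘ y) (e ∘ z))) ↔
      φ.Realize (Sum.elim x (Sum.elim y z)) := by
  rw [← e.map_formula, Sum.comp_elim, Sum.comp_elim]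

theorem realize_elim₄ {α₁ α₂ α₃ α₄ : Type*} (φ : L.Formula (α₁ ⊕ (α₂ ⊕ (α₃ ⊕ α₄)))) (w : α₁ → N₁)
    (x : α₂ → N₁) (y : α₃ → N₁) (z : α₄ → N₁) :
    φ.Realize (Sum.elim (e ∘ w) (Sum.elim (e ∘ x) (Sum.elim (e ∘ y) (e ∘ z)))) ↔
      φ.Realize (Sum.elim w (Sum.elim x (Sum.elim y z))) := by
  rw [← e.map_formula, Sum.comp_elim, Sum.comp_elim, Sum.comp_elim]

/-- The homomorphism between the interpreted groups induced by an elementary embedding. -/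
def mapG : I₁.G →* I₂.G :=
  MonoidHom.mk' (fun x => Pts.map e x) fun x y =>
    ((I₂.mul_iff (Pts.map e x) (Pts.map e y) (Pts.map e (x * y))).1
      ((realize_elim₃ e _ _ _ _).2 ((I₁.mul_iff x y (x * y)).2 rfl))).symm

/-- The homomorphism between the interpreted abelian groups induced by an elementary embedding. -/
def mapA : I₁.A →+ I₂.A :=
  AddMonoidHom.mk' (fun x => Pts.map e x) fun x y =>
    ((I₂.add_iff (Pts.map e x) (Pts.map e y) (Pts.map e (x + y))).1
      ((realize_elim₃ e _ _ _ _).2 ((I₁.add_iff x y (x + y)).2 rfl))).symm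

@[simp] theorem coordA_mapA (x : I₁.A) : I₂.coordA (mapA I₁ I₂ e x) = e ∘ I₁.coordA x := rfl

theorem mapA_smul (g : I₁.G) (x : I₁.A) :
    mapA I₁ I₂ e (g • x) = mapG I₁ I₂ e g • mapA I₁ I₂ e x :=
  ((I₂.act_iff (Pts.map e g) (Pts.map e x) (mapA I₁ I₂ e (g • x))).1
    ((realize_elim₃ e _ _ _ _).2 ((I₁.act_iff g x (g • x)).2 rfl))).symm

variable (hb : ∀ x, b₂ x = e (b₁ x))

include hb in
theorem mapA_h (x y : I₁.G) : mapA I₁ I₂ e (I₁.h.toFun x y) =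
    I₂.h.toFun (mapG I₁ I₂ e x) (mapG I₁ I₂ e y) := by
  obtain rfl : b₂ = e ∘ b₁ := funext hb
  exact ((I₂.coc_iff (Pts.map e x) (Pts.map e y) (mapA I₁ I₂ e (I₁.h.toFun x y))).1
    ((realize_elim₄ e _ _ _ _ _).2 ((I₁.coc_iff x y (I₁.h.toFun x y)).2 rfl))).symm

/-- The homomorphism between the extensions induced by an elementary embedding. -/
def mapExt : I₁.Ext →* I₂.Ext :=
  MonoidHom.mk' (fun p => ⟨mapA I₁ I₂ e p.fst, mapG I₁ I₂ e p.snd⟩) fun p q => by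
    ext1
    · simp [mapA_smul, mapA_h I₁ I₂ e hb]
    · simp

theorem coordG_injective : Function.Injective I₁.coordG := fun _ _ h => Pts.ext h

theorem coordA_injective : Function.Injective I₁.coordA := fun _ _ h => Pts.ext h

theorem coordExt_injective : Function.Injective I₁.coordExt := by
  intro p q h
  ext1
  · exact coordA_injective I₁ (funext fun i => congrFun h (Sum.inl i))
  · exact coordG_injective I₁ (funext fun i => congrFun h (Sum.inr i))

theorem coordExt_mapExt (p : I₁.Ext) :
    I₂.coordExt (mapExt I₁ I₂ e hb p) = e ∘ I₁.coordExt p := by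
  funext i
  rcases i with i | i <;> rfl

theorem isCoord_coordG (P : Set N₁) : IsCoord L P I₁.coordG where
  injective := coordG_injective I₁
  exists_hom σ _ := ⟨mapG I₁ I₁ σ.toElementaryEmbedding, fun _ => rfl⟩

theorem isCoord_coordExt (P : Set N₁) (hP : ∀ x, b₁ x ∈ P) : IsCoord L P I₁.coordExt where
  injective := coordExt_injective I₁
  exists_hom σ hσ := ⟨mapExt I₁ I₁ σ.toElementaryEmbedding fun x => (hσ _ (hP x)).symm,
    fun p => coordExt_mapExt I₁ I₁ _ _ p⟩

end Maps

section Image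

variable {L : FirstOrder.Language.{u, u}} {M N : Type u} [L.Structure M] [L.Structure N]
  {B : Set M} {n m : ℕ} {D : ExtFormulas L B n m} (I : Interp D M (fun b : B => (b : M)))
  (j : M ↪ₑ[L] N)

/-- The image being finite, "the value is one of these tuples" is a formula with parameters from
`M`, written as a negated conjunction of negations, and it passes to `N`. -/
theorem h_star_mem_range (hfin : (Set.range fun p : I.G × I.G => I.h.toFun p.1 p.2).Finite)
    (x y : (I.star j).G) : ∃ a ∈ Set.range (fun p : I.G × I.G => I.h.toFun p.1 p.2),
      (I.star j).h.toFun x y = mapA I (I.star j) j a := by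
  classical
  let R := Set.range fun p : I.G × I.G => I.h.toFun p.1 p.2
  have : Finite R := hfin
  let gx : Fin n → (B ⊕ (R × Fin m)) ⊕ (Fin n ⊕ (Fin n ⊕ Fin m)) := Sum.inr ∘ Sum.inl
  let gy : Fin n → (B ⊕ (R × Fin m)) ⊕ (Fin n ⊕ (Fin n ⊕ Fin m)) := Sum.inr ∘ Sum.inr ∘ Sum.inl
  let gz : Fin m → (B ⊕ (R × Fin m)) ⊕ (Fin n ⊕ (Fin n ⊕ Fin m)) := Sum.inr ∘ Sum.inr ∘ Sum.inr
  have := all_transfer j (ι := Fin n ⊕ (Fin n ⊕ Fin m))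
    ((D.domG.relabel gx).imp <| (D.domG.relabel gy).imp <| (D.domA.relabel gz).imp <|
      (D.coc.relabel (Sum.elim (Sum.inl ∘ Sum.inl) (Sum.elim gx (Sum.elim gy gz)))).imp <|
      (Formula.iInf fun r : R => Formula.not (Formula.iInf fun i : Fin m =>
        Term.equal (Term.var (gz i)) (Term.var (Sum.inl (Sum.inr (r, i)))))).not)
    (Sum.elim (fun b : B => (b : M)) (fun p : R × Fin m => I.coordA p.1.1 p.2)) (by
      intro w
      simp only [Formula.realize_imp, Formula.realize_relabel, Formula.realize_not,
        Formula.realize_iInf, Formula.realize_equal, Sum.comp_elim]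
      intro hx hy hz hc hn
      have e := (I.coc_iff ⟨_, hx⟩ ⟨_, hy⟩ ⟨_, hz⟩).1 hc
      refine hn ⟨_, ⟨⟨_, hx⟩, ⟨_, hy⟩⟩, rfl⟩ fun i => ?_
      exact (congrFun (congrArg Pts.val e) i).symm)
    (Sum.elim x.1 (Sum.elim y.1 ((I.star j).h.toFun x y).1))
  simp only [Formula.realize_imp, Formula.realize_relabel, Formula.realize_not,
        Formula.realize_iInf, Formula.realize_equal, Sum.comp_elim] at this
  have := this x.2 y.2 ((I.star j).h.toFun x y).2 (((I.star j).coc_iff x y _).2 rfl)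
  simp only [not_forall] at this
  obtain ⟨r, hr⟩ := this
  refine ⟨r.1, r.2, coordA_injective _ (funext fun i => ?_)⟩
  exact by_contra fun hi => hr ⟨i, hi⟩

/-- A value of h is the unique solution of a formula over `B`. Uniqueness passes to `N`, and `σ`
preserves that formula because it fixes `j '' B`. -/
theorem aut_fixes_h_star (hfin : (Set.range fun p : I.G × I.G => I.h.toFun p.1 p.2).Finite)
    (hdcl : ∀ x y : I.G, B.Definable L {I.coordA (I.h.toFun x y)}) (σ : N ≃[L] N)
    (hσ : ∀ p ∈ j '' B, σ p = p) (x y : (I.star j).G) :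
    mapA (I.star j) (I.star j) σ.toElementaryEmbedding ((I.star j).h.toFun x y) =
      (I.star j).h.toFun x y := by
  obtain ⟨_, ⟨⟨x', y'⟩, rfl⟩, h⟩ := h_star_mem_range I j hfin x y
  obtain ⟨φ, hφ⟩ := Set.definable_iff_exists_formula_sum.1 (hdcl x' y')
  have hφ' : ∀ v : Fin m → M, φ.Realize (Sum.elim (↑) v) ↔ v = I.coordA (I.h.toFun x' y') := by
    intro v
    rw [← Set.mem_singleton_iff, hφ]
    rfl
  rw [h]
  apply coordA_injective
  rw [coordA_mapA, coordA_mapA]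
  have h1 := all_transfer j (φ := (φ.relabel (Sum.map Sum.inl id : B ⊕ Fin m → _)).imp
      (Formula.iInf fun i : Fin m => Term.equal (Term.var (Sum.inr i))
        (Term.var (Sum.inl (Sum.inr i)))))
    (Sum.elim (fun b : B => (b : M)) (I.coordA (I.h.toFun x' y'))) (by
      intro v
      simp only [Formula.realize_imp, Formula.realize_relabel, Formula.realize_iInf,
        Formula.realize_equal, Sum.elim_comp_map, Function.comp_id]
      intro h i
      exact congrFun ((hφ' v).1 h) i)
    (σ ∘ j ∘ I.coordA (I.h.toFun x' y'))
  simp only [Formula.realize_imp, Formula.realize_relabel, Formula.realize_iInf,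
    Formula.realize_equal, Sum.elim_comp_map, Function.comp_id] at h1
  funext i
  refine h1 ?_ i
  have h2 := (j.map_formula φ _).2 ((hφ' _).2 rfl)
  have h3 := (StrongHomClass.realize_formula σ φ).2 h2
  convert h3 using 1
  funext z
  rcases z with z | z
  · exact (hσ _ ⟨z, z.2, rfl⟩).symm
  · rfl

end Image

end Interp


/-! ### The criterion for the 000-component. -/

/-- With trivial action modulo `C`, the difference of two splittings with values in the image
subgroup is a homomorphism to `ImageQuot`. This is the only use of the assumption on Hom. -/
theorem Cocycle.SplitsOn.sub_mem_of_subsingleton {Γ Q : Type u} [Group Γ] [AddCommGroup Q]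
    [DistribMulAction Γ Q] {h : Cocycle Γ Q} {C : AddSubgroup Q} {K : Subgroup Γ} {F F' : Γ → Q}
    (hsub : Subsingleton (K →* Multiplicative (h.ImageQuot C)))
    (htriv : ∀ g ∈ K, ∀ a : Q, g • a - a ∈ C)
    (hs : h.SplitsOn C K F) (hs' : h.SplitsOn C K F') (hF : ∀ x ∈ K, F x ∈ h.imageSubgroup)
    (hF' : ∀ x ∈ K, F' x ∈ h.imageSubgroup) (x : Γ) (hx : x ∈ K) : F' x - F x ∈ C := by
  let f : K →* Multiplicative (h.ImageQuot C) := MonoidHom.mk' (fun x =>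
    Multiplicative.ofAdd (QuotientAddGroup.mk
      (⟨F' x - F x, sub_mem (hF' x x.2) (hF x x.2)⟩ : h.imageSubgroup) : h.ImageQuot C)) (by
    rintro ⟨x, hx⟩ ⟨y, hy⟩
    rw [← ofAdd_add, ← QuotientAddGroup.mk_add]
    congr 1
    refine QuotientAddGroup.eq_iff_sub_mem.2 (AddSubgroup.mem_addSubgroupOf.2 ?_)
    have h1 := sub_mem (hs.cocycle_mem x hx y hy) (hs'.cocycle_mem x hx y hy)
    have h2 := htriv x hx (F' y - F y)
    have := sub_mem h2 h1
    have := neg_mem this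
    simp only [AddSubgroup.coe_sub, AddSubgroup.coe_add,
      Subgroup.coe_mul]
    rw [smul_sub] at this
    have := neg_mem this
    convert this using 1
    abel)
  have h1 : f = 1 := Subsingleton.elim _ _
  have h2 : f ⟨x, hx⟩ = 1 := by rw [h1]; rfl
  have h3 : (QuotientAddGroup.mk
      (⟨F' x - F x, sub_mem (hF' x hx) (hF x hx)⟩ : h.imageSubgroup) : h.ImageQuot C) = 0 := h2
  exact AddSubgroup.mem_addSubgroupOf.1 ((QuotientAddGroup.eq_zero_iff _).1 h3)

namespace Interp

variable {L : FirstOrder.Language.{u, u}} {β : Type u} {n m : ℕ} {D : ExtFormulas L β n m}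
  {N : Type u} [L.Structure N] {b : β → N} {κ : Cardinal.{u}} {P : Set N} (I : Interp D N b)
  {A₁ : AddSubgroup I.A}

theorem mapA_mem (hA₁ : IsInvariant L P (I.coordA '' (A₁ : Set I.A))) (σ : N ≃[L] N)
    (hσ : ∀ p ∈ P, σ p = p) (a : I.A) (ha : a ∈ A₁) :
    mapA I I σ.toElementaryEmbedding a ∈ A₁ := by
  have : I.coordA (mapA I I σ.toElementaryEmbedding a) ∈ I.coordA '' (A₁ : Set I.A) := by
    rw [← hA₁ σ hσ]
    exact ⟨_, ⟨a, ha, rfl⟩, rfl⟩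
  obtain ⟨a', ha', h⟩ := this
  rwa [← coordA_injective I h]

theorem mapA_symm (σ : N ≃[L] N) (a : I.A) :
    mapA I I σ.toElementaryEmbedding (mapA I I σ.symm.toElementaryEmbedding a) = a :=
  coordA_injective I (funext fun i => σ.apply_symm_apply (I.coordA a i))

theorem mapA_eq_of_mem_imageSubgroup (σ : N ≃[L] N)
    (hfix : ∀ x y, mapA I I σ.toElementaryEmbedding (I.h.toFun x y) = I.h.toFun x y) {a : I.A}
    (ha : a ∈ I.h.imageSubgroup) : mapA I I σ.toElementaryEmbedding a = a := by
  induction ha using AddSubgroup.closure_induction with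
  | mem x hx =>
    obtain ⟨⟨x, y⟩, rfl⟩ := hx
    exact hfix x y
  | zero => exact map_zero _
  | add x y _ _ hx hy => rw [map_add, hx, hy]
  | neg x _ hx => rw [map_neg, hx]

/-- `G^{000}` acts trivially on `A / A₁` if `A₁` has bounded index. -/
theorem smul_sub_mem_of_mem_comp000 (hN : IsMonster L κ N)
    (hA₁ : IsInvariant L P (I.coordA '' (A₁ : Set I.A))) (hbdd : Cardinal.mk (I.A ⧸ A₁) < κ)
    (hinv : ∀ g : I.G, ∀ a ∈ A₁, g • a ∈ A₁) :
    ∀ g ∈ comp000 L κ P I.coordG, ∀ a : I.A, g • a - a ∈ A₁ := by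
  let K : Subgroup I.G :=
    { carrier := {g | ∀ a : I.A, g • a - a ∈ A₁}
      one_mem' := fun a => by simp
      mul_mem' := fun {x y} hx hy a => by
        have := add_mem (hx (y • a)) (hy a)
        rwa [sub_add_sub_cancel, ← mul_smul] at this
      inv_mem' := fun {x} hx a => by
        have := neg_mem (hx (x⁻¹ • a))
        rwa [smul_inv_smul, neg_sub] at this }
  suffices h : comp000 L κ P I.coordG ≤ K from fun g hg => h hg
  refine comp000_le ((isCoord_coordG I P).isInvariant_iff.2 ?_) ?_
  · intro σ hσ x y hxy hx a
    obtain rfl : y = mapG I I σ.toElementaryEmbedding x := coordG_injective I hxy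
    have := mapA_mem I hA₁ σ hσ _ (hx (mapA I I σ.symm.toElementaryEmbedding a))
    rwa [map_sub, mapA_smul, mapA_symm] at this
  -- `K` is the kernel of the action on `A / A₁`, so its index is at most the number of self-maps of
  -- this bounded quotient, again bounded since `κ` is a strong limit.
  · refine (mk_quotient_le_of_map K (fun g => fun q : I.A ⧸ A₁ =>
      (QuotientAddGroup.mk (g • q.out) : I.A ⧸ A₁)) fun x y hxy a => ?_).trans_lt
      (mk_fun_lt hN.strongLimit hbdd hbdd hN.aleph0_lt)
    have h1 := QuotientAddGroup.eq_iff_sub_mem.1 (congrFun hxy.symm (QuotientAddGroup.mk a))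
    have h2 : a - (QuotientAddGroup.mk a : I.A ⧸ A₁).out ∈ A₁ :=
      QuotientAddGroup.eq_iff_sub_mem.1 (QuotientAddGroup.out_eq' _).symm
    have h3 := hinv x⁻¹ _ h1
    have h4 := sub_mem (add_mem h3 (hinv (x⁻¹ * y) _ h2)) h2
    convert h4 using 1
    simp only [smul_sub, ← mul_smul, inv_mul_cancel, one_smul]
    abel

theorem mk_quotient_splitting_lt (hN : IsMonster L κ N) (hP : Cardinal.mk P < κ)
    (hA₁ : IsInvariant L P (I.coordA '' (A₁ : Set I.A))) (hbdd : Cardinal.mk (I.A ⧸ A₁) < κ)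
    (hinv : ∀ g : I.G, ∀ a ∈ A₁, g • a ∈ A₁) {F : I.G → I.A}
    (hs : I.h.SplitsOn A₁ (comp000 L κ P I.coordG) F) :
    Cardinal.mk (I.Ext ⧸ hs.subgroup hinv) < κ :=
  (hs.mk_quotient_le (smul_sub_mem_of_mem_comp000 I hN hA₁ hbdd hinv)).trans_lt
    (Cardinal.mul_lt_of_lt hN.aleph0_lt.le (mk_quotient_comp000_lt hN hP (isCoord_coordG I P)) hbdd)

/-- If `h` splits on `G^{000}` modulo `A₁`, then the component of the extension meets `A` within
`A₁`. -/
theorem interA_comp000_subset (hN : IsMonster L κ N) (hP : Cardinal.mk P < κ)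
    (hb : ∀ x, b x ∈ P)
    (hfix : ∀ σ : N ≃[L] N, (∀ p ∈ P, σ p = p) → ∀ x y,
      mapA I I σ.toElementaryEmbedding (I.h.toFun x y) = I.h.toFun x y)
    (hA₁ : IsInvariant L P (I.coordA '' (A₁ : Set I.A))) (hbdd : Cardinal.mk (I.A ⧸ A₁) < κ)
    (hinv : ∀ g : I.G, ∀ a ∈ A₁, g • a ∈ A₁)
    (hsub : Subsingleton (comp000 L κ P I.coordG →* Multiplicative (I.h.ImageQuot A₁)))
    (hsplit : I.h.IsSplitOnMod A₁ hinv (comp000 L κ P I.coordG)) :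
    I.interA (comp000 L κ P I.coordExt) ⊆ A₁ := by
  obtain ⟨F, hF, hs⟩ := Cocycle.isSplitOnMod_iff.1 hsplit
  have htriv := smul_sub_mem_of_mem_comp000 I hN hA₁ hbdd hinv
  have hle : comp000 L κ P I.coordExt ≤ hs.subgroup hinv := by
    refine comp000_le ((isCoord_coordExt I P hb).isInvariant_iff.2 ?_)
      (mk_quotient_splitting_lt I hN hP hA₁ hbdd hinv hs)
    rintro σ hσ p q hpq ⟨hp1, hp2⟩
    obtain rfl : q = mapExt I I σ.toElementaryEmbedding (fun x => (hσ _ (hb x)).symm) p :=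
      coordExt_injective I (hpq.trans (coordExt_mapExt I I σ.toElementaryEmbedding _ p).symm)
    have hK : ∀ x ∈ comp000 L κ P I.coordG,
        mapG I I σ.toElementaryEmbedding x ∈ comp000 L κ P I.coordG := fun x hx =>
      (isCoord_coordG I P).comp000_mem σ hσ _ _ rfl hx
    refine ⟨hK _ hp1, ?_⟩
    -- `F ∘ σ` splits the same cocycle because `σ` fixes the values of h. It does so for the
    -- untwisted action, because `x` and `σ x` both act trivially modulo `A₁`.
    have hs' : I.h.SplitsOn A₁ (comp000 L κ P I.coordG)
        (fun x => F (mapG I I σ.toElementaryEmbedding x)) := by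
      refine ⟨by simpa using hs.one, fun x hx y hy => ?_⟩
      have h1 := hs.cocycle_mem _ (hK x hx) _ (hK y hy)
      rw [← mapA_h I I σ.toElementaryEmbedding (fun x => (hσ _ (hb x)).symm), hfix σ hσ,
        ← map_mul] at h1
      have h2 := htriv _ (hK x hx) (F (mapG I I σ.toElementaryEmbedding y))
      have h3 := htriv _ hx (F (mapG I I σ.toElementaryEmbedding y))
      have := sub_mem (add_mem h1 h2) h3
      convert this using 1
      abel
    have h1 := hs.sub_mem_of_subsingleton hsub htriv hs' hF (fun x hx => hF _ (hK x hx)) _ hp1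
    have h2 := mapA_mem I hA₁ σ hσ _ hp2
    -- `σ` fixes `F p.snd`; thus `σ (a + F g) = σ a + F g`, which differs from `σ a + F (σ g)` by an
    -- element of `A₁`.
    have h3 := mapA_eq_of_mem_imageSubgroup I σ (hfix σ hσ) (hF _ hp1)
    rw [map_add, h3] at h2
    have := add_mem h1 h2
    convert this using 1
    change _ + F (mapG I I σ.toElementaryEmbedding p.snd) = _
    change mapA I I σ.toElementaryEmbedding p.fst + _ = _
    abel
  intro a ha
  have h1 := (hle ha).2
  have := sub_mem h1 hs.one
  rwa [add_sub_cancel_right] at this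

/-- If the component of the extension meets `A` within `A₁`, then `h` splits on `G^{000}`
modulo `A₁`. -/
theorem isSplitOnMod_comp000 (hN : IsMonster L κ N) (hP : Cardinal.mk P < κ)
    (hb : ∀ x, b x ∈ P)
    (hfix : ∀ σ : N ≃[L] N, (∀ p ∈ P, σ p = p) → ∀ x y,
      mapA I I σ.toElementaryEmbedding (I.h.toFun x y) = I.h.toFun x y)
    (hA₁ : IsInvariant L P (I.coordA '' (A₁ : Set I.A))) (hbdd : Cardinal.mk (I.A ⧸ A₁) < κ)
    (hinv : ∀ g : I.G, ∀ a ∈ A₁, g • a ∈ A₁)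
    (hint : I.interA (comp000 L κ P I.coordExt) ⊆ A₁) :
    I.h.IsSplitOnMod A₁ hinv (comp000 L κ P I.coordG) := by
  refine Cocycle.isSplitOnMod_of_subgroup (comp000 L κ P I.coordExt) ?_ ?_ fun a ha => hint ha
  -- Lying over A₀ + A₁ is what lets the splitting extracted below take values in A₀.
  · refine comp000_le ((isCoord_coordExt I P hb).isInvariant_iff.2 ?_)
      (Cocycle.mk_quotient_supSubgroup_le.trans_lt hbdd)
    rintro σ hσ p q hpq hp
    obtain rfl : q = mapExt I I σ.toElementaryEmbedding (fun x => (hσ _ (hb x)).symm) p :=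
      coordExt_injective I (hpq.trans (coordExt_mapExt I I σ.toElementaryEmbedding _ p).symm)
    obtain ⟨x, hx, y, hy, hxy⟩ := AddSubgroup.mem_sup.1 (Cocycle.mem_supSubgroup.1 hp)
    refine Cocycle.mem_supSubgroup.2 ?_
    change mapA I I σ.toElementaryEmbedding p.fst ∈ _
    rw [← hxy, map_add, mapA_eq_of_mem_imageSubgroup I σ (hfix σ hσ) hx]
    exact AddSubgroup.mem_sup.2 ⟨_, hx, _, mapA_mem I hA₁ σ hσ _ hy, rfl⟩
  · have hc := isCoord_coordExt I P hb
    refine comp000_le ((isCoord_coordG I P).isInvariant_iff.2 ?_) ?_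
    · rintro σ hσ x y hxy ⟨p, hp, rfl⟩
      refine ⟨mapExt I I σ.toElementaryEmbedding (fun x => (hσ _ (hb x)).symm) p,
        hc.comp000_mem σ hσ _ _ (coordExt_mapExt I I _ _ p) hp, ?_⟩
      exact (coordG_injective I hxy).symm
    -- The set-theoretic section `g ↦ (0, g)` bounds the index of the projected component by the
    -- index of the component of the extension.
    · refine (mk_quotient_le_of_map _
        (fun g => ((⟨0, g⟩ : I.Ext) : I.Ext ⧸ comp000 L κ P I.coordExt)) fun x y hxy => ?_).trans_lt
        (mk_quotient_comp000_lt hN hP hc)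
      exact ⟨_, QuotientGroup.eq.1 hxy, rfl⟩

end Interp


/-! ### Elementary chains whose steps realize all types. -/

section Monster

variable {L : FirstOrder.Language.{u, u}}

/-- `T` realizes, via `e`, all the types over `S` in variables indexed by `S`. -/
def RealizesTypes {S : Type*} {T : Type*} [L.Structure S] (e : S → T) [L.Structure T] : Prop :=
  ∀ p : Set (L.Formula (S ⊕ S)),
    (∀ q : Finset (L.Formula (S ⊕ S)), (q : Set _) ⊆ p →
      ∃ v : S → S, ∀ φ ∈ q, φ.Realize (Sum.elim id v)) →
    ∃ v : S → T, ∀ φ ∈ p, φ.Realize (Sum.elim e v)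

/-- An ultrapower over the finite sets of formulas: the coordinate at `q` solves `q ∩ p`, and the
ultrafilter contains, for every φ, the set of those `q` that contain φ. -/
theorem exists_realizesTypes (S : Type u) [L.Structure S] [Nonempty S] :
    ∃ (T : Type u) (_ : L.Structure T) (e : S ↪ₑ[L] T), RealizesTypes (L := L) e := by
  classical
  let X := Finset (L.Formula (S ⊕ S))
  let U : Ultrafilter X := Ultrafilter.of Filter.atTop
  let e : S → (U : Filter X).Product (fun _ => S) := fun s => ((fun _ => s : X → S) : _)
  have he : ∀ {α : Type u} (φ : L.Formula α) (x : α → X → S),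
      (φ.Realize fun i => (x i : (U : Filter X).Product (fun _ => S))) ↔
      ∀ᶠ a : X in U, φ.Realize fun i => x i a := fun φ x => Ultraproduct.realize_formula_cast φ x
  refine ⟨(U : Filter X).Product (fun _ => S), inferInstance, ⟨e, ?_⟩, ?_⟩
  · intro n φ x
    refine (Ultraproduct.realize_formula_cast φ (fun i _ => x i)).trans ?_
    exact Filter.eventually_const
  · intro p hp
    choose w hw using fun q : X => hp (q.filter (· ∈ p)) (by
      intro φ hφ
      exact (Finset.mem_filter.1 hφ).2)
    refine ⟨fun s => ((fun q => w q s : X → S) : _), fun φ hφ => ?_⟩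
    have h1 := (he φ (Sum.elim (fun s _ => s) (fun s q => w q s))).2 (by
      refine Filter.Eventually.filter_mono (Ultrafilter.of_le _) ?_
      filter_upwards [Filter.eventually_ge_atTop ({φ} : X)] with q hq
      have := hw q φ (Finset.mem_filter.2 ⟨hq (Finset.mem_singleton_self φ), hφ⟩)
      convert this using 1
      funext x; rcases x with x | x <;> rfl)
    have h2 : (Sum.elim e (fun s => ((fun q => w q s : X → S) :
        (U : Filter X).Product (fun _ => S)))) = fun i =>
        ((Sum.elim (fun s _ => s) (fun s q => w q s) i : X → S) :
          (U : Filter X).Product (fun _ => S)) := by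
      funext x; rcases x with x | x <;> rfl
    rw [← h2] at h1
    exact h1

/-- An `L`-structure on a small set of ordinals. -/
structure Stage (L : FirstOrder.Language.{u, u}) where
  carrier : Set Ordinal.{u}
  small : Small.{u} carrier
  nonempty : Nonempty carrier
  str : L.Structure carrier

attribute [instance] Stage.small Stage.nonempty Stage.str

namespace Stage

/-- Elementary extension of stages. -/
instance : Preorder (Stage L) where
  le S T := ∃ e : S.carrier ↪ₑ[L] T.carrier, ∀ x, (e x : Ordinal) = x
  le_refl S := ⟨ElementaryEmbedding.refl L S.carrier, fun _ => rfl⟩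
  le_trans S T U := by
    rintro ⟨e, he⟩ ⟨f, hf⟩
    exact ⟨f.comp e, fun x => by rw [ElementaryEmbedding.comp_apply, hf, he]⟩

theorem subset_of_le {S T : Stage L} (h : S ≤ T) : S.carrier ⊆ T.carrier := by
  obtain ⟨e, he⟩ := h
  intro x hx
  have := (e ⟨x, hx⟩).2
  rwa [he] at this

theorem exists_emb_eq_inclusion {S T : Stage L} (h : S ≤ T) :
    ∃ e : S.carrier ↪ₑ[L] T.carrier, ∀ x, e x = Set.inclusion (subset_of_le h) x := by
  obtain ⟨e, he⟩ := h
  exact ⟨e, fun x => Subtype.ext (he x)⟩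

/-- The inclusion of stages. -/
noncomputable def incl {S T : Stage L} (h : S ≤ T) : S.carrier ↪ₑ[L] T.carrier :=
  (exists_emb_eq_inclusion h).choose

theorem incl_apply {S T : Stage L} (h : S ≤ T) (x : S.carrier) :
    incl h x = ⟨x, subset_of_le h x.2⟩ := (exists_emb_eq_inclusion h).choose_spec x

theorem incl_comp {S T U : Stage L} (h : S ≤ T) (h' : T ≤ U) (x : S.carrier) :
    incl h' (incl h x) = incl (h.trans h') x := by
  simp only [incl_apply]

/-- Old points keep their ordinals and new ones are placed above an upper bound `o` of the old.
Extensions thus become literal inclusions, and limits of chains become unions. -/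
theorem exists_ext (S : Stage L) (T : Type u) [L.Structure T] (e : S.carrier ↪ₑ[L] T) :
    ∃ (S' : Stage L) (f : T ≃[L] S'.carrier), ∀ x, (f (e x) : Ordinal) = x := by
  classical
  obtain ⟨o, ho⟩ := Ordinal.bddAbove_of_small (s := S.carrier)
  let r : T → T → Prop := WellOrderingRel
  let g : T → Ordinal.{u} := fun t =>
    if h : ∃ s, e s = t then (h.choose : Ordinal) else o + 1 + Ordinal.typein r t
  have hg1 : ∀ s, g (e s) = s := by
    intro s
    have h : ∃ s', e s' = e s := ⟨s, rfl⟩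
    simp only [g, dif_pos h]
    exact congrArg _ (e.injective h.choose_spec)
  have hg2 : ∀ t, (∀ s, e s ≠ t) → g t = o + 1 + Ordinal.typein r t := by
    intro t ht
    have h : ¬ ∃ s, e s = t := by push Not; exact ht
    simp only [g, dif_neg h]
  have hlt : ∀ (s : S.carrier) (a : Ordinal), (s : Ordinal) ≠ o + 1 + a := by
    intro s a h
    have h1 := ho s.2
    have h2 : o + 1 ≤ s := by rw [h]; exact le_self_add
    exact absurd (h2.trans h1) (by simp)
  have hg : Function.Injective g := by
    intro t t' htt
    by_cases h : ∃ s, e s = t <;> by_cases h' : ∃ s, e s = t'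
    · obtain ⟨s, rfl⟩ := h
      obtain ⟨s', rfl⟩ := h'
      rw [hg1, hg1] at htt
      rw [Subtype.ext htt]
    · obtain ⟨s, rfl⟩ := h
      push Not at h'
      rw [hg1, hg2 _ h'] at htt
      exact absurd htt (hlt _ _)
    · obtain ⟨s, rfl⟩ := h'
      push Not at h
      rw [hg1, hg2 _ h] at htt
      exact absurd htt.symm (hlt _ _)
    · push Not at h h'
      rw [hg2 _ h, hg2 _ h'] at htt
      exact Ordinal.typein_injective r (add_left_cancel htt)
  let f : T ≃ Set.range g := Equiv.ofInjective g hg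
  refine ⟨⟨Set.range g, inferInstance, ⟨f (e S.nonempty.some)⟩, f.inducedStructure⟩,
    f.inducedStructureEquiv, fun x => hg1 x⟩

/-- The carrier is a set of ordinals, one universe too high for the ultrapower, so the construction
runs on its `Shrink` copy and is pasted back. -/
theorem exists_le_realizesTypes (S : Stage L) :
    ∃ (S' : Stage L) (h : S ≤ S'), RealizesTypes (L := L) (incl h) := by
  let s : S.carrier ≃ Shrink.{u} S.carrier := equivShrink _
  let _ : L.Structure (Shrink.{u} S.carrier) := s.inducedStructure
  let s' : S.carrier ≃[L] Shrink.{u} S.carrier := s.inducedStructureEquiv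
  have : Nonempty (Shrink.{u} S.carrier) := ⟨s S.nonempty.some⟩
  obtain ⟨T, _, e, he⟩ := exists_realizesTypes (L := L) (Shrink.{u} S.carrier)
  obtain ⟨S', f, hf⟩ := S.exists_ext T (e.comp s'.toElementaryEmbedding)
  have hle : S ≤ S' := ⟨f.toElementaryEmbedding.comp (e.comp s'.toElementaryEmbedding), hf⟩
  have hincl : ∀ x, incl hle x = f (e (s' x)) := fun x => by
    rw [incl_apply]
    exact Subtype.ext (hf x).symm
  refine ⟨S', hle, fun p hp => ?_⟩
  have hs : ∀ (φ : L.Formula (S.carrier ⊕ S.carrier)) (v : S.carrier → S.carrier),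
      (φ.relabel (Sum.map s' s')).Realize (Sum.elim id (s' ∘ v ∘ s'.symm)) ↔
        φ.Realize (Sum.elim id v) := by
    intro φ v
    rw [Formula.realize_relabel, ← StrongHomClass.realize_formula s' φ]
    apply iff_of_eq; congr 1
    funext x; rcases x with x | x
    · rfl
    · simp
  obtain ⟨v, hv⟩ := he ((fun φ => φ.relabel (Sum.map s' s')) '' p) (by
    classical
    intro q hq
    obtain ⟨r, hr, rfl⟩ := Finset.subset_set_image_iff.1 hq
    obtain ⟨v, hv⟩ := hp r hr
    refine ⟨s' ∘ v ∘ s'.symm, fun φ hφ => ?_⟩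
    obtain ⟨χ, hχ, rfl⟩ := Finset.mem_image.1 hφ
    exact (hs _ _).2 (hv χ hχ))
  refine ⟨f ∘ v ∘ s', fun φ hφ => ?_⟩
  have := hv _ ⟨φ, hφ, rfl⟩
  rw [Formula.realize_relabel, ← StrongHomClass.realize_formula f] at this
  convert this using 1
  funext x; rcases x with x | x
  · exact hincl x
  · rfl

section Union

variable {ι : Type u} [LinearOrder ι] [Nonempty ι] {c : ι → Stage L} (hc : Monotone c)

theorem exists_forall_mem {n : ℕ} (v : Fin n → (⋃ i, (c i).carrier : Set Ordinal.{u})) (hc : Monotone c) :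
    ∃ i, ∀ k, (v k : Ordinal) ∈ (c i).carrier := by
  choose i hi using fun k => Set.mem_iUnion.1 (v k).2
  obtain ⟨l, hl⟩ := Finset.exists_le (Finset.univ.image i)
  exact ⟨l, fun k => subset_of_le (hc (hl _ (Finset.mem_image_of_mem _ (Finset.mem_univ k)))) (hi k)⟩

/-- The structure on the union of a chain of stages. -/
@[reducible]
noncomputable def unionStructure : L.Structure (⋃ i, (c i).carrier : Set Ordinal.{u}) where
  funMap f v := ⟨Structure.funMap (M := (c (exists_forall_mem v hc).choose).carrier) f
    (fun k => ⟨v k, (exists_forall_mem v hc).choose_spec k⟩), Set.mem_iUnion.2 ⟨_, Subtype.property _⟩⟩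
  RelMap R v := Structure.RelMap (M := (c (exists_forall_mem v hc).choose).carrier) R
    (fun k => ⟨v k, (exists_forall_mem v hc).choose_spec k⟩)

/-- The embedding of a stage into the union. -/
noncomputable def toUnion (i : ι) :
    letI := unionStructure hc
    (c i).carrier ↪[L] (⋃ i, (c i).carrier : Set Ordinal.{u}) :=
  letI := unionStructure hc
  { toFun := Set.inclusion (Set.subset_iUnion (fun i => (c i).carrier) i)
    inj' := Set.inclusion_injective _
    map_fun' := by
      intro n f x
      apply Subtype.ext
      let v : Fin n → (⋃ i, (c i).carrier : Set Ordinal.{u}) :=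
        Set.inclusion (Set.subset_iUnion (fun i => (c i).carrier) i) ∘ x
      let k := (exists_forall_mem v hc).choose
      let y : Fin n → (c k).carrier := fun l => ⟨v l, (exists_forall_mem v hc).choose_spec l⟩
      change ((Structure.funMap f x : (c i).carrier) : Ordinal) =
        ((Structure.funMap f y : (c k).carrier) : Ordinal)
      have h1 : incl (hc (le_max_left i k)) ∘ x = incl (hc (le_max_right i k)) ∘ y := by
        funext l
        simp only [Function.comp_apply, incl_apply]
        rfl
      have h2 := ElementaryEmbedding.map_fun (incl (hc (le_max_left i k))) f x
      rw [h1, ← ElementaryEmbedding.map_fun, incl_apply, incl_apply] at h2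
      exact congrArg Subtype.val h2
    map_rel' := by
      intro n R x
      let v : Fin n → (⋃ i, (c i).carrier : Set Ordinal.{u}) :=
        Set.inclusion (Set.subset_iUnion (fun i => (c i).carrier) i) ∘ x
      let k := (exists_forall_mem v hc).choose
      let y : Fin n → (c k).carrier := fun l => ⟨v l, (exists_forall_mem v hc).choose_spec l⟩
      change Structure.RelMap R y ↔ Structure.RelMap R x
      have h1 : incl (hc (le_max_left i k)) ∘ x = incl (hc (le_max_right i k)) ∘ y := by
        funext l
        simp only [Function.comp_apply, incl_apply]
        rfl
      rw [← ElementaryEmbedding.map_rel (incl (hc (le_max_left i k))) R x, h1,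
        ElementaryEmbedding.map_rel] }

theorem toUnion_incl {i k : ι} (hik : i ≤ k) (x : (c i).carrier) :
    letI := unionStructure hc
    toUnion hc k (incl (hc hik) x) = toUnion hc i x := by
  rw [incl_apply]
  rfl

/-- Tarski's theorem on elementary chains. In the quantifier case a new element of the union lies in
some stage, and the formula is moved to the larger of the two stages. -/
theorem realize_toUnion {α : Type*} {n : ℕ} (φ : L.BoundedFormula α n) : ∀ (i : ι)
    (v : α → (c i).carrier) (xs : Fin n → (c i).carrier),
    letI := unionStructure hc
    φ.Realize (toUnion hc i ∘ v) (toUnion hc i ∘ xs) ↔ φ.Realize v xs := by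
  let _ := unionStructure hc
  induction φ with
  | falsum => intros; rfl
  | equal t₁ t₂ =>
    intro i v xs
    simp only [BoundedFormula.Realize, ← Sum.comp_elim, HomClass.realize_term]
    exact (toUnion hc i).injective.eq_iff
  | rel R ts =>
    intro i v xs
    simp only [BoundedFormula.Realize, ← Sum.comp_elim, HomClass.realize_term]
    exact (toUnion hc i).map_rel R _
  | imp _ _ ih1 ih2 =>
    intro i v xs
    rw [BoundedFormula.realize_imp, BoundedFormula.realize_imp, ih1, ih2]
  | all φ ih =>
    intro i v xs
    rw [BoundedFormula.realize_all, BoundedFormula.realize_all]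
    constructor
    · intro h x
      rw [← ih, Fin.comp_snoc]
      exact h _
    · rintro h ⟨x, hx⟩
      obtain ⟨k, hk⟩ := Set.mem_iUnion.1 hx
      have h1 := ((incl (hc (le_max_left i k))).map_boundedFormula φ.all v xs).2
        (BoundedFormula.realize_all.2 h)
      have h2 := BoundedFormula.realize_all.1 h1 (incl (hc (le_max_right i k)) ⟨x, hk⟩)
      rw [← ih, Fin.comp_snoc] at h2
      have h3 : ∀ y, toUnion hc (max i k) (incl (hc (le_max_left i k)) y) = toUnion hc i y :=
        fun y => toUnion_incl hc (le_max_left i k) y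
      convert h2 using 1
      · funext a; exact (h3 _).symm
      · congr 1
        · funext a; exact (h3 _).symm
        · exact (toUnion_incl hc (le_max_right i k) ⟨x, hk⟩).symm

include hc in
theorem exists_union : ∃ U : Stage L, U.carrier = ⋃ i, (c i).carrier ∧ ∀ i, c i ≤ U := by
  let i₀ := Classical.arbitrary ι
  refine ⟨⟨⋃ i, (c i).carrier, inferInstance,
    ⟨⟨_, Set.mem_iUnion.2 ⟨i₀, (c i₀).nonempty.some.2⟩⟩⟩, unionStructure hc⟩, rfl, fun i => ?_⟩
  let _ := unionStructure hc
  refine ⟨⟨toUnion hc i, fun n φ x => ?_⟩, fun x => rfl⟩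
  have := realize_toUnion hc φ i x default
  rw [Formula.Realize, Formula.Realize, ← this, Unique.eq_default (toUnion hc i ∘ default)]

end Union

/-- Transfinite recursion: `F i` bounds `S` and every `st (F k)` with `k < i`, where `st` realizes
all types over its argument. A type over `F i` is then realized in `st (F i)`, hence in every later
stage. -/
theorem exists_chain (S : Stage L) (J : Type u) [LinearOrder J] [WellFoundedLT J] :
    ∃ F : J → Stage L, (∀ i, S ≤ F i) ∧ Monotone F ∧
      ∀ i j, i < j → ∃ h : F i ≤ F j, RealizesTypes (L := L) (incl h) := by
  classical
  choose st hst hreal using fun S : Stage L => S.exists_le_realizesTypes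
  have hub : ∀ (ι : Type u) [LinearOrder ι] [Nonempty ι] (c : ι → Stage L), Monotone c →
      ∃ U, ∀ i, c i ≤ U := fun ι _ _ c hc => by
    obtain ⟨U, -, hU⟩ := exists_union hc
    exact ⟨U, hU⟩
  let ub : ∀ i : J, (WithBot (Set.Iio i) → Stage L) → Stage L := fun i c =>
    if h : Monotone c then (hub _ c h).choose else S
  let ext : ∀ i : J, ((k : J) → k < i → Stage L) → WithBot (Set.Iio i) → Stage L := fun i f k =>
    WithBot.recBotCoe S (fun k : Set.Iio i => st (f k.1 k.2)) k
  let F : J → Stage L := WellFoundedLT.fix fun i f => ub i (ext i f)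
  have hF : ∀ i, F i = ub i (ext i fun k _ => F k) := fun i => WellFoundedLT.fix_eq _ i
  have key : ∀ i, S ≤ F i ∧ ∀ k < i, st (F k) ≤ F i := by
    intro i
    induction i using WellFoundedLT.induction with
    | ind i ih =>
    have hmono : Monotone (ext i fun k _ => F k) := by
      intro a b hab
      induction a using WithBot.recBotCoe with
      | bot =>
        induction b using WithBot.recBotCoe with
        | bot => exact le_refl _
        | coe b => exact (ih b.1 b.2).1.trans (hst _)
      | coe a =>
        induction b using WithBot.recBotCoe with
        | bot => simp at hab
        | coe b =>
          rcases (WithBot.coe_le_coe.1 hab).eq_or_lt with rfl | hlt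
          · exact le_refl _
          · exact ((ih b.1 b.2).2 a.1 hlt).trans (hst _)
    have h := (hub _ _ hmono).choose_spec
    have hFi : F i = (hub _ _ hmono).choose := by
      rw [hF]
      exact dif_pos hmono
    rw [← hFi] at h
    exact ⟨h ⊥, fun k hk => h ((⟨k, hk⟩ : Set.Iio i) : WithBot (Set.Iio i))⟩
  refine ⟨F, fun i => (key i).1, fun i j hij => ?_, fun i j hij => ?_⟩
  · rcases hij.eq_or_lt with rfl | hlt
    · exact le_refl _
    · exact (hst _).trans ((key j).2 i hlt)
  · have h := (key j).2 i hij
    refine ⟨(hst _).trans h, fun p hp => ?_⟩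
    obtain ⟨v, hv⟩ := hreal (F i) p hp
    refine ⟨incl h ∘ v, fun φ hφ => ?_⟩
    have := ((incl h).map_formula φ _).2 (hv φ hφ)
    convert this using 1
    funext x; rcases x with x | x
    · exact (incl_comp _ _ x).symm
    · rfl

end Stage

theorem exists_elementarySubstructure_range {A N : Type*} [L.Structure A] [L.Structure N]
    (g : A ↪ₑ[L] N) : ∃ X : L.ElementarySubstructure N, (X : Set N) = Set.range g := by
  refine ⟨⟨g.toEmbedding.toHom.range, fun n φ x => ?_⟩, rfl⟩
  let t := g.toEmbedding.equivRange
  have h1 : Subtype.val ∘ x = g ∘ (t.symm ∘ x) := by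
    funext k
    have : t (t.symm (x k)) = x k := t.apply_symm_apply _
    exact (congrArg Subtype.val this).symm
  have h2 : x = t ∘ (t.symm ∘ x) := by
    funext k
    exact (t.apply_symm_apply _).symm
  rw [h1, g.map_formula]
  conv_rhs => rw [h2]
  exact (StrongHomClass.realize_formula t φ).symm

/-- An elementary chain whose steps realize all types. -/
theorem exists_elementary_chain (K : Type u) [L.Structure K] [Nonempty K] (J : Type u)
    [LinearOrder J] [WellFoundedLT J] [Nonempty J] :
    ∃ (N : Type u) (_ : L.Structure N) (X : J → L.ElementarySubstructure N),
      Monotone X ∧ (∀ x, ∃ i, x ∈ X i) ∧ Nonempty (K ↪ₑ[L] N) ∧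
      ∀ i j, i < j → ∀ p : Set (L.Formula (X i ⊕ X i)),
        (∀ q : Finset (L.Formula (X i ⊕ X i)), (q : Set _) ⊆ p →
          ∃ v : X i → X i, ∀ φ ∈ q, φ.Realize (Sum.elim (↑) (fun x => (v x : N)))) →
        ∃ v : X i → X j, ∀ φ ∈ p, φ.Realize (Sum.elim (↑) (fun x => (v x : N))) := by
  classical
  let r : K → K → Prop := WellOrderingRel
  let f : K ≃ Set.range (Ordinal.typein r) := Equiv.ofInjective _ (Ordinal.typein_injective r)
  obtain ⟨S, ⟨f'⟩⟩ : ∃ S : Stage L, Nonempty (K ≃[L] S.carrier) :=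
    ⟨⟨Set.range (Ordinal.typein r), inferInstance, ⟨f (Classical.arbitrary K)⟩,
      f.inducedStructure⟩, ⟨f.inducedStructureEquiv⟩⟩
  obtain ⟨F, hSF, hF, hreal⟩ := S.exists_chain J
  obtain ⟨U, hUc, hU⟩ := Stage.exists_union hF
  let s : U.carrier ≃ Shrink.{u} U.carrier := equivShrink _
  let _ : L.Structure (Shrink.{u} U.carrier) := s.inducedStructure
  let s' : U.carrier ≃[L] Shrink.{u} U.carrier := s.inducedStructureEquiv
  let em : ∀ i, (F i).carrier ↪ₑ[L] Shrink.{u} U.carrier := fun i =>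
    s'.toElementaryEmbedding.comp (Stage.incl (hU i))
  have hem : ∀ i j (h : F i ≤ F j) x, em j (Stage.incl h x) = em i x := fun i j h x =>
    congrArg s' (Stage.incl_comp h (hU j) x)
  choose X hX using fun i => exists_elementarySubstructure_range (em i)
  let t : ∀ i, (F i).carrier ≃ X i := fun i =>
    (Equiv.ofInjective (em i) (em i).injective).trans (Equiv.setCongr (hX i).symm)
  have ht : ∀ i x, ((t i x : X i) : Shrink.{u} U.carrier) = em i x := fun i x => rfl
  refine ⟨Shrink.{u} U.carrier, inferInstance, X, ?_, ?_, ?_, ?_⟩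
  · intro i j hij x hx
    change x ∈ (X j : Set _)
    have hx : x ∈ (X i : Set _) := hx
    rw [hX] at hx ⊢
    obtain ⟨y, rfl⟩ := hx
    exact ⟨_, hem i j (hF hij) y⟩
  · intro x
    have : (s.symm x : Ordinal) ∈ ⋃ i, (F i).carrier := by rw [← hUc]; exact (s.symm x).2
    obtain ⟨i, hi⟩ := Set.mem_iUnion.1 this
    refine ⟨i, ?_⟩
    change x ∈ (X i : Set _)
    rw [hX]
    refine ⟨⟨_, hi⟩, ?_⟩
    change s (Stage.incl (hU i) _) = x
    rw [Stage.incl_apply]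
    exact s.apply_symm_apply x
  · let i₀ := Classical.arbitrary J
    exact ⟨(em i₀).comp ((Stage.incl (hSF i₀)).comp f'.toElementaryEmbedding)⟩
  · intro i j hij p hp
    obtain ⟨h, hr⟩ := hreal i j hij
    let g : X i ⊕ X i → (F i).carrier ⊕ (F i).carrier := Sum.map (t i).symm (t i).symm
    obtain ⟨v, hv⟩ := hr ((fun φ => φ.relabel g) '' p) (by
      intro q hq
      obtain ⟨q, hq', rfl⟩ := Finset.subset_set_image_iff.1 hq
      obtain ⟨v, hv⟩ := hp q hq'
      refine ⟨(t i).symm ∘ v ∘ t i, fun φ hφ => ?_⟩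
      obtain ⟨χ, hχ, rfl⟩ := Finset.mem_image.1 hφ
      rw [Formula.realize_relabel, ← (em i).map_formula]
      convert hv χ hχ using 1
      funext x; rcases x with x | x
      · simp only [g, Function.comp_apply, Sum.map_inl, Sum.elim_inl, id_eq, ← ht]
        simp
      · simp only [g, Function.comp_apply, Sum.map_inr, Sum.elim_inr, ← ht]
        simp)
    refine ⟨t j ∘ v ∘ (t i).symm, fun φ hφ => ?_⟩
    have := hv _ ⟨φ, hφ, rfl⟩
    rw [Formula.realize_relabel, ← (em j).map_formula] at this
    convert this using 1
    funext x; rcases x with x | x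
    · simp only [g, Function.comp_apply, Sum.map_inl, Sum.elim_inl, hem, ← ht]
      simp
    · rfl

end Monster


/-! ### Saturation and homogeneity of the union of a chain; existence of monster models. -/

section Homogeneous

variable {L : FirstOrder.Language.{u, u}} {N : Type u} [L.Structure N]

/-- A relation which is a partial elementary map. -/
def ElemRel (L : FirstOrder.Language.{u, u}) {N : Type u} [L.Structure N] (R : Set (N × N)) : Prop :=
  ∀ φ : L.Formula R, φ.Realize (fun r : R => r.1.1) ↔ φ.Realize (fun r : R => r.1.2)

theorem ElemRel.swap {R : Set (N × N)} (hR : ElemRel L R) : ElemRel L (Prod.swap ⁻¹' R) := by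
  intro φ
  have := hR (φ.relabel (fun r : (Prod.swap ⁻¹' R : Set (N × N)) => (⟨r.1.swap, r.2⟩ : R)))
  rw [Formula.realize_relabel, Formula.realize_relabel] at this
  exact this.symm

theorem elemRel_of_forall_finset {R : Set (N × N)}
    (h : ∀ s : Finset R, ∃ R' : Set (N × N), ElemRel L R' ∧ ∀ r ∈ s, r.1 ∈ R') : ElemRel L R := by
  intro φ
  obtain ⟨s, ψ, hψ⟩ := exists_formula_finset φ
  obtain ⟨R', hR', hs⟩ := h s
  have := hR' (ψ.relabel (fun r : s => (⟨r.1.1, hs r.1 r.2⟩ : R')))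
  rw [Formula.realize_relabel, Formula.realize_relabel] at this
  rw [← hψ, ← hψ]
  exact this

theorem ElemRel.sUnion {c : Set (Set (N × N))} (hc : IsChain (· ⊆ ·) c) (hne : c.Nonempty)
    (h : ∀ R ∈ c, ElemRel L R) : ElemRel L (⋃₀ c) := by
  refine elemRel_of_forall_finset fun s => ?_
  have hfin : (Subtype.val '' (s : Set (⋃₀ c : Set (N × N)))).Finite := s.finite_toSet.image _
  obtain ⟨R, hR, hs⟩ := hc.directedOn.exists_mem_subset_of_finite_of_subset_sUnion hne hfin (by
    rintro _ ⟨y, _, rfl⟩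
    exact y.2)
  exact ⟨R, h R hR, fun r hr => hs ⟨r, hr, rfl⟩⟩

theorem ElemRel.eq_of_eq {R : Set (N × N)} (hR : ElemRel L R) {r r' : N × N} (h : r ∈ R)
    (h' : r' ∈ R) (e : r.1 = r'.1) : r.2 = r'.2 := by
  have := (hR (Term.equal (Term.var ⟨r, h⟩) (Term.var ⟨r', h'⟩))).1 (by simpa using e)
  simpa using this

theorem ElemRel.exists_aut {R : Set (N × N)} (hR : ElemRel L R) (h1 : ∀ x, ∃ y, (x, y) ∈ R)
    (h2 : ∀ y, ∃ x, (x, y) ∈ R) : ∃ σ : N ≃[L] N, ∀ r ∈ R, σ r.1 = r.2 := by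
  choose f hf using h1
  let e : N ↪ₑ[L] N := ⟨f, fun n φ x => by
    have := hR (φ.relabel fun k => ⟨(x k, f (x k)), hf (x k)⟩)
    rw [Formula.realize_relabel, Formula.realize_relabel] at this
    exact this.symm⟩
  have hs : Function.Surjective e := fun y => by
    obtain ⟨x, hx⟩ := h2 y
    exact ⟨x, hR.eq_of_eq (hf x) hx rfl⟩
  refine ⟨{ Equiv.ofBijective e ⟨e.injective, hs⟩ with
    map_fun' := fun f x => e.map_fun f x
    map_rel' := fun R x => e.map_rel R x }, fun r hr => hR.eq_of_eq (hf r.1) hr rfl⟩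

variable {J : Type u} [LinearOrder J] {X : J → L.ElementarySubstructure N}

/-- Types over a member of the chain are realized in the later ones. -/
def ChainRealizes (X : J → L.ElementarySubstructure N) : Prop :=
  ∀ i j, i < j → ∀ p : Set (L.Formula (X i ⊕ X i)),
    (∀ q : Finset (L.Formula (X i ⊕ X i)), (q : Set _) ⊆ p →
      ∃ v : X i → X i, ∀ φ ∈ q, φ.Realize (Sum.elim (↑) (fun x => (v x : N)))) →
    ∃ v : X i → X j, ∀ φ ∈ p, φ.Realize (Sum.elim (↑) (fun x => (v x : N)))

/-- The type to realize is the elementary diagram of `X i` together with the equations prescribed by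
`R`. For a finite part, the variables outside the domain of `R` are quantified away; the resulting
formula passes across `R`, and `X i`, being elementary, contains witnesses. -/
theorem ElemRel.exists_extend [Nonempty N] (hX : ChainRealizes X) {i j : J} (hij : i < j)
    {R : Set (N × N)} (hR : ElemRel L R) (hRi : ∀ r ∈ R, r.1 ∈ X i ∧ r.2 ∈ X i) :
    ∃ R', R ⊆ R' ∧ ElemRel L R' ∧ (∀ r ∈ R', r.1 ∈ X i ∧ r.2 ∈ X j) ∧
      ∀ x ∈ X i, ∃ y, (x, y) ∈ R' := by
  classical
  let A : Set (L.Formula (X i)) := {φ | φ.Realize (fun x : X i => (x : N))}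
  let E : R → L.Formula (X i ⊕ X i) := fun r => Term.equal (Term.var (Sum.inl ⟨r.1.2, (hRi _ r.2).2⟩))
    (Term.var (Sum.inr ⟨r.1.1, (hRi _ r.2).1⟩))
  let rel : L.Formula (X i) → L.Formula (X i ⊕ X i) := fun φ => φ.relabel Sum.inr
  obtain ⟨v, hv⟩ := hX i j hij (rel '' A ∪ Set.range E) (by
    intro q hq
    obtain ⟨s, hs, hsq⟩ := Finset.subset_set_image_iff.1
      (show ((q.filter (· ∈ rel '' A) : Finset _) : Set _) ⊆ rel '' A by
        intro φ hφ
        exact (Finset.mem_filter.1 hφ).2)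
    let φ₀ : L.Formula (X i) := Formula.iInf fun φ : s => (φ : L.Formula (X i))
    have hφ₀ : φ₀.Realize (fun x : X i => (x : N)) := by
      simp only [φ₀, Formula.realize_iInf]
      exact fun φ => hs φ.2
    let g : X i → R ⊕ X i := fun x =>
      if h : ∃ r : R, r.1.1 = x then Sum.inl h.choose else Sum.inr x
    obtain ⟨ψ, hψ⟩ := exists_formula_exs (φ₀.relabel g)
    have h1 : ψ.Realize (fun r : R => r.1.1) := by
      rw [hψ]
      refine ⟨fun x => x, ?_⟩
      rw [Formula.realize_relabel]
      convert hφ₀ using 1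
      funext x
      simp only [g, Function.comp_apply]
      split_ifs with h
      · exact h.choose_spec
      · rfl
    have h2 := (hR ψ).1 h1
    have h3 : ψ.Realize (fun r : R => (⟨r.1.2, (hRi _ r.2).2⟩ : X i)) :=
      ((X i).subtype.map_formula ψ _).1 h2
    rw [hψ] at h3
    obtain ⟨w, hw⟩ := h3
    rw [Formula.realize_relabel, ← (X i).subtype.map_formula] at hw
    simp only [φ₀, Formula.realize_iInf] at hw
    let v : X i → X i := Sum.elim (fun r : R => (⟨r.1.2, (hRi _ r.2).2⟩ : X i)) w ∘ g
    refine ⟨v, fun φ hφ => ?_⟩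
    rcases hq hφ with h | ⟨r, rfl⟩
    · have : φ ∈ s.image rel := by
        rw [hsq]
        exact Finset.mem_filter.2 ⟨hφ, h⟩
      obtain ⟨χ, hχ, rfl⟩ := Finset.mem_image.1 this
      have := hw ⟨χ, hχ⟩
      simp only [rel, Formula.realize_relabel]
      exact this
    · simp only [E, Formula.realize_equal, Term.realize_var, Sum.elim_inl, Sum.elim_inr]
      have h : ∃ r' : R, r'.1.1 = r.1.1 := ⟨r, rfl⟩
      simp only [v, g, Function.comp_apply, dif_pos h, Sum.elim_inl]
      exact hR.eq_of_eq r.2 h.choose.2 h.choose_spec.symm)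
  have hvA : ∀ φ : L.Formula (X i), φ.Realize (fun x : X i => (x : N)) →
      φ.Realize (fun x => (v x : N)) := by
    intro φ hφ
    have := hv (rel φ) (Or.inl ⟨φ, hφ, rfl⟩)
    simp only [rel, Formula.realize_relabel] at this
    exact this
  refine ⟨Set.range fun x : X i => ((x : N), (v x : N)), ?_, ?_, ?_, ?_⟩
  · intro r hr
    have := hv (E ⟨r, hr⟩) (Or.inr ⟨_, rfl⟩)
    simp only [E, Formula.realize_equal, Term.realize_var, Sum.elim_inl, Sum.elim_inr] at this
    exact ⟨⟨r.1, (hRi _ hr).1⟩, Prod.ext rfl this.symm⟩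
  · intro φ
    have e1 : ∀ φ : L.Formula (Set.range fun x : X i => ((x : N), (v x : N))),
        φ.Realize (fun r => r.1.1) → φ.Realize (fun r => r.1.2) := by
      intro φ hφ
      have := hvA (φ.relabel fun r => ⟨r.1.1, by obtain ⟨x, hx⟩ := r.2; rw [← hx]; exact x.2⟩) (by
        rw [Formula.realize_relabel]; exact hφ)
      rw [Formula.realize_relabel] at this
      convert this using 1
      funext r
      obtain ⟨_, x, rfl⟩ := r
      rfl
    refine ⟨e1 φ, fun h => ?_⟩
    by_contra h'
    exact Formula.realize_not.1 (e1 φ.not (Formula.realize_not.2 h')) h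
  · rintro _ ⟨x, rfl⟩
    exact ⟨x.2, (v x).2⟩
  · intro x hx
    exact ⟨_, ⟨x, hx⟩, rfl⟩

theorem ElemRel.exists_extend_both [Nonempty N] [NoMaxOrder J] (hX : ChainRealizes X)
    (hmono : Monotone X) (i : J) {R : Set (N × N)} (hR : ElemRel L R)
    (hRi : ∀ r ∈ R, r.1 ∈ X i ∧ r.2 ∈ X i) :
    ∃ R' j, R ⊆ R' ∧ ElemRel L R' ∧ (∀ r ∈ R', r.1 ∈ X j ∧ r.2 ∈ X j) ∧
      ∀ x ∈ X i, (∃ y, (x, y) ∈ R') ∧ ∃ y, (y, x) ∈ R' := by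
  obtain ⟨j, hij⟩ := exists_gt i
  obtain ⟨k, hjk⟩ := exists_gt j
  obtain ⟨R₁, h1, h2, h3, h4⟩ := hR.exists_extend hX hij hRi
  obtain ⟨R₂, h5, h6, h7, h8⟩ := h2.swap.exists_extend hX hjk
    (fun r hr => ⟨(h3 _ hr).2, hmono hij.le (h3 _ hr).1⟩)
  refine ⟨Prod.swap ⁻¹' R₂, k, fun r hr => h5 (by simpa using h1 hr), h6.swap,
    fun r hr => ⟨(h7 _ hr).2, hmono hjk.le (h7 _ hr).1⟩, fun x hx => ⟨?_, ?_⟩⟩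
  · obtain ⟨y, hy⟩ := h4 x hx
    exact ⟨y, h5 (by simpa using hy)⟩
  · exact h8 x (hmono hij.le hx)

/-- A partial elementary map whose domain and range are the same union of members of the chain. -/
def IsGoodRel (X : J → L.ElementarySubstructure N) (R : Set (N × N)) : Prop :=
  ElemRel L R ∧ ∀ r ∈ R, ∃ i, (r.1 ∈ X i ∧ r.2 ∈ X i) ∧
    ∀ x ∈ X i, (∃ y, (x, y) ∈ R) ∧ ∃ y, (y, x) ∈ R

/-- Back-and-forth iterated ω times: each step covers, on both sides, the member of the chain
containing the previous step, so the union satisfies the covering condition. -/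
theorem ElemRel.exists_isGoodRel [Nonempty N] [NoMaxOrder J] (hX : ChainRealizes X)
    (hmono : Monotone X) (i : J) {R : Set (N × N)} (hR : ElemRel L R)
    (hRi : ∀ r ∈ R, r.1 ∈ X i ∧ r.2 ∈ X i) :
    ∃ R', R ⊆ R' ∧ IsGoodRel X R' ∧ ∀ x ∈ X i, (∃ y, (x, y) ∈ R') ∧ ∃ y, (y, x) ∈ R' := by
  let T := {p : Set (N × N) × J // ElemRel L p.1 ∧ ∀ r ∈ p.1, r.1 ∈ X p.2 ∧ r.2 ∈ X p.2}
  have hstep : ∀ t : T, ∃ t' : T, t.1.1 ⊆ t'.1.1 ∧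
      ∀ x ∈ X t.1.2, (∃ y, (x, y) ∈ t'.1.1) ∧ ∃ y, (y, x) ∈ t'.1.1 := by
    intro t
    obtain ⟨R', j, h1, h2, h3, h4⟩ := t.2.1.exists_extend_both hX hmono t.1.2 t.2.2
    exact ⟨⟨(R', j), h2, h3⟩, h1, h4⟩
  choose st hst1 hst2 using hstep
  let t : ℕ → T := fun n => st^[n] ⟨(R, i), hR, hRi⟩
  have ht : ∀ n, t (n + 1) = st (t n) := fun n => Function.iterate_succ_apply' _ _ _
  have hm : Monotone fun n => (t n).1.1 := monotone_nat_of_le_succ fun n => by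
    rw [ht]; exact hst1 _
  have hU : ⋃ n, (t n).1.1 = ⋃₀ Set.range fun n => (t n).1.1 := by rw [Set.sUnion_range]
  have hsub : ∀ n, (t n).1.1 ⊆ ⋃ n, (t n).1.1 := fun n => Set.subset_iUnion (fun n => (t n).1.1) n
  have hcov : ∀ n, ∀ x ∈ X (t n).1.2, (∃ y, (x, y) ∈ ⋃ n, (t n).1.1) ∧
      ∃ y, (y, x) ∈ ⋃ n, (t n).1.1 := by
    intro n x hx
    obtain ⟨⟨y, hy⟩, ⟨z, hz⟩⟩ := hst2 _ x hx
    rw [← ht] at hy hz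
    exact ⟨⟨y, hsub _ hy⟩, ⟨z, hsub _ hz⟩⟩
  refine ⟨⋃ n, (t n).1.1, hsub 0, ⟨?_, ?_⟩, hcov 0⟩
  · rw [hU]
    refine ElemRel.sUnion hm.isChain_range (Set.range_nonempty _) ?_
    rintro _ ⟨n, rfl⟩
    exact (t n).2.1
  · intro r hr
    obtain ⟨n, hn⟩ := Set.mem_iUnion.1 hr
    exact ⟨(t n).1.2, (t n).2.2 r hn, hcov n⟩

/-- A maximal good relation covers every member of the chain. If it missed `X j`, it would be
contained in `X j` and could be extended to a good relation covering it. -/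
theorem isStronglyHomogeneous_of_chain {κ : Cardinal.{u}} [Nonempty N] [NoMaxOrder J]
    (hX : ChainRealizes X) (hmono : Monotone X)
    (hcof : ∀ C : Set N, Cardinal.mk C < κ → ∃ i, C ⊆ X i) (hκ : Cardinal.aleph0 ≤ κ) :
    IsStronglyHomogeneous L κ N := by
  intro C hC f hf
  let R₀ : Set (N × N) := Set.range fun c : C => ((c : N), f c)
  have hR₀ : ElemRel L R₀ := by
    intro φ
    choose s hs using fun r : R₀ => r.2
    have := hf (φ.relabel s)
    rw [Formula.realize_relabel, Formula.realize_relabel] at this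
    convert this using 2
    · funext r; exact (congrArg Prod.fst (hs r)).symm
    · funext r; exact (congrArg Prod.snd (hs r)).symm
  obtain ⟨i, hi⟩ := hcof (C ∪ Set.range f)
    ((Cardinal.mk_union_le _ _).trans_lt (Cardinal.add_lt_of_lt hκ hC
      (Cardinal.mk_range_le.trans_lt hC)))
  obtain ⟨R₁, h01, hR₁, -⟩ := hR₀.exists_isGoodRel hX hmono i (by
    rintro _ ⟨c, rfl⟩
    exact ⟨hi (Or.inl c.2), hi (Or.inr ⟨c, rfl⟩)⟩)
  obtain ⟨m, hm, hmax⟩ := zorn_subset_nonempty {R | IsGoodRel X R} (by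
    intro c hc hchain hne
    refine ⟨⋃₀ c, ⟨ElemRel.sUnion hchain hne fun R hR => (hc hR).1, ?_⟩,
      fun R hR => Set.subset_sUnion_of_mem hR⟩
    rintro r ⟨R, hR, hr⟩
    obtain ⟨i, hi, hx⟩ := (hc hR).2 r hr
    exact ⟨i, hi, fun x hxi => ⟨(hx x hxi).1.imp fun y hy => ⟨R, hR, hy⟩,
      (hx x hxi).2.imp fun y hy => ⟨R, hR, hy⟩⟩⟩) R₁ hR₁
  have hall : ∀ j, ∀ x ∈ X j, (∃ y, (x, y) ∈ m) ∧ ∃ y, (y, x) ∈ m := by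
    intro j
    by_contra hj
    obtain ⟨R', h1, h2, h3⟩ := hmax.prop.1.exists_isGoodRel hX hmono j (by
      intro r hr
      obtain ⟨i, hi, hx⟩ := hmax.prop.2 r hr
      -- `X i` is entirely covered by `m`; if `j` lay below `i`, then `X j` would be covered too.
      have hij : i ≤ j := by
        by_contra hji
        exact hj fun x hxj => hx x (hmono (not_le.1 hji).le hxj)
      exact ⟨hmono hij hi.1, hmono hij hi.2⟩)
    have : R' ⊆ m := hmax.le_of_ge h2 h1
    exact hj fun x hx => ⟨(h3 x hx).1.imp fun y hy => this hy, (h3 x hx).2.imp fun y hy => this hy⟩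
  have hx : ∀ x : N, ∃ j, x ∈ X j := by
    intro x
    obtain ⟨j, hj⟩ := hcof {x} (lt_of_lt_of_le (by simp) hκ)
    exact ⟨j, hj rfl⟩
  obtain ⟨σ, hσ⟩ := hmax.prop.1.exists_aut
    (fun x => (hall _ x (hx x).choose_spec).1) (fun x => (hall _ x (hx x).choose_spec).2)
  exact ⟨σ, fun c => hσ _ (hm (h01 ⟨c, rfl⟩))⟩

theorem isSaturated_of_chain {κ : Cardinal.{u}} [Nonempty N] [NoMaxOrder J]
    (hX : ChainRealizes X) (hcof : ∀ C : Set N, Cardinal.mk C < κ → ∃ i, C ⊆ X i) :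
    IsSaturated L κ N := by
  classical
  intro C hC p hp
  obtain ⟨i, hi⟩ := hcof C hC
  obtain ⟨j, hij⟩ := exists_gt i
  have : Nonempty (X i) := inferInstance
  -- Types in the chain have variables indexed by all of `X i`; only the one named `x₀` is used.
  let x₀ : X i := Classical.arbitrary _
  let tr : L[[C]].Formula (Fin 1) → L.Formula (C ⊕ Fin 1) := fun φ =>
    BoundedFormula.constantsVarsEquiv φ
  have htr : ∀ φ (v : Fin 1 → N), (tr φ).Realize (Sum.elim (↑) v) ↔ φ.Realize v :=
    fun φ v => BoundedFormula.realize_constantsVarsEquiv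
  let g : C ⊕ Fin 1 → X i ⊕ X i := Sum.map (fun c => ⟨c, hi c.2⟩) (fun _ => x₀)
  obtain ⟨v, hv⟩ := hX i j hij ((fun φ => (tr φ).relabel g) '' p) (by
    intro q hq
    obtain ⟨r, hr, rfl⟩ := Finset.subset_set_image_iff.1 hq
    obtain ⟨v, hv⟩ := hp r hr
    let ψ : L.Formula C := Formula.iExs (Fin 1) (Formula.iInf fun φ : r => tr φ.1)
    have h1 : ψ.Realize (fun c : C => (c : N)) := by
      simp only [ψ, Formula.realize_iExs, Formula.realize_iInf]
      exact ⟨v, fun φ => (htr _ _).2 (hv φ.1 φ.2)⟩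
    have h2 : ψ.Realize (fun c : C => (⟨c, hi c.2⟩ : X i)) :=
      ((X i).subtype.map_formula ψ _).1 h1
    simp only [ψ, Formula.realize_iExs, Formula.realize_iInf] at h2
    obtain ⟨w, hw⟩ := h2
    refine ⟨fun _ => w 0, fun φ hφ => ?_⟩
    obtain ⟨χ, hχ, rfl⟩ := Finset.mem_image.1 hφ
    have := ((X i).subtype.map_formula _ _).2 (hw ⟨χ, hχ⟩)
    rw [Formula.realize_relabel]
    convert this using 1
    funext y; rcases y with y | y
    · rfl
    · simp [g, Subsingleton.elim y 0])
  refine ⟨fun _ => v x₀, fun φ hφ => ?_⟩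
  have := hv _ ⟨φ, hφ, rfl⟩
  rw [Formula.realize_relabel] at this
  rw [← htr]
  convert this using 1
  funext y; rcases y with y | y <;> rfl

end Homogeneous

theorem exists_isStrongLimit_gt (c : Cardinal.{u}) : ∃ κ : Cardinal.{u}, κ.IsStrongLimit ∧ c < κ := by
  -- Adding ω makes the index a limit ordinal, and it also gives the strict inequality.
  refine ⟨Cardinal.beth (c.ord + Ordinal.omega0), Cardinal.isStrongLimit_beth.2
    (Ordinal.isSuccLimit_add _ Ordinal.isSuccLimit_omega0).isSuccPrelimit, ?_⟩
  refine (Cardinal.le_beth_ord c).trans_lt (Cardinal.beth_strictMono ?_)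
  exact (lt_add_iff_pos_right _).2 Ordinal.omega0_pos

/-- Every structure has a monster model. -/
theorem exists_isMonster (L : FirstOrder.Language.{u, u}) (K : Type u) [L.Structure K]
    [Nonempty K] : ∃ (κ : Cardinal.{u}) (N : Type u) (_ : L.Structure N),
      IsMonster L κ N ∧ Nonempty (K ↪ₑ[L] N) := by
  obtain ⟨κ, hκ, hlt⟩ := exists_isStrongLimit_gt (max Cardinal.aleph0 L.card)
  have hκ0 : Cardinal.aleph0 < κ := (le_max_left _ _).trans_lt hlt
  -- The length κ⁺ is regular and exceeds `κ`, so every set of fewer than `κ` points lies in a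
  -- single member of the chain; `κ` itself need not be regular.
  let J : Type u := (Order.succ κ).ord.ToType
  have hreg : (Order.succ κ).IsRegular := Cardinal.isRegular_succ hκ0.le
  have hJ : Order.cof J = Order.succ κ := by
    rw [Ordinal.cof_toType, hreg.cof_ord]
  have : NoMaxOrder J := Cardinal.noMaxOrder (hκ0.le.trans (Order.le_succ κ))
  have : Nonempty J := by
    rw [← Order.cof_ne_zero_iff, hJ]
    exact (hreg.pos).ne'
  obtain ⟨N, _, X, hmono, hcov, ⟨e⟩, hX⟩ := exists_elementary_chain (L := L) K J
  have hcof : ∀ C : Set N, Cardinal.mk C < κ → ∃ i, C ⊆ X i := by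
    intro C hC
    choose i hi using hcov
    by_contra h
    push Not at h
    have hco : IsCofinal (Set.range fun c : C => i c) := by
      intro j
      obtain ⟨x, hx, hxj⟩ := Set.not_subset.1 (h j)
      refine ⟨i x, ⟨⟨x, hx⟩, rfl⟩, ?_⟩
      by_contra hlt
      exact hxj (hmono (not_le.1 hlt).le (hi x))
    have := (Order.cof_le hco).trans Cardinal.mk_range_le
    rw [hJ] at this
    exact absurd (this.trans_lt hC) (not_lt.2 (Order.le_succ κ))
  have : Nonempty N := ⟨e (Classical.arbitrary K)⟩
  exact ⟨κ, N, inferInstance, ⟨hκ, hκ0, (le_max_right _ _).trans_lt hlt,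
    isSaturated_of_chain hX hcof, isStronglyHomogeneous_of_chain hX hmono hcof hκ0.le⟩, ⟨e⟩⟩


/-! ### Predicates on the interpreted group given by one formula in all structures. -/

section UniformlyDefinable

variable {L : FirstOrder.Language.{u, u}} {β : Type u} {n m : ℕ}

/-- The coordinates of a tuple of elements of the interpreted group. -/
def Interp.coordsG {D : ExtFormulas L β n m} {K : Type u} [L.Structure K] {b : β → K}
    (I : Interp D K b) {α : Type*} (v : α → I.G) : α × Fin n → K := fun p => I.coordG (v p.1) p.2

/-- A predicate on tuples of elements of the interpreted group is given by a formula, the same one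
in every structure. -/
def UniformlyDefinable (D : ExtFormulas L β n m) {α : Type*}
    (R : ∀ {K : Type u} [L.Structure K] {b : β → K} (I : Interp D K b), (α → I.G) → Prop) : Prop :=
  ∃ ψ : L.Formula (β ⊕ (α × Fin n)), ∀ {K : Type u} [L.Structure K] {b : β → K} (I : Interp D K b)
    (v : α → I.G), ψ.Realize (Sum.elim b (I.coordsG v)) ↔ R I v

namespace UniformlyDefinable

variable {D : ExtFormulas L β n m} {α α' : Type*}
  {R S : ∀ {K : Type u} [L.Structure K] {b : β → K} (I : Interp D K b), (α → I.G) → Prop}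

theorem imp (hR : UniformlyDefinable D R) (hS : UniformlyDefinable D S) :
    UniformlyDefinable D fun I v => R I v → S I v := by
  obtain ⟨φ, hφ⟩ := hR
  obtain ⟨ψ, hψ⟩ := hS
  exact ⟨φ.imp ψ, fun I v => by rw [Formula.realize_imp, hφ, hψ]⟩

theorem false : UniformlyDefinable D (α := α) fun _ _ => False :=
  ⟨⊥, fun _ _ => Formula.realize_bot⟩

theorem congr (hR : UniformlyDefinable D R) (h : ∀ {K : Type u} [L.Structure K] {b : β → K}
    (I : Interp D K b) (v : α → I.G), R I v ↔ S I v) : UniformlyDefinable D S := by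
  obtain ⟨φ, hφ⟩ := hR
  exact ⟨φ, fun I v => (hφ I v).trans (h I v)⟩

theorem not (hR : UniformlyDefinable D R) : UniformlyDefinable D fun I v => ¬ R I v :=
  hR.imp false

theorem and (hR : UniformlyDefinable D R) (hS : UniformlyDefinable D S) :
    UniformlyDefinable D fun I v => R I v ∧ S I v := by
  obtain ⟨φ, hφ⟩ := hR
  obtain ⟨ψ, hψ⟩ := hS
  exact ⟨φ ⊓ ψ, fun I v => by rw [Formula.realize_inf, hφ, hψ]⟩

theorem comp (hR : UniformlyDefinable D R) (f : α → α') :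
    UniformlyDefinable D (α := α') fun I v => R I (v ∘ f) := by
  obtain ⟨φ, hφ⟩ := hR
  refine ⟨φ.relabel (Sum.map id (Prod.map f id)), fun I v => ?_⟩
  rw [Formula.realize_relabel, ← hφ, Sum.elim_comp_map]
  rfl

theorem iInf {ι : Type*} [Finite ι]
    {T : ι → ∀ {K : Type u} [L.Structure K] {b : β → K} (I : Interp D K b), (α → I.G) → Prop}
    (hT : ∀ i, UniformlyDefinable D (T i)) : UniformlyDefinable D fun I v => ∀ i, T i I v := by
  choose φ hφ using hT
  exact ⟨Formula.iInf φ, fun I v => by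
    rw [Formula.realize_iInf]
    exact forall_congr' fun i => hφ i I v⟩

/-- Quantification over the group is quantification over tuples relativized to `D.domG`. -/
theorem all {ι : Type*} [Finite ι] {T : ∀ {K : Type u} [L.Structure K] {b : β → K}
    (I : Interp D K b), (α ⊕ ι → I.G) → Prop} (hT : UniformlyDefinable D T) :
    UniformlyDefinable D (α := α) fun I v => ∀ g, T I (Sum.elim v g) := by
  obtain ⟨φ, hφ⟩ := hT
  let e : β ⊕ ((α ⊕ ι) × Fin n) → (β ⊕ (α × Fin n)) ⊕ (ι × Fin n) := Sum.elim (Sum.inl ∘ Sum.inl)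
    fun p => p.1.elim (fun a => Sum.inl (Sum.inr (a, p.2))) fun i => Sum.inr (i, p.2)
  refine ⟨Formula.iAlls (ι × Fin n) ((Formula.iInf fun i : ι => D.domG.relabel fun k =>
    Sum.inr (i, k)).imp (φ.relabel e)), fun {K} _ {b} I v => ?_⟩
  have h : ∀ g : ι → I.G, Sum.elim (Sum.elim b (I.coordsG v)) (I.coordsG g) ∘ e =
      Sum.elim b (I.coordsG (Sum.elim v g)) := by
    intro g
    funext x
    rcases x with x | ⟨x | x, i⟩ <;> rfl
  simp only [Formula.realize_iAlls, Formula.realize_imp, Formula.realize_relabel,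
    Formula.realize_iInf]
  constructor
  · intro H g
    have := H (I.coordsG g) fun i => (g i).2
    rw [h g] at this
    exact (hφ I _).1 this
  · intro H w hw
    let g : ι → I.G := fun i => (⟨fun k => w (i, k), hw i⟩ : Pts D.domG K)
    have : w = I.coordsG g := rfl
    rw [this, h g]
    exact (hφ I _).2 (H _)

theorem ex {ι : Type*} [Finite ι] {T : ∀ {K : Type u} [L.Structure K] {b : β → K}
    (I : Interp D K b), (α ⊕ ι → I.G) → Prop} (hT : UniformlyDefinable D T) :
    UniformlyDefinable D (α := α) fun I v => ∃ g, T I (Sum.elim v g) :=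
  hT.not.all.not.congr fun I v => by push Not; exact Iff.rfl

theorem eq (x y : α) : UniformlyDefinable D fun _ v => v x = v y := by
  refine ⟨Formula.iInf fun i : Fin n => Term.equal (Term.var (Sum.inr (x, i)))
    (Term.var (Sum.inr (y, i))), fun I v => ?_⟩
  simp only [Formula.realize_iInf, Formula.realize_equal, Term.realize_var, Sum.elim_inr]
  exact ⟨fun h => Interp.coordG_injective I (funext h), fun h i => by simp [Interp.coordsG, h]⟩

theorem mul (x y z : α) : UniformlyDefinable D fun _ v => v x * v y = v z := by
  refine ⟨D.mul.relabel (Sum.elim (fun i => Sum.inr (x, i)) (Sum.elim (fun i => Sum.inr (y, i))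
    (fun i => Sum.inr (z, i)))), fun I v => ?_⟩
  rw [Formula.realize_relabel, Sum.comp_elim, Sum.comp_elim]
  exact I.mul_iff (v x) (v y) (v z)

/-- The unit is the only idempotent of a group, so no parameter for it is needed. -/
theorem one (x : α) : UniformlyDefinable D fun _ v => v x = 1 :=
  (mul x x x).congr fun _ _ => mul_eq_left

/-- This yields elementarity of the maps between induced structures, and later the transfer of
commutator width. -/
theorem iff_map (hR : UniformlyDefinable D R) {M N : Type u} [L.Structure M] [L.Structure N]
    {b : β → M} {b' : β → N} (I : Interp D M b) (I' : Interp D N b') (e : M ↪ₑ[L] N)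
    (hb : ∀ x, b' x = e (b x)) (v : α → I.G) :
    R I' (fun x => Interp.mapG I I' e (v x)) ↔ R I v := by
  obtain ⟨φ, hφ⟩ := hR
  refine (hφ I' _).symm.trans (Iff.trans ?_ (hφ I v))
  rw [← e.map_formula φ, Sum.comp_elim]
  apply iff_of_eq
  congr 2
  funext x
  exact hb x

end UniformlyDefinable

end UniformlyDefinable

/-! ### The structure induced on the interpreted group and its monster model. -/

section Induced

/-- The function symbols of the induced language: the multiplication. -/
inductive IndFun : ℕ → Type u
  | mul : IndFun 2

/-- The language of the structure induced on the interpreted group. -/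
def indLang (L : FirstOrder.Language.{u, u}) (β : Type u) (n : ℕ) : FirstOrder.Language.{u, u} :=
  ⟨IndFun, fun k => L.Formula (β ⊕ (Fin k × Fin n))⟩

variable {L : FirstOrder.Language.{u, u}} {β : Type u} {n m : ℕ} {D : ExtFormulas L β n m}

instance {K : Type u} [L.Structure K] {b : β → K} (I : Interp D K b) :
    (indLang L β n).Structure I.G where
  funMap f := match f with
    | IndFun.mul => fun v => v 0 * v 1
  RelMap φ v := Formula.Realize (M := K) φ (Sum.elim b (I.coordsG v))

theorem indLang_card_lt {κ : Cardinal.{u}} (hκ : Cardinal.aleph0 < κ) (hL : L.card < κ)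
    (hβ : Cardinal.mk β < κ) : (indLang L β n).card < κ := by
  let μ := max Cardinal.aleph0 (max (Cardinal.mk β) L.card)
  have hμ : μ < κ := max_lt hκ (max_lt hβ hL)
  have hμ0 : Cardinal.aleph0 ≤ μ := le_max_left _ _
  have h1 : ∀ k, Cardinal.mk (L.Formula (β ⊕ (Fin k × Fin n))) ≤ μ := by
    intro k
    -- The addition bound is stated for strict inequalities below an infinite cardinal, hence the
    -- detour through the successor of `μ`.
    refine Order.lt_succ_iff.1 ?_
    have hμ' := hμ0.trans_lt (Order.lt_succ μ)
    have e : Cardinal.mk (L.Formula (β ⊕ (Fin k × Fin n))) ≤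
        Cardinal.mk (Σ n', L.BoundedFormula (β ⊕ (Fin k × Fin n)) n') :=
      Cardinal.mk_le_of_injective (f := fun φ => ⟨0, φ⟩) (fun a b h => by simpa using h)
    refine (e.trans BoundedFormula.card_le).trans_lt ?_
    simp only [Cardinal.lift_id]
    refine max_lt hμ' (Cardinal.add_lt_of_lt hμ'.le ?_ ?_)
    · rw [Cardinal.mk_sum]
      refine Cardinal.add_lt_of_lt hμ'.le ?_ ?_
      · simpa using (Order.lt_succ_iff (b := μ)).2 ((le_max_left _ _).trans (le_max_right _ _))
      · refine lt_of_lt_of_le ?_ hμ'.le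
        rw [Cardinal.lift_lt_aleph0]
        exact Cardinal.lt_aleph0_of_finite _
    · exact Order.lt_succ_iff.2 ((le_max_right _ _).trans (le_max_right _ _))
  have h2 : Cardinal.mk (Σ k, (indLang L β n).Functions k) ≤ μ := by
    have : Subsingleton (Σ k, (indLang L β n).Functions k) :=
      ⟨by rintro ⟨_, ⟨⟩⟩ ⟨_, ⟨⟩⟩; rfl⟩
    exact (Cardinal.le_one_iff_subsingleton.2 this).trans (Cardinal.one_le_aleph0.trans hμ0)
  have h3 : Cardinal.mk (Σ k, (indLang L β n).Relations k) ≤ μ := by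
    rw [Cardinal.mk_sigma]
    refine (Cardinal.sum_le_sum _ (fun _ => μ) h1).trans ?_
    rw [Cardinal.sum_const]
    simp only [Cardinal.mk_nat, Cardinal.lift_aleph0, Cardinal.lift_uzero]
    exact (Cardinal.mul_eq_right hμ0 hμ0 Cardinal.aleph0_ne_zero).le
  refine lt_of_le_of_lt ?_ hμ
  rw [Language.card, Language.Symbols, Cardinal.mk_sum]
  simp only [Cardinal.lift_id]
  exact Cardinal.add_le_of_le hμ0 h2 h3

/-- The graph of a term is defined by naming the values of its subterms with existential
quantifiers. -/
theorem uniformlyDefinable_term {α : Type*} (t : (indLang L β n).Term α) :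
    UniformlyDefinable D (α := α ⊕ Unit) fun _ v => t.realize (v ∘ Sum.inl) = v (Sum.inr ()) := by
  induction t with
  | var a => exact UniformlyDefinable.eq _ _
  | func f ts ih =>
    cases f
    have h0 := (ih 0).comp (Sum.elim (Sum.inl ∘ Sum.inl ∘ Sum.inl) (fun _ => Sum.inl (Sum.inr ())) :
      α ⊕ Unit → ((α ⊕ Unit) ⊕ Unit) ⊕ Unit)
    have h1 := (ih 1).comp (Sum.elim (Sum.inl ∘ Sum.inl ∘ Sum.inl) Sum.inr :
      α ⊕ Unit → ((α ⊕ Unit) ⊕ Unit) ⊕ Unit)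
    refine ((h0.and h1).and (UniformlyDefinable.mul (Sum.inl (Sum.inr ())) (Sum.inr ())
      (Sum.inl (Sum.inl (Sum.inr ()))))).ex.ex.congr fun I v => ?_
    constructor
    · rintro ⟨x, y, ⟨h0, h1⟩, h⟩
      change (ts 0).realize (v ∘ Sum.inl) = x () at h0
      change (ts 1).realize (v ∘ Sum.inl) = y () at h1
      change x () * y () = v (Sum.inr ()) at h
      rw [← h, ← h0, ← h1]
      rfl
    · intro h
      exact ⟨fun _ => _, fun _ => _, ⟨rfl, rfl⟩, h⟩

theorem uniformlyDefinable_rel {k : ℕ} (R : (indLang L β n).Relations k) :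
    UniformlyDefinable D (α := Fin k) fun _ v => Structure.RelMap R v :=
  ⟨R, fun _ _ => Iff.rfl⟩

theorem uniformlyDefinable_boundedFormula {α : Type*} {k : ℕ}
    (χ : (indLang L β n).BoundedFormula α k) :
    UniformlyDefinable D (α := α ⊕ Fin k) fun _ v => χ.Realize (v ∘ Sum.inl) (v ∘ Sum.inr) := by
  induction χ with
  | falsum => exact UniformlyDefinable.false
  | @equal k t₁ t₂ =>
    refine ((uniformlyDefinable_term t₁).and (uniformlyDefinable_term t₂)).ex.congr fun I v => ?_
    rw [BoundedFormula.Realize]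
    have : Sum.elim (v ∘ Sum.inl) (v ∘ Sum.inr) = v := Sum.elim_comp_inl_inr v
    rw [this]
    constructor
    · rintro ⟨g, h1, h2⟩
      exact h1.trans h2.symm
    · intro h
      exact ⟨fun _ => _, rfl, h.symm⟩
  | @rel k l R ts =>
    refine ((UniformlyDefinable.iInf fun i => (uniformlyDefinable_term (ts i)).comp
      (Sum.elim Sum.inl fun _ => Sum.inr i)).and ((uniformlyDefinable_rel R).comp
        (Sum.inr : Fin l → (α ⊕ Fin k) ⊕ Fin l))).ex.congr fun I v => ?_
    have : Sum.elim (v ∘ Sum.inl) (v ∘ Sum.inr) = v := Sum.elim_comp_inl_inr v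
    rw [BoundedFormula.Realize, this]
    constructor
    · rintro ⟨g, h1, h2⟩
      obtain rfl : (fun i => (ts i).realize v) = g := funext h1
      exact h2
    · intro h
      exact ⟨_, fun _ => rfl, h⟩
  | imp _ _ h1 h2 => exact h1.imp h2
  | @all k f ih =>
    refine (ih.comp (Sum.elim (Sum.inl ∘ Sum.inl) (Fin.snoc (α := fun _ => (α ⊕ Fin k) ⊕ Unit)
      (Sum.inl ∘ Sum.inr) (Sum.inr ())))).all.congr fun I v => ?_
    rw [BoundedFormula.Realize]
    have h : ∀ g : Unit → I.G, Sum.elim v g ∘ Fin.snoc (α := fun _ => (α ⊕ Fin k) ⊕ Unit)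
        (Sum.inl ∘ Sum.inr) (Sum.inr ()) = Fin.snoc (α := fun _ => I.G) (v ∘ Sum.inr) (g ()) := by
      intro g
      funext i
      refine Fin.lastCases ?_ (fun i => ?_) i <;> simp
    constructor
    · intro H g
      rw [← h fun _ => g]
      exact H _
    · intro H g
      have := H (g ())
      rw [← h g] at this
      exact this

theorem uniformlyDefinable_formula {α : Type*} (χ : (indLang L β n).Formula α) :
    UniformlyDefinable D (α := α) fun _ v => χ.Realize v := by
  refine ((uniformlyDefinable_boundedFormula χ).comp
    (Sum.elim id fun i : Fin 0 => i.elim0)).congr fun I v => ?_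
  rw [Formula.Realize]
  apply iff_of_eq
  congr 1
  exact funext fun i => i.elim0

end Induced


section InducedMonster

variable {L : FirstOrder.Language.{u, u}} {β : Type u} {n m : ℕ} {D : ExtFormulas L β n m}
  {N : Type u} [L.Structure N] {b : β → N} {κ : Cardinal.{u}} (I : Interp D N b)

/-- A formula mentions only finitely many group elements, so after listing them it is an atomic
relation of the induced language. -/
theorem exists_formula_indLang {α : Type*} (φ : L.Formula (β ⊕ (α × Fin n))) :
    ∃ χ : (indLang L β n).Formula α, ∀ {K : Type u} [L.Structure K] {b : β → K} (I : Interp D K b)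
      (v : α → I.G), χ.Realize v ↔ φ.Realize (Sum.elim b (I.coordsG v)) := by
  classical
  obtain ⟨s, ψ, hψ⟩ := exists_formula_finset φ
  let t : Finset α := s.biUnion fun x => x.elim (fun _ => ∅) fun p => {p.1}
  have ht : ∀ a i, Sum.inr (a, i) ∈ s → a ∈ t := fun a i h =>
    Finset.mem_biUnion.2 ⟨_, h, Finset.mem_singleton_self _⟩
  let e : ∀ x, x ∈ s → β ⊕ (Fin t.card × Fin n) := fun x => match x with
    | Sum.inl x => fun _ => Sum.inl x
    | Sum.inr (a, i) => fun h => Sum.inr (t.equivFin ⟨a, ht a i h⟩, i)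
  let R : (indLang L β n).Relations t.card := ψ.relabel fun x => e x.1 x.2
  refine ⟨Relations.formula R fun k => Term.var (t.equivFin.symm k : α),
    fun {K} _ {b} I v => ?_⟩
  rw [Formula.realize_rel, ← hψ]
  change Formula.Realize (ψ.relabel fun x => e x.1 x.2) _ ↔ _
  rw [Formula.realize_relabel]
  apply iff_of_eq
  congr 1
  funext x
  rcases x with ⟨x | ⟨a, i⟩, h⟩
  · rfl
  · simp [e, Interp.coordsG]

/-- The automorphism of the induced structure given by an automorphism. -/
def indAut (σ : N ≃[L] N) (hσ : ∀ x, σ (b x) = b x) : I.G ≃[indLang L β n] I.G where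
  toFun := Interp.mapG I I σ.toElementaryEmbedding
  invFun := Interp.mapG I I σ.symm.toElementaryEmbedding
  left_inv x := Interp.coordG_injective I (funext fun i => σ.symm_apply_apply (I.coordG x i))
  right_inv x := Interp.coordG_injective I (funext fun i => σ.apply_symm_apply (I.coordG x i))
  map_fun' f v := by
    cases f
    exact map_mul _ _ _
  map_rel' R v := (uniformlyDefinable_rel R).iff_map I I σ.toElementaryEmbedding
    (fun x => (hσ x).symm) v

theorem mk_params_lt (hκ : Cardinal.aleph0 ≤ κ) (hβ : Cardinal.mk β < κ) {α : Type u}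
    (hα : Cardinal.mk α < κ) : Cardinal.mk (β ⊕ (α × Fin n)) < κ := by
  have : Cardinal.mk (α × Fin n) = Cardinal.mk (α × ULift.{u} (Fin n)) :=
    Cardinal.mk_congr (Equiv.prodCongr (Equiv.refl _) Equiv.ulift.symm)
  rw [Cardinal.mk_sum]
  simp only [Cardinal.lift_id]
  refine Cardinal.add_lt_of_lt hκ hβ ?_
  rw [this]
  exact mk_prod_lt hκ hα (mk_finite_lt hκ _)

/-- Tuples with the same type in the induced language have the same type over `b` in the ambient
structure, so ambient homogeneity applies. -/
theorem IsMonster.exists_aut_of_indLang (hN : IsMonster L κ N) (hβ : Cardinal.mk β < κ)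
    {α : Type u} (hα : Cardinal.mk α < κ) (v w : α → I.G)
    (h : ∀ χ : (indLang L β n).Formula α, χ.Realize v → χ.Realize w) :
    ∃ σ : N ≃[L] N, (∀ x, σ (b x) = b x) ∧ ∀ a, I.coordG (w a) = σ ∘ I.coordG (v a) := by
  obtain ⟨σ, hσ⟩ := hN.homogeneous.exists_aut (mk_params_lt (n := n) hN.aleph0_lt.le hβ hα)
    (Sum.elim b (I.coordsG v)) (Sum.elim b (I.coordsG w)) (by
      intro φ hφ
      obtain ⟨χ, hχ⟩ := exists_formula_indLang (D := D) φ
      exact (hχ I w).1 (h χ ((hχ I v).2 hφ)))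
  exact ⟨σ, fun x => hσ (Sum.inl x), fun a => funext fun i => (hσ (Sum.inr (a, i))).symm⟩

/-- Homogeneity restricts an ambient automorphism fixing `b`. Saturation translates a type into
ambient formulas and adds the formula defining the group, so that the realization is a group
element. -/
theorem isMonster_ind (hN : IsMonster L κ N) (hβ : Cardinal.mk β < κ) :
    IsMonster (indLang L β n) κ I.G where
  strongLimit := hN.strongLimit
  aleph0_lt := hN.aleph0_lt
  card_lt := indLang_card_lt hN.aleph0_lt hN.card_lt hβ
  homogeneous := by
    intro C hC f hf
    obtain ⟨σ, hσ, hf'⟩ := hN.exists_aut_of_indLang I hβ hC (fun c => (c : I.G)) f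
      fun χ => (hf χ).1
    exact ⟨indAut I σ hσ, fun c => Interp.coordG_injective I (hf' c).symm⟩
  saturated := by
    classical
    intro C hC p hp
    let tr : (indLang L β n)[[C]].Formula (Fin 1) → (indLang L β n).Formula (C ⊕ Fin 1) := fun φ =>
      BoundedFormula.constantsVarsEquiv φ
    have htr : ∀ φ (v : Fin 1 → I.G), (tr φ).Realize (Sum.elim (↑) v) ↔ φ.Realize v :=
      fun φ v => BoundedFormula.realize_constantsVarsEquiv
    have huni : ∀ φ : (indLang L β n)[[C]].Formula (Fin 1), ∃ ψ : L.Formula ((β ⊕ (C × Fin n)) ⊕ Fin n), ∀ v : Fin 1 → I.G,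
        ψ.Realize (Sum.elim (Sum.elim b (I.coordsG fun c : C => (c : I.G))) (I.coordG (v 0))) ↔
          φ.Realize v := by
      intro φ
      obtain ⟨ψ, hψ⟩ := uniformlyDefinable_formula (D := D) (tr φ)
      refine ⟨ψ.relabel (Sum.elim (Sum.inl ∘ Sum.inl) fun p => p.1.elim
        (fun c => Sum.inl (Sum.inr (c, p.2))) fun _ => Sum.inr p.2), fun v => ?_⟩
      rw [← htr, Formula.realize_relabel]
      refine Iff.trans (iff_of_eq ?_) (hψ I (Sum.elim (↑) v))
      congr 1
      funext x
      rcases x with x | ⟨x | x, i⟩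
      · rfl
      · rfl
      · simp [Interp.coordsG, Subsingleton.elim x 0]
    choose ψ hψ using huni
    obtain ⟨w, hw⟩ := hN.saturated.realize hN.aleph0_lt.le (Fin n)
      (mk_params_lt (n := n) hN.aleph0_lt.le hβ hC) (Sum.elim b (I.coordsG fun c : C => (c : I.G)))
      (insert (D.domG.relabel Sum.inr) (ψ '' p)) (by
        intro q hq
        obtain ⟨r, hr, hrq⟩ := Finset.subset_set_image_iff.1
          (show ((q.erase (D.domG.relabel Sum.inr) : Finset _) : Set _) ⊆ ψ '' p by
            intro φ hφ
            have := Finset.mem_erase.1 hφ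
            exact (hq this.2).resolve_left this.1)
        obtain ⟨v, hv⟩ := hp r hr
        refine ⟨I.coordG (v 0), fun φ hφ => ?_⟩
        by_cases h : φ = D.domG.relabel Sum.inr
        · rw [h, Formula.realize_relabel]
          exact (v 0).2
        · have : φ ∈ r.image ψ := by
            rw [hrq]
            exact Finset.mem_erase.2 ⟨h, hφ⟩
          obtain ⟨χ, hχ, rfl⟩ := Finset.mem_image.1 this
          exact (hψ χ v).2 (hv χ hχ))
    have h0 := hw _ (Set.mem_insert _ _)
    rw [Formula.realize_relabel] at h0
    refine ⟨fun _ => (⟨w, h0⟩ : Pts D.domG N), fun φ hφ => ?_⟩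
    exact (hψ φ _).1 (hw _ (Set.mem_insert_of_mem _ ⟨φ, hφ, rfl⟩))

/-- The elementary embedding of the induced structures given by an elementary embedding. -/
def indEmb {M : Type u} [L.Structure M] {b₁ : β → M} (I₁ : Interp D M b₁) (e : M ↪ₑ[L] N)
    (hb : ∀ x, b x = e (b₁ x)) : I₁.G ↪ₑ[indLang L β n] I.G where
  toFun := Interp.mapG I₁ I e
  map_formula' _ χ v := (uniformlyDefinable_formula χ).iff_map I₁ I e hb v

/-- At a given point, an automorphism of the induced structure agrees with an ambient one fixing
`b`. Hence every `P`-invariant subgroup is invariant for the induced structure without parameters.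
-/
theorem comp000_coordG_eq_top (hN : IsMonster L κ N) (hβ : Cardinal.mk β < κ) {P : Set N}
    (hP : ∀ p ∈ P, ∃ x, b x = p)
    (h : comp000 (indLang L β n) κ ∅ (fun (x : I.G) (_ : Unit) => x) = ⊤) :
    comp000 L κ P I.coordG = ⊤ := by
  rw [eq_top_iff, ← h]
  refine le_sInf fun H hH => comp000_le ?_ hH.2
  have hc : IsCoord (indLang L β n) ∅ (fun (x : I.G) (_ : Unit) => x) := {
    injective := fun x y hxy => congrFun hxy ()
    exists_hom := fun τ _ => ⟨MonoidHom.mk' τ fun x y => τ.map_fun IndFun.mul ![x, y],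
      fun _ => rfl⟩ }
  refine hc.isInvariant_iff.2 fun τ _ x y hxy hx => ?_
  obtain rfl : y = τ x := congrFun hxy ()
  obtain ⟨σ, hσ, hx'⟩ := hN.exists_aut_of_indLang I hβ (α := PUnit) (κ := κ)
    (by simpa using Cardinal.one_lt_aleph0.trans hN.aleph0_lt) (fun _ => x) (fun _ => τ x) (by
      intro χ hχ
      exact (StrongHomClass.realize_formula τ χ).2 hχ)
  refine (Interp.isCoord_coordG I P).isInvariant_iff.1 hH.1 σ ?_ x (τ x) (hx' ⟨⟩) hx
  intro p hp
  obtain ⟨z, rfl⟩ := hP p hp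
  exact hσ z

theorem AbsolutelyConnected.comp000_eq_top {M : Type u} [L.Structure M] {b₁ : β → M}
    {I₁ : Interp D M b₁} (hG : AbsolutelyConnected I₁.G) (hN : IsMonster L κ N) (e : M ↪ₑ[L] N)
    (hb : ∀ x, b x = e (b₁ x)) (hβ : Cardinal.mk β < κ) {P : Set N}
    (hP : ∀ p ∈ P, ∃ x, b x = p) : comp000 L κ P I.coordG = ⊤ :=
  comp000_coordG_eq_top I hN hβ hP (hG.2 (indLang L β n) IndFun.mul (fun _ _ => rfl) I.G
    (fun _ _ => rfl) κ (isMonster_ind I hN hβ) ⟨indEmb I I₁ e hb⟩ ∅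
    (by simpa using Cardinal.aleph0_pos.trans hN.aleph0_lt))

end InducedMonster


/-! ### Absolutely connected groups are perfect. -/

section Perfect

/-- Characters of the abelianization with values in ℚ/ℤ separate points; ℚ/ℤ embeds in ℝ/ℤ, where a
norm and compactness are available. -/
theorem exists_norm_character {G : Type u} [Group G] (hG : commutator G ≠ ⊤) :
    ∃ c : G → AddCircle (1 : ℝ), (∀ x y, c (x * y) = c x + c y) ∧ ∃ g, 0 < ‖c g‖ := by
  obtain ⟨g, hg⟩ : ∃ g, g ∉ commutator G := by
    by_contra h
    push Not at h
    exact hG (eq_top_iff.2 fun g _ => h g)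
  have hg' : Additive.ofMul (Abelianization.of g) ≠ 0 := fun h => hg (by
    have : Abelianization.of g = 1 := h
    rw [← Abelianization.ker_of]
    exact this)
  obtain ⟨d, hd⟩ := CharacterModule.exists_character_apply_ne_zero_of_ne_zero hg'
  let r : AddCircle (1 : ℚ) →+ AddCircle (1 : ℝ) :=
    QuotientAddGroup.map _ _ (Rat.castHom ℝ).toAddMonoidHom (by
      rw [AddSubgroup.zmultiples_le]
      exact ⟨1, by simp⟩)
  have hr : ∀ x, r x = 0 → x = 0 := by
    intro x
    induction x using QuotientAddGroup.induction_on with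
    | H x =>
      intro h
      obtain ⟨k, hk⟩ := (QuotientAddGroup.eq_zero_iff _).1 h
      refine (QuotientAddGroup.eq_zero_iff _).2 ⟨k, ?_⟩
      have : (k : ℝ) = (x : ℝ) := by simpa using hk
      have : (k : ℚ) = x := by exact_mod_cast this
      simpa using this
  refine ⟨fun x => r (d (Additive.ofMul (Abelianization.of x))), fun x y => ?_, g, ?_⟩
  · simp only [map_mul, ofMul_mul, map_add]
  · exact norm_pos_iff.2 fun h => hd (hr _ h)

/-- The range of `c` is totally bounded, being contained in a compact group. -/
theorem exists_finite_cover {G : Type u} [Group G] {c : G → AddCircle (1 : ℝ)}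
    (hc : ∀ x y, c (x * y) = c x + c y) {ε : ℝ} (hε : 0 < ε) :
    ∃ (k : ℕ) (s : Fin k → G), ∀ x, ∃ i, ‖c ((s i)⁻¹ * x)‖ < ε := by
  have hc' : ∀ x y, c (x⁻¹ * y) = c y - c x := by
    intro x y
    rw [eq_sub_iff_add_eq', ← hc, mul_inv_cancel_left]
  have : TotallyBounded (Set.range c) := isCompact_univ.totallyBounded.subset (Set.subset_univ _)
  obtain ⟨t, ht, htf, hcov⟩ := this.exists_subset (Metric.dist_mem_uniformity hε)
  obtain ⟨k, e, -, he⟩ := htf.fin_param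
  choose s hs using fun i => ht (he ▸ Set.mem_range_self i : e i ∈ t)
  refine ⟨k, s, fun x => ?_⟩
  obtain ⟨y, hy, hxy⟩ := Set.mem_iUnion₂.1 (hcov ⟨x, rfl⟩)
  rw [← he] at hy
  obtain ⟨i, rfl⟩ := hy
  refine ⟨i, ?_⟩
  rw [hc', hs, ← dist_eq_norm]
  exact hxy

/-- The relation symbols of the expansion of a group by a sequence of unary predicates. -/
inductive NbhdRel : ℕ → Type u
  | nbhd (k : ℕ) : NbhdRel 1

/-- The language of a group with a sequence of unary predicates. -/
def nbhdLang : FirstOrder.Language.{u, u} := ⟨IndFun, NbhdRel⟩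

namespace nbhdLang

/-- The symbol for the multiplication. -/
def mulSymb : nbhdLang.{u}.Functions 2 := IndFun.mul

/-- The symbols for the predicates. -/
def nbhdSymb (k : ℕ) : nbhdLang.{u}.Relations 1 := NbhdRel.nbhd k

/-- The group `G` with the sequence `U` of subsets. -/
abbrev structureOfSets {G : Type u} [Group G] (U : ℕ → Set G) : nbhdLang.{u}.Structure G where
  funMap f := match f with
    | IndFun.mul => fun v => v 0 * v 1
  RelMap R := match R with
    | NbhdRel.nbhd k => fun v => v 0 ∈ U k

variable {G N : Type u} [Group G] [nbhdLang.{u}.Structure G] [nbhdLang.{u}.Structure N]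

/-- A product of variables. -/
abbrev mulTerm {α : Type*} (x y : nbhdLang.{u}.Term α) : nbhdLang.{u}.Term α := mulSymb.apply₂ x y

/-- A monster model comes only as a structure; its group law is recovered from that of `G` by
elementarity. -/
theorem exists_group (hG : ∀ x y : G, Structure.funMap mulSymb ![x, y] = x * y)
    (e : G ↪ₑ[nbhdLang.{u}] N) : ∃ _ : Group N,
      ∀ x y : N, Structure.funMap mulSymb ![x, y] = x * y := by
  let mu : N → N → N := fun x y => Structure.funMap mulSymb ![x, y]
  have assoc : ∀ x y z, mu (mu x y) z = mu x (mu y z) := by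
    intro x y z
    have := all_transfer e (ι := Fin 3) (α := Empty)
      (Term.equal (mulTerm (mulTerm (Term.var (Sum.inr 0)) (Term.var (Sum.inr 1)))
          (Term.var (Sum.inr 2)))
        (mulTerm (Term.var (Sum.inr 0)) (mulTerm (Term.var (Sum.inr 1)) (Term.var (Sum.inr 2)))))
      Empty.elim (by intro v; simp [hG, mul_assoc]) ![x, y, z]
    simpa using this
  have one : ∀ x, mu (e 1) x = x := by
    intro x
    have := all_transfer e (ι := Fin 1) (α := Unit)
      (Term.equal (mulTerm (Term.var (Sum.inl ())) (Term.var (Sum.inr 0))) (Term.var (Sum.inr 0)))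
      (fun _ => 1) (by intro v; simp [hG]) ![x]
    simpa using this
  have inv : ∀ x, ∃ y, mu y x = e 1 := by
    intro x
    have := all_transfer e (ι := Fin 1) (α := Unit)
      (Formula.iExs (Fin 1) (Term.equal (mulTerm (Term.var (Sum.inr 0))
        (Term.var (Sum.inl (Sum.inr 0)))) (Term.var (Sum.inl (Sum.inl ())))))
      (fun _ => 1) (by intro v; simpa [hG] using ⟨fun _ => (v 0)⁻¹, by simp⟩) ![x]
    simp only [Formula.realize_iExs, Formula.realize_equal] at this
    obtain ⟨y, hy⟩ := this
    exact ⟨y 0, by simpa using hy⟩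
  choose iv hiv using inv
  let : Mul N := ⟨mu⟩
  let : One N := ⟨e 1⟩
  let : Inv N := ⟨iv⟩
  exact ⟨Group.ofLeftAxioms assoc one hiv, fun _ _ => rfl⟩

/-- The predicates interpreted in a structure. -/
def nbhd (N : Type u) [nbhdLang.{u}.Structure N] (k : ℕ) : Set N :=
  {x | Structure.RelMap (nbhdSymb k) ![x]}

/-- The intersection of the predicates is a proper invariant subgroup. A coset is determined by
choosing, for each `k`, one of the finitely many translates of the predicate at `k + 1` containing
it, so there are at most continuum many. -/
theorem comp000_ne_top {N : Type u} [nbhdLang.{u}.Structure N] [Group N] {κ : Cardinal.{u}}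
    (hN : ∀ x y : N, Structure.funMap mulSymb ![x, y] = x * y) (hκ : κ.IsStrongLimit)
    (hκ0 : Cardinal.aleph0 < κ) (h1 : ∀ k, (1 : N) ∈ nbhd N k)
    (h2 : ∀ k, ∀ x ∈ nbhd N (k + 1), ∀ y ∈ nbhd N (k + 1), x⁻¹ * y ∈ nbhd N k)
    (h3 : ∀ k, ∃ (K : ℕ) (s : Fin K → N), ∀ x, ∃ i, (s i)⁻¹ * x ∈ nbhd N k)
    (h4 : ∃ g, g ∉ nbhd N 0) : comp000 nbhdLang.{u} κ ∅ (fun (x : N) (_ : Unit) => x) ≠ ⊤ := by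
  have hinv : ∀ k, ∀ x ∈ nbhd N (k + 1), x⁻¹ ∈ nbhd N k := fun k x hx => by
    simpa using h2 k x hx 1 (h1 _)
  let H : Subgroup N :=
    { carrier := {x | ∀ k, x ∈ nbhd N k}
      one_mem' := h1
      mul_mem' := fun {x y} hx hy k => by simpa using h2 k _ (hinv _ x (hx _)) y (hy _)
      inv_mem' := fun {x} hx k => hinv k x (hx _) }
  have hle : comp000 nbhdLang.{u} κ ∅ (fun (x : N) (_ : Unit) => x) ≤ H := by
    refine comp000_le ?_ ?_
    · have hc : IsCoord nbhdLang.{u} ∅ (fun (x : N) (_ : Unit) => x) := {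
        injective := fun x y hxy => congrFun hxy ()
        exists_hom := fun τ _ => ⟨MonoidHom.mk' τ fun x y => by
          rw [← hN, ← hN, τ.map_fun]
          congr 1
          funext i
          fin_cases i <;> rfl, fun _ => rfl⟩ }
      refine hc.isInvariant_iff.2 fun τ _ x y hxy hx k => ?_
      obtain rfl : y = τ x := congrFun hxy ()
      have := (τ.map_rel (nbhdSymb k) ![x]).2 (hx k)
      have h : (τ ∘ ![x] : Fin 1 → N) = ![τ x] := by
        funext i
        fin_cases i
        rfl
      rwa [h] at this
    · choose K s hs using h3
      choose i hi using hs
      refine (mk_quotient_le_of_map H (fun x => fun k : ULift.{u} ℕ =>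
        ULift.up.{u} (i (k.down + 1) x : ℕ)) fun x y hxy k => ?_).trans_lt (mk_fun_lt hκ ?_ ?_ hκ0)
      · have : i (k + 1) x = i (k + 1) y := Fin.ext (congrArg ULift.down (congrFun hxy ⟨k⟩))
        have h := h2 k _ (hi (k + 1) x) _ (hi (k + 1) y)
        rw [this] at h
        simpa [mul_assoc] using h
      · simpa using hκ0
      · simpa using hκ0
  obtain ⟨g, hg⟩ := h4
  intro htop
  exact hg ((htop ▸ hle) (Subgroup.mem_top g) 0)

/-- The language has no inverse, so `x⁻¹ * y` enters as the `z` with `x * z = y`. -/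
theorem nbhd_transfer (hG : ∀ x y : G, Structure.funMap mulSymb ![x, y] = x * y)
    [Group N] (hN : ∀ x y : N, Structure.funMap mulSymb ![x, y] = x * y)
    (e : G ↪ₑ[nbhdLang.{u}] N) (k : ℕ)
    (h : ∀ x ∈ nbhd G (k + 1), ∀ y ∈ nbhd G (k + 1), x⁻¹ * y ∈ nbhd G k) :
    ∀ x ∈ nbhd N (k + 1), ∀ y ∈ nbhd N (k + 1), x⁻¹ * y ∈ nbhd N k := by
  intro x hx y hy
  have := all_transfer e (ι := Fin 3) (α := Empty)
    (((nbhdSymb (k + 1)).formula₁ (Term.var (Sum.inr 0))).imp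
      (((nbhdSymb (k + 1)).formula₁ (Term.var (Sum.inr 1))).imp
      ((Term.equal (mulTerm (Term.var (Sum.inr 0)) (Term.var (Sum.inr 2)))
        (Term.var (Sum.inr 1))).imp ((nbhdSymb k).formula₁ (Term.var (Sum.inr 2))))))
    Empty.elim (by
      intro v
      simp only [Formula.realize_imp, Formula.realize_rel₁, Formula.realize_equal,
        Term.realize_functions_apply₂, Term.realize_var, Sum.elim_inr, hG]
      intro hx hy hz
      rw [← eq_inv_mul_iff_mul_eq] at hz
      rw [hz]
      exact h _ hx _ hy) ![x, y, x⁻¹ * y]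
  simp only [Formula.realize_imp, Formula.realize_rel₁, Formula.realize_equal,
    Term.realize_functions_apply₂, Term.realize_var, Sum.elim_inr, hN] at this
  exact this hx hy (by simp)

theorem cover_transfer (hG : ∀ x y : G, Structure.funMap mulSymb ![x, y] = x * y)
    [Group N] (hN : ∀ x y : N, Structure.funMap mulSymb ![x, y] = x * y)
    (e : G ↪ₑ[nbhdLang.{u}] N) (k : ℕ) {K : ℕ} (s : Fin K → G)
    (h : ∀ x, ∃ i, (s i)⁻¹ * x ∈ nbhd G k) (x : N) : ∃ i, (e (s i))⁻¹ * x ∈ nbhd N k := by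
  have := all_transfer e (ι := Fin 1)
    (Formula.iExs (Fin 1) (Formula.iSup fun i : Fin K =>
      (Term.equal (mulTerm (Term.var (Sum.inl (Sum.inl i))) (Term.var (Sum.inr 0)))
        (Term.var (Sum.inl (Sum.inr 0)))) ⊓ (nbhdSymb k).formula₁ (Term.var (Sum.inr 0))))
    s (by
      intro v
      simp only [Formula.realize_iExs, Formula.realize_iSup, Formula.realize_inf,
        Formula.realize_rel₁, Formula.realize_equal,
        Term.realize_functions_apply₂, Term.realize_var, Sum.elim_inr, Sum.elim_inl, hG]
      obtain ⟨i, hi⟩ := h (v 0)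
      exact ⟨fun _ => (s i)⁻¹ * v 0, i, by simp, hi⟩) (fun _ => x)
  simp only [Formula.realize_iExs, Formula.realize_iSup, Formula.realize_inf,
    Formula.realize_rel₁, Formula.realize_equal,
    Term.realize_functions_apply₂, Term.realize_var, Sum.elim_inr, Sum.elim_inl, hN] at this
  obtain ⟨z, i, hi, hz⟩ := this
  refine ⟨i, ?_⟩
  rw [← eq_inv_mul_iff_mul_eq] at hi
  rw [hi] at hz
  exact hz

theorem map_mem_nbhd {G N : Type u} [nbhdLang.{u}.Structure G] [nbhdLang.{u}.Structure N]
    (e : G ↪ₑ[nbhdLang.{u}] N) (k : ℕ) (x : G) :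
    e x ∈ nbhd N k ↔ x ∈ nbhd G k := by
  rw [nbhd, nbhd, Set.mem_ofPred_eq, Set.mem_ofPred_eq, ← e.map_rel]
  apply iff_of_eq
  congr 1
  funext i
  fin_cases i
  rfl

end nbhdLang

/-- An absolutely connected group is perfect. -/
theorem AbsolutelyConnected.commutator_eq_top {G : Type u} [Group G] (hG : AbsolutelyConnected G) :
    commutator G = ⊤ := by
  by_contra hne
  obtain ⟨c, hc, g, hg⟩ := exists_norm_character hne
  have hc1 : c 1 = 0 := by simpa using hc 1 1
  have hc' : ∀ x y, c (x⁻¹ * y) = c y - c x := by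
    intro x y
    rw [eq_sub_iff_add_eq', ← hc, mul_inv_cancel_left]
  -- Halving the radius gives U_{k+1}⁻¹ U_{k+1} ⊆ U_k by the triangle inequality; starting at `‖c
  -- g‖` itself keeps `g` out of U_0.
  let ε : ℕ → ℝ := fun k => ‖c g‖ / 2 ^ k
  have hε : ∀ k, 0 < ε k := fun k => by positivity
  let _ := nbhdLang.structureOfSets.{u} fun k => {x : G | ‖c x‖ < ε k}
  have hmem : ∀ k (x : G), x ∈ nbhdLang.nbhd G k ↔ ‖c x‖ < ε k := fun k x => Iff.rfl
  have hmul : ∀ x y : G, Structure.funMap nbhdLang.mulSymb ![x, y] = x * y := fun _ _ => rfl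
  obtain ⟨κ, N, _, hN, ⟨e⟩⟩ := exists_isMonster nbhdLang.{u} G
  obtain ⟨_, hNmul⟩ := nbhdLang.exists_group hmul e
  refine nbhdLang.comp000_ne_top hNmul hN.strongLimit hN.aleph0_lt ?_ (fun k =>
    nbhdLang.nbhd_transfer hmul hNmul e k ?_) (fun k => ?_) ?_
    (hG.2 nbhdLang.{u} nbhdLang.mulSymb hmul N hNmul κ hN ⟨e⟩ ∅
      (by simpa using Cardinal.aleph0_pos.trans hN.aleph0_lt))
  · intro k
    have h1 : e 1 = 1 := by
      have := e.map_fun nbhdLang.mulSymb ![1, 1]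
      rw [hmul] at this
      have h2 : (e ∘ ![1, 1] : Fin 2 → N) = ![e 1, e 1] := by
        funext i
        fin_cases i <;> rfl
      rw [h2, hNmul, mul_one] at this
      exact mul_eq_left.1 this.symm
    rw [← h1, nbhdLang.map_mem_nbhd, hmem, hc1, norm_zero]
    exact hε k
  · intro x hx y hy
    rw [hmem] at hx hy ⊢
    rw [hc']
    have : ε k = ε (k + 1) + ε (k + 1) := by
      simp only [ε, pow_succ]
      field_simp
      ring
    rw [this, add_comm]
    exact (norm_sub_le _ _).trans_lt (add_lt_add hy hx)
  · obtain ⟨K, s, hs⟩ := exists_finite_cover hc (hε k)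
    exact ⟨K, fun i => e (s i), nbhdLang.cover_transfer hmul hNmul e k s hs⟩
  · refine ⟨e g, ?_⟩
    rw [nbhdLang.map_mem_nbhd, hmem]
    simp [ε]

end Perfect


/-! ### Products of boundedly many commutators and their transfer to `G*`. -/

section CommutatorProducts

/-- The products of `k` commutators. -/
def commProds (Γ : Type*) [Group Γ] : ℕ → Set Γ
  | 0 => {1}
  | k + 1 => {g | ∃ z ∈ commProds Γ k, ∃ x y, g * (y * x) = z * (x * y)}

theorem commProds_mono (Γ : Type*) [Group Γ] : Monotone (commProds Γ) :=
  monotone_nat_of_le_succ fun _ g hg => ⟨g, hg, 1, 1, rfl⟩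

theorem commProds_subset_ker {Γ Q : Type*} [Group Γ] [CommGroup Q] (f : Γ →* Q) (k : ℕ) :
    commProds Γ k ⊆ f.ker := by
  induction k with
  | zero =>
    rintro _ rfl
    exact f.ker.one_mem
  | succ k ih =>
    rintro g ⟨z, hz, x, y, h⟩
    have hz : f z = 1 := ih hz
    have := congrArg f h
    simp only [map_mul, hz, one_mul, mul_comm (f y)] at this
    exact mul_eq_right.1 this

theorem commProds_map {Γ Γ' : Type*} [Group Γ] [Group Γ'] (f : Γ →* Γ')
    (hf : Function.Surjective f) (k : ℕ) : ∀ g' ∈ commProds Γ' k, ∃ g ∈ commProds Γ k, f g = g' := by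
  induction k with
  | zero =>
    rintro _ rfl
    exact ⟨1, rfl, map_one f⟩
  | succ k ih =>
    rintro g' ⟨z', hz', x', y', h⟩
    obtain ⟨z, hz, rfl⟩ := ih z' hz'
    obtain ⟨x, rfl⟩ := hf x'
    obtain ⟨y, rfl⟩ := hf y'
    refine ⟨z * (x * y) * (y * x)⁻¹, ⟨z, hz, x, y, by group⟩, ?_⟩
    rw [map_mul, map_inv, map_mul, map_mul, map_mul, ← h, mul_inv_cancel_right]

/-- Trivial commutators pad shorter products, so "at most `k`" becomes exactly `k`. The list is read
from its end because `commProds` adds factors on the right. -/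
theorem FiniteCommutatorWidth.exists_commProds {G : Type u} [Group G]
    (hw : FiniteCommutatorWidth G) (hG : commutator G = ⊤) : ∃ k, ∀ g : G, g ∈ commProds G k := by
  obtain ⟨k, hk⟩ := hw
  refine ⟨k, fun g => ?_⟩
  obtain ⟨l, hl, hc, rfl⟩ := hk g (hG ▸ Subgroup.mem_top g)
  refine commProds_mono G hl ?_
  clear hl
  induction l using List.reverseRecOn with
  | nil => rfl
  | append_singleton l a ih =>
    obtain ⟨x, y, rfl⟩ := hc a (by simp)
    rw [List.length_append]
    refine ⟨l.prod, ih fun x hx => hc x (by simp [hx]), x, y, ?_⟩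
    rw [List.prod_append, List.prod_singleton, commutatorElement_def]
    group

theorem commutator_eq_top_of_commProds {G : Type*} [Group G] {k : ℕ}
    (h : ∀ g : G, g ∈ commProds G k) : commutator G = ⊤ := by
  rw [eq_top_iff]
  intro g _
  have := commProds_subset_ker (Abelianization.of (G := G)) k (h g)
  rwa [Abelianization.ker_of] at this

variable {L : FirstOrder.Language.{u, u}} {β : Type u} {n m : ℕ} {D : ExtFormulas L β n m}

/-- In `commProds` the relation g = z·[x, y] appears without inverses, as g(yx) = z(xy), so the
multiplication formula and six auxiliary elements suffice. -/
theorem uniformlyDefinable_commProds (k : ℕ) :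
    UniformlyDefinable D (α := Unit) fun I v => v () ∈ commProds I.G k := by
  induction k with
  | zero => exact UniformlyDefinable.one ()
  | succ k ih =>
    let i : Fin 6 → Unit ⊕ Fin 6 := Sum.inr
    refine (((((ih.comp fun _ => i 0).and (UniformlyDefinable.mul (i 1) (i 2) (i 3))).and
      (UniformlyDefinable.mul (i 2) (i 1) (i 4))).and
      (UniformlyDefinable.mul (Sum.inl ()) (i 4) (i 5))).and
      (UniformlyDefinable.mul (i 0) (i 3) (i 5))).ex.congr fun I v => ?_
    constructor
    · rintro ⟨w, ⟨⟨⟨h0, h1⟩, h2⟩, h3⟩, h4⟩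
      refine ⟨w 0, h0, w 1, w 2, ?_⟩
      change w 1 * w 2 = w 3 at h1
      change w 2 * w 1 = w 4 at h2
      change v () * w 4 = w 5 at h3
      change w 0 * w 3 = w 5 at h4
      rw [h1, h2, h3, h4]
    · rintro ⟨z, hz, x, y, h⟩
      exact ⟨![z, x, y, x * y, y * x, z * (x * y)], ⟨⟨⟨hz, rfl⟩, rfl⟩, h⟩, rfl⟩

theorem forall_mem_commProds {M N : Type u} [L.Structure M] [L.Structure N] {b : β → M}
    {b' : β → N} (I : Interp D M b) (I' : Interp D N b') (e : M ↪ₑ[L] N)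
    (hb : ∀ x, b' x = e (b x)) {k : ℕ} (h : ∀ g : I.G, g ∈ commProds I.G k) (g : I'.G) :
    g ∈ commProds I'.G k := by
  have := (((uniformlyDefinable_commProds (D := D) k).comp
    (Sum.inr : Unit → Empty ⊕ Unit)).all.iff_map I I' e hb Empty.elim).2 fun g => h (g ())
  exact this fun _ => g

end CommutatorProducts

/-! ### Type-definability in the extension. -/

section TypeDefinable

variable {L : FirstOrder.Language.{u, u}} {β : Type u} {n m : ℕ} {D : ExtFormulas L β n m}
  {N : Type u} [L.Structure N] {b : β → N} {κ : Cardinal.{u}} {P : Set N} (I : Interp D N b)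

theorem IsTypeDefinable.iInter {ι : Type} {J : Sort*} {X : J → Set (ι → N)}
    (hX : ∀ i, IsTypeDefinable L P (X i)) : IsTypeDefinable L P (⋂ i, X i) := by
  choose S hS hXS using hX
  refine ⟨⋃ i, S i, ?_, ?_⟩
  · intro s hs
    obtain ⟨i, hi⟩ := Set.mem_iUnion.1 hs
    exact hS i s hi
  · rw [Set.sInter_iUnion]
    exact Set.iInter_congr hXS

theorem exists_formula_ext_mul (D : ExtFormulas L β n m) :
    ∃ φ : L.Formula (β ⊕ ((Fin m ⊕ Fin n) ⊕ ((Fin m ⊕ Fin n) ⊕ (Fin m ⊕ Fin n)))),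
      ∀ {K : Type u} [L.Structure K] {b : β → K} (I : Interp D K b) (p q r : I.Ext),
        φ.Realize (Sum.elim b (Sum.elim (I.coordExt p) (Sum.elim (I.coordExt q) (I.coordExt r)))) ↔
          p * q = r := by
  let V := β ⊕ ((Fin m ⊕ Fin n) ⊕ ((Fin m ⊕ Fin n) ⊕ (Fin m ⊕ Fin n)))
  let p₁ : Fin m ⊕ Fin n → V := Sum.inr ∘ Sum.inl
  let p₂ : Fin m ⊕ Fin n → V := Sum.inr ∘ Sum.inr ∘ Sum.inl
  let p₃ : Fin m ⊕ Fin n → V := Sum.inr ∘ Sum.inr ∘ Sum.inr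
  -- The three auxiliary elements of the abelian group are g • a', a + g • a' and h(g, g').
  let c : Fin 3 → Fin m → V ⊕ (Fin 3 × Fin m) := fun k i => Sum.inr (k, i)
  refine ⟨D.mul.relabel (Sum.elim (p₁ ∘ Sum.inr) (Sum.elim (p₂ ∘ Sum.inr) (p₃ ∘ Sum.inr))) ⊓
    Formula.iExs (Fin 3 × Fin m) ((Formula.iInf fun k : Fin 3 => D.domA.relabel (c k)) ⊓
      (D.act.relabel (Sum.elim (Sum.inl ∘ p₁ ∘ Sum.inr)
        (Sum.elim (Sum.inl ∘ p₂ ∘ Sum.inl) (c 0))) ⊓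
      (D.add.relabel (Sum.elim (Sum.inl ∘ p₁ ∘ Sum.inl) (Sum.elim (c 0) (c 1))) ⊓
      (D.coc.relabel (Sum.elim (Sum.inl ∘ Sum.inl) (Sum.elim (Sum.inl ∘ p₁ ∘ Sum.inr)
        (Sum.elim (Sum.inl ∘ p₂ ∘ Sum.inr) (c 2)))) ⊓
      D.add.relabel (Sum.elim (c 1) (Sum.elim (c 2) (Sum.inl ∘ p₃ ∘ Sum.inl))))))),
    fun {K} _ {b} I p q r => ?_⟩
  simp only [Formula.realize_inf, Formula.realize_relabel, Formula.realize_iExs,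
    Formula.realize_iInf, Sum.comp_elim]
  constructor
  · rintro ⟨h1, w, hw, h2, h3, h4, h5⟩
    have e1 := (I.mul_iff p.snd q.snd r.snd).1 h1
    have e2 := (I.act_iff p.snd q.fst ⟨_, hw 0⟩).1 h2
    have e3 := (I.add_iff p.fst ⟨_, hw 0⟩ ⟨_, hw 1⟩).1 h3
    have e4 := (I.coc_iff p.snd q.snd ⟨_, hw 2⟩).1 h4
    have e5 := (I.add_iff ⟨_, hw 1⟩ ⟨_, hw 2⟩ r.fst).1 h5
    rw [← e3, ← e4, ← e2] at e5
    exact Cocycle.Ext.ext e5 e1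
  · rintro rfl
    refine ⟨(I.mul_iff p.snd q.snd _).2 rfl, fun x => I.coordA (![p.snd • q.fst,
      p.fst + p.snd • q.fst, I.h.toFun p.snd q.snd] x.1) x.2, fun k => (![p.snd • q.fst,
      p.fst + p.snd • q.fst, I.h.toFun p.snd q.snd] k).2, ?_, ?_, ?_, ?_⟩
    · exact (I.act_iff p.snd q.fst _).2 rfl
    · exact (I.add_iff p.fst (p.snd • q.fst : I.A) _).2 rfl
    · exact (I.coc_iff p.snd q.snd _).2 rfl
    · exact (I.add_iff (p.fst + p.snd • q.fst : I.A) (I.h.toFun p.snd q.snd) _).2 rfl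

/-- Sets of elements of the extension given by systems of equations are type-definable. -/
theorem isTypeDefinable_ext_solutions (hN : IsMonster L κ N) (hP : Cardinal.mk P < κ)
    (hb : ∀ x, b x ∈ P) {ι : Type} [Finite ι] (X : ι → Set I.Ext)
    (hX : ∀ i, IsTypeDefinable L P (I.coordExt '' X i)) (E : Set (ι × ι × ι)) (o : ι) :
    IsTypeDefinable L P (I.coordExt '' {p | ∃ w : ι → I.Ext, (∀ i, w i ∈ X i) ∧
      (∀ e ∈ E, w e.1 * w e.2.1 = w e.2.2) ∧ w o = p}) := by
  obtain ⟨φ, hφ⟩ := exists_formula_ext_mul D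
  let T := Fin m ⊕ Fin n
  let pr : ι → T → T ⊕ (ι × T) := fun i t => Sum.inr (i, t)
  have h1 : ∀ i, IsTypeDefinable L P {x : T ⊕ (ι × T) → N | x ∘ pr i ∈ I.coordExt '' X i} :=
    fun i => (hX i).preimage_comp _
  have h2 : ∀ e : E, IsTypeDefinable L P {x : T ⊕ (ι × T) → N | Formula.Realize (φ.relabel
      (Sum.map id (Sum.elim (pr e.1.1) (Sum.elim (pr e.1.2.1) (pr e.1.2.2))))) (Sum.elim b x)} :=
    fun e => isTypeDefinable_formula b hb _
  have h3 : IsTypeDefinable L P {x : T ⊕ (ι × T) → N | Formula.Realize (Formula.iInf fun t : T =>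
      Term.equal (Term.var (Sum.inr (Sum.inl t))) (Term.var (Sum.inr (pr o t)))) (Sum.elim b x)} :=
    isTypeDefinable_formula b hb _
  have h := (((IsTypeDefinable.iInter h1).inter (IsTypeDefinable.iInter h2)).inter h3).exists hN hP
  convert h using 1
  ext u
  simp only [Set.mem_image, Set.mem_ofPred_eq, Set.mem_inter_iff, Set.mem_iInter,
    Formula.realize_relabel, Formula.realize_iInf, Formula.realize_equal, Term.realize_var,
    Sum.elim_inr, Sum.elim_inl, Sum.elim_comp_map, Function.comp_id, Sum.comp_elim]
  have hreal : ∀ (w : ι → I.Ext) (x : T ⊕ (ι × T) → N), (∀ i, I.coordExt (w i) = x ∘ pr i) →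
      ∀ e : ι × ι × ι, φ.Realize (Sum.elim b (Sum.elim (x ∘ pr e.1)
        (Sum.elim (x ∘ pr e.2.1) (x ∘ pr e.2.2)))) ↔ w e.1 * w e.2.1 = w e.2.2 := by
    intro w x hw e
    rw [← hw, ← hw, ← hw, hφ]
  constructor
  · rintro ⟨p, ⟨w, hw, hE, rfl⟩, rfl⟩
    refine ⟨fun x => I.coordExt (w x.1) x.2, ⟨fun i => ⟨w i, hw i, rfl⟩, fun e => ?_⟩,
      fun t => rfl⟩
    exact (hreal w (Sum.elim (I.coordExt (w o)) fun x => I.coordExt (w x.1) x.2) (fun i => rfl)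
      e.1).2 (hE e.1 e.2)
  · rintro ⟨x, ⟨hw, hE⟩, ho⟩
    choose w hwX hw using hw
    refine ⟨w o, ⟨w, hwX, fun e he => ?_, rfl⟩, ?_⟩
    · exact (hreal w (Sum.elim u x) hw e).1 (hE ⟨e, he⟩)
    · rw [hw]
      funext t
      exact (ho t).symm

theorem isTypeDefinable_ext_univ : IsTypeDefinable L P (I.coordExt '' Set.univ) := by
  have h := isTypeDefinable_formula (P := P) (Empty.elim : Empty → N) (fun x => x.elim)
    ((D.domA.relabel (Sum.inr ∘ Sum.inl)) ⊓ (D.domG.relabel (Sum.inr ∘ Sum.inr)))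
  convert h using 1
  ext u
  simp only [Set.mem_image, Set.mem_univ, true_and, Set.mem_ofPred_eq, Formula.realize_inf,
    Formula.realize_relabel]
  constructor
  · rintro ⟨p, rfl⟩
    exact ⟨p.fst.2, p.snd.2⟩
  · rintro ⟨h1, h2⟩
    exact ⟨⟨(⟨_, h1⟩ : Pts D.domA N), (⟨_, h2⟩ : Pts D.domG N)⟩, Sum.elim_comp_inl_inr u⟩

/-- The condition on the second coordinate is again expressed as g * g = g. -/
theorem isTypeDefinable_ext_of_snd_eq_one {A₁ : AddSubgroup I.A}
    (hA₁ : IsTypeDefinable L P (I.coordA '' (A₁ : Set I.A))) :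
    IsTypeDefinable L P (I.coordExt '' {p | p.fst ∈ A₁ ∧ p.snd = 1}) := by
  have h := isTypeDefinable_formula (P := P) (Empty.elim : Empty → N) (fun x => x.elim)
    ((D.domG.relabel (Sum.inr ∘ Sum.inr : Fin n → Empty ⊕ (Fin m ⊕ Fin n))) ⊓
      D.mul.relabel (Sum.elim (Sum.inr ∘ Sum.inr)
        (Sum.elim (Sum.inr ∘ Sum.inr) (Sum.inr ∘ Sum.inr))))
  have h' := (hA₁.preimage_comp (Sum.inl : Fin m → Fin m ⊕ Fin n)).inter h
  convert h' using 1
  ext u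
  simp only [Set.mem_image, Set.mem_inter_iff, Set.mem_ofPred_eq, Formula.realize_inf,
    Formula.realize_relabel, Sum.comp_elim]
  constructor
  · rintro ⟨⟨a, g⟩, ⟨ha, rfl : g = 1⟩, rfl⟩
    exact ⟨⟨a, ha, rfl⟩, (1 : I.G).2, (I.mul_iff (1 : I.G) (1 : I.G) (1 : I.G)).2 (mul_one (1 : I.G))⟩
  · rintro ⟨⟨a, ha, hau⟩, h2, h3⟩
    let g : I.G := (⟨_, h2⟩ : Pts D.domG N)
    have : g * g = g := (I.mul_iff g g g).1 h3
    refine ⟨⟨a, g⟩, ⟨ha, mul_eq_left.1 this⟩, ?_⟩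
    rw [Interp.coordExt, hau]
    exact Sum.elim_comp_inl_inr u

theorem isTypeDefinable_ext_commProds (hN : IsMonster L κ N) (hP : Cardinal.mk P < κ)
    (hb : ∀ x, b x ∈ P) (k : ℕ) : IsTypeDefinable L P (I.coordExt '' commProds I.Ext k) := by
  induction k with
  | zero =>
    convert isTypeDefinable_ext_solutions I hN hP hb (ι := Unit) (fun _ => Set.univ)
      (fun _ => isTypeDefinable_ext_univ I) {((), (), ())} () using 2
    ext p
    constructor
    · rintro rfl
      exact ⟨fun _ => 1, fun _ => trivial, fun _ _ => mul_one _, rfl⟩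
    · rintro ⟨w, -, h, rfl⟩
      exact mul_eq_left.1 (h _ rfl)
  | succ k ih =>
    -- The unknowns 0 to 6 are z, x, y, xy, yx, z(xy) and p; the equations say that p(yx) = z(xy).
    convert isTypeDefinable_ext_solutions I hN hP hb (ι := Fin 7)
      (fun i => if i = 0 then commProds I.Ext k else Set.univ)
      (fun i => by
        split_ifs
        · exact ih
        · exact isTypeDefinable_ext_univ I)
      {(1, 2, 3), (2, 1, 4), (6, 4, 5), (0, 3, 5)} 6 using 2
    ext p
    constructor
    · rintro ⟨z, hz, x, y, h⟩
      refine ⟨![z, x, y, x * y, y * x, z * (x * y), p], fun i => ?_, ?_, rfl⟩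
      · split_ifs with hi
        · subst hi
          exact hz
        · trivial
      · rintro e (rfl | rfl | rfl | rfl)
        exacts [rfl, rfl, h, rfl]
    · rintro ⟨w, hw, hE, rfl⟩
      refine ⟨w 0, by simpa using hw 0, w 1, w 2, ?_⟩
      have e1 := hE (1, 2, 3) (by simp)
      have e2 := hE (2, 1, 4) (by simp)
      have e3 := hE (6, 4, 5) (by simp)
      have e4 := hE (0, 3, 5) (by simp)
      simp only at e1 e2 e3 e4
      rw [e1, e2, e3, e4]

end TypeDefinable

/-! ### Splittings over a perfect group acting trivially modulo `C`. -/

section Splitting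

variable {Γ Q : Type u} [Group Γ] [AddCommGroup Q] [DistribMulAction Γ Q] {h : Cocycle Γ Q}
  {C : AddSubgroup Q} {hC : ∀ g : Γ, ∀ c ∈ C, g • c ∈ C} {F : Γ → Q}

/-- The subgroup is the kernel of the homomorphism θ to an abelian group, so it contains all
products of `k` commutators. These cover `Γ`, so any member can be corrected by one of them to an
element over 1, whose first coordinate is in `C`. The right-hand side no longer involves `F`. -/
theorem Cocycle.SplitsOn.mem_subgroup_iff_commProds (hs : h.SplitsOn C ⊤ F)
    (htriv : ∀ (g : Γ) (a : Q), g • a - a ∈ C) {k : ℕ} (hk : ∀ g : Γ, g ∈ commProds Γ k)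
    (p : h.Ext) : p ∈ hs.subgroup hC ↔
      ∃ q ∈ commProds h.Ext k, ∃ r : h.Ext, (r.fst ∈ C ∧ r.snd = 1) ∧ q * r = p := by
  let θ : h.Ext →* Multiplicative (Q ⧸ C) := MonoidHom.mk' (fun p =>
    Multiplicative.ofAdd (QuotientAddGroup.mk (p.fst + F p.snd))) (by
    intro p q
    rw [← ofAdd_add, ← QuotientAddGroup.mk_add]
    congr 1
    refine QuotientAddGroup.eq_iff_sub_mem.2 ?_
    have := add_mem (hs.mul_sub_mem (p := p) (q := q) trivial trivial)
      (htriv p.snd (q.fst + F q.snd))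
    convert this using 1
    abel)
  have hθ : ∀ p, p ∈ θ.ker ↔ p ∈ hs.subgroup hC := by
    intro p
    rw [hs.mem_subgroup, and_iff_right (Subgroup.mem_top _)]
    exact QuotientAddGroup.eq_zero_iff (N := C) (p.fst + F p.snd)
  have hmem : ∀ q ∈ commProds h.Ext k, q ∈ hs.subgroup hC := fun q hq =>
    (hθ q).1 (commProds_subset_ker θ k hq)
  constructor
  · intro hp
    obtain ⟨q, hq, hqp⟩ := commProds_map (Ext.sndHom h) (fun g => ⟨⟨0, g⟩, rfl⟩) k p.snd (hk _)
    have h1 : (q⁻¹ * p).snd = 1 := by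
      rw [Ext.mul_snd, Ext.inv_snd, ← hqp, Ext.sndHom_apply, inv_mul_cancel]
    refine ⟨q, hq, q⁻¹ * p, ⟨?_, h1⟩, mul_inv_cancel_left _ _⟩
    have h2 := (hs.mem_subgroup.1 (mul_mem (inv_mem (hmem q hq)) hp)).2
    rw [h1] at h2
    simpa using sub_mem h2 hs.one
  · rintro ⟨q, hq, r, ⟨hr, hr1⟩, rfl⟩
    refine mul_mem (hmem q hq) (hs.mem_subgroup.2 ⟨trivial, ?_⟩)
    rw [hr1]
    exact add_mem hr hs.one

/-- Modulo Q₀ + C, with Q₀ the image subgroup, both the cocycle and the action become trivial. `F`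
is then a homomorphism from a perfect group to an abelian one, hence trivial, and its values can be
moved into Q₀ by elements of `C`. -/
theorem Cocycle.isSplitOnMod_of_isSplitMod (hΓ : commutator Γ = ⊤)
    (htriv : ∀ (g : Γ) (a : Q), g • a - a ∈ C) (hsplit : h.IsSplitMod C hC) :
    h.IsSplitOnMod C hC ⊤ := by
  obtain ⟨F, hs⟩ := isSplitMod_iff.1 hsplit
  let S := h.imageSubgroup ⊔ C
  let f : Γ →* Multiplicative (Q ⧸ S) := MonoidHom.mk' (fun x =>
    Multiplicative.ofAdd (QuotientAddGroup.mk (F x))) (by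
    intro x y
    rw [← ofAdd_add, ← QuotientAddGroup.mk_add]
    congr 1
    refine QuotientAddGroup.eq_iff_sub_mem.2 ?_
    have h1 : h.toFun x y ∈ S := AddSubgroup.mem_sup_left (h.mem_imageSubgroup x y)
    have h2 : _ ∈ S := AddSubgroup.mem_sup_right (hs.cocycle_mem x trivial y trivial)
    have h3 : _ ∈ S := AddSubgroup.mem_sup_right (htriv x (F y))
    have := sub_mem (add_mem h2 h3) h1
    convert this using 1
    abel)
  have hF : ∀ x, F x ∈ S := by
    intro x
    have : x ∈ f.ker := Abelianization.commutator_subset_ker f (hΓ ▸ Subgroup.mem_top x)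
    exact (QuotientAddGroup.eq_zero_iff (N := S) (F x)).1 this
  choose F' hF' a ha hFa using fun x => AddSubgroup.mem_sup.1 (hF x)
  refine isSplitOnMod_iff.2 ⟨F', fun x _ => hF' x, ?_, fun x hx y hy => ?_⟩
  · have := sub_mem hs.one (ha 1)
    rwa [← hFa 1, add_sub_cancel_right] at this
  · have h1 := hs.cocycle_mem x hx y hy
    rw [← hFa x, ← hFa y, ← hFa (x * y)] at h1
    have := sub_mem (add_mem (add_mem h1 (ha x)) (hC x _ (ha y))) (ha (x * y))
    convert this using 1
    rw [smul_add]
    abel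

theorem Cocycle.isSplitMod_of_isSplitOnMod (hsplit : h.IsSplitOnMod C hC ⊤) :
    h.IsSplitMod C hC := by
  obtain ⟨F, -, hs⟩ := isSplitOnMod_iff.1 hsplit
  exact isSplitMod_iff.2 ⟨F, hs⟩

end Splitting

namespace Interp

variable {L : FirstOrder.Language.{u, u}} {β : Type u} {n m : ℕ} {D : ExtFormulas L β n m}
  {N : Type u} [L.Structure N] {b : β → N} {κ : Cardinal.{u}} {P : Set N} (I : Interp D N b)
  {A₁ : AddSubgroup I.A}

/-- If `h` splits on `G` modulo `A₁`, then the type-definable component of the extension meets `A`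
within `A₁`. -/
theorem interA_comp00_subset (hN : IsMonster L κ N) (hP : Cardinal.mk P < κ)
    (hb : ∀ x, b x ∈ P) (hA₁ : IsTypeDefinable L P (I.coordA '' (A₁ : Set I.A)))
    (hbdd : Cardinal.mk (I.A ⧸ A₁) < κ) (hinv : ∀ g : I.G, ∀ a ∈ A₁, g • a ∈ A₁)
    (htop : comp000 L κ P I.coordG = ⊤) {k : ℕ} (hk : ∀ g : I.G, g ∈ commProds I.G k)
    (hsplit : I.h.IsSplitOnMod A₁ hinv ⊤) : I.interA (comp00 L κ P I.coordExt) ⊆ A₁ := by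
  obtain ⟨F, hF, hs⟩ := Cocycle.isSplitOnMod_iff.1 hsplit
  have htriv : ∀ (g : I.G) (a : I.A), g • a - a ∈ A₁ := fun g a =>
    smul_sub_mem_of_mem_comp000 I hN hA₁.isInvariant hbdd hinv g (htop ▸ Subgroup.mem_top g) a
  have hle : comp00 L κ P I.coordExt ≤ hs.subgroup hinv := by
    refine comp00_le ?_ ((hs.mk_quotient_le fun g _ => htriv g).trans_lt
      (Cardinal.mul_lt_of_lt hN.aleph0_lt.le
        (htop ▸ mk_quotient_comp000_lt hN hP (isCoord_coordG I P)) hbdd))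
    -- The subgroup is described as products of `k` commutators times A₁, a system of equations over
    -- type-definable sets.
    convert isTypeDefinable_ext_solutions I hN hP hb (ι := Fin 3)
      ![commProds I.Ext k, {p | p.fst ∈ A₁ ∧ p.snd = 1}, Set.univ] (fun i => by
        fin_cases i
        · exact isTypeDefinable_ext_commProds I hN hP hb k
        · exact isTypeDefinable_ext_of_snd_eq_one I hA₁
        · exact isTypeDefinable_ext_univ I) {(0, 1, 2)} 2 using 2
    ext p
    refine (hs.mem_subgroup_iff_commProds htriv hk p).trans ?_
    constructor
    · rintro ⟨q, hq, r, hr, h⟩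
      refine ⟨![q, r, p], fun i => ?_, ?_, rfl⟩
      · fin_cases i
        exacts [hq, hr, trivial]
      · rintro _ rfl
        exact h
    · rintro ⟨w, hw, hE, rfl⟩
      exact ⟨w 0, hw 0, w 1, hw 1, hE _ rfl⟩
  intro a ha
  have h1 := (hle ha).2
  have := sub_mem h1 hs.one
  rwa [add_sub_cancel_right] at this

end Interp

end ConnComp

/-! ### The proposition. -/

theorem mainTheorem5 {L : FirstOrder.Language.{u, u}} {M N : Type u} [L.Structure M]
    [L.Structure N] (κ : Cardinal.{u}) (hN : ConnComp.IsMonster L κ N) (j : M ↪ₑ[L] N)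
    (B : Set M) (hB : B.Finite) {n m : ℕ} (D : ConnComp.ExtFormulas L B n m)
    (I : ConnComp.Interp D M (fun b : B => (b : M)))
    (hfin : (Set.range fun p : I.G × I.G => I.h.toFun p.1 p.2).Finite)
    (hdcl : ∀ x y : I.G, B.Definable L {I.coordA (I.h.toFun x y)})
    (A₁ : AddSubgroup (I.star j).A)
    (hA₁_type : ConnComp.IsTypeDefinable L (j '' B) ((I.star j).coordA '' (A₁ : Set (I.star j).A)))
    (hA₁_bdd : Cardinal.mk ((I.star j).A ⧸ A₁) < κ)
    (hA₁_inv : ∀ g : (I.star j).G, ∀ a ∈ A₁, g • a ∈ A₁) :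
    (Subsingleton
        (ConnComp.comp000 L κ (j '' B) (I.star j).coordG →*
          Multiplicative ((I.star j).h.ImageQuot A₁)) →
      (¬ (I.star j).h.IsSplitOnMod A₁ hA₁_inv
          (ConnComp.comp000 L κ (j '' B) (I.star j).coordG) ↔
        ¬ (I.star j).interA (ConnComp.comp000 L κ (j '' B) (I.star j).coordExt) ⊆ A₁)) ∧
    (ConnComp.AbsolutelyConnected I.G → ConnComp.FiniteCommutatorWidth I.G →
      ConnComp.comp000 L κ (j '' B) (I.star j).coordG = ⊤ ∧
      ConnComp.comp00 L κ (j '' B) (I.star j).coordG = ⊤ ∧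
      commutator (I.star j).G = ⊤ ∧
      (¬ (I.star j).h.IsSplitOnMod A₁ hA₁_inv
          (ConnComp.comp00 L κ (j '' B) (I.star j).coordG) ↔
        ¬ (I.star j).interA (ConnComp.comp00 L κ (j '' B) (I.star j).coordExt) ⊆ A₁) ∧
      (¬ (I.star j).h.IsSplitOnMod A₁ hA₁_inv
          (ConnComp.comp00 L κ (j '' B) (I.star j).coordG) ↔
        ¬ (I.star j).h.IsSplitMod A₁ hA₁_inv)) := by
  have hP : Cardinal.mk (j '' B) < κ :=
    (Cardinal.lt_aleph0_iff_set_finite.2 (hB.image j)).trans hN.aleph0_lt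
  have hb : ∀ x : B, (j ∘ fun b : B => (b : M)) x ∈ j '' B := fun x => ⟨x, x.2, rfl⟩
  have hfix := ConnComp.Interp.aut_fixes_h_star I j hfin hdcl
  refine ⟨fun hsub => not_congr ⟨ConnComp.Interp.interA_comp000_subset _ hN hP hb hfix
    hA₁_type.isInvariant hA₁_bdd hA₁_inv hsub, ConnComp.Interp.isSplitOnMod_comp000 _ hN hP hb hfix
    hA₁_type.isInvariant hA₁_bdd hA₁_inv⟩, fun hG hw => ?_⟩
  have h000 : ConnComp.comp000 L κ (j '' B) (I.star j).coordG = ⊤ :=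
    hG.comp000_eq_top (I.star j) hN j (fun _ => rfl)
      ((Cardinal.lt_aleph0_iff_set_finite.2 hB).trans hN.aleph0_lt)
      (by rintro _ ⟨x, hx, rfl⟩; exact ⟨⟨x, hx⟩, rfl⟩)
  have h00 : ConnComp.comp00 L κ (j '' B) (I.star j).coordG = ⊤ :=
    top_le_iff.1 (h000 ▸ ConnComp.comp000_le_comp00)
  obtain ⟨k, hk⟩ := hw.exists_commProds hG.commutator_eq_top
  have hk' := ConnComp.forall_mem_commProds I (I.star j) j (fun _ => rfl) hk
  have hperf := ConnComp.commutator_eq_top_of_commProds hk'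
  have htriv : ∀ (g : (I.star j).G) (a : (I.star j).A), g • a - a ∈ A₁ := fun g a =>
    ConnComp.Interp.smul_sub_mem_of_mem_comp000 _ hN hA₁_type.isInvariant hA₁_bdd hA₁_inv g
      (h000 ▸ Subgroup.mem_top g) a
  -- The implication of part (i) which needs no assumption on Hom. It also serves the 00-component,
  -- which contains the 000-component, so the inclusion in A₁ is inherited.
  have hiff := @ConnComp.Interp.isSplitOnMod_comp000 _ _ _ _ _ _ _ _ κ (j '' B) (I.star j) A₁ hN hP
    hb hfix hA₁_type.isInvariant hA₁_bdd hA₁_inv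
  rw [h000] at hiff
  refine ⟨h000, h00, hperf, not_congr ?_, not_congr ?_⟩
  · rw [h00]
    exact ⟨ConnComp.Interp.interA_comp00_subset _ hN hP hb hA₁_type hA₁_bdd hA₁_inv h000 hk',
      fun h => hiff fun a ha => h (ConnComp.comp000_le_comp00 ha)⟩
  · rw [h00]
    exact ⟨ConnComp.Cocycle.isSplitMod_of_isSplitOnMod,
      ConnComp.Cocycle.isSplitOnMod_of_isSplitMod hperf htriv⟩
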